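/- Let $\{X_t\}_{t\in\mathbb Z}$ be a strictly stationary $\mathbb R^m$-valued time series with finite second moments, $\gamma_{jk}(h)=\mathrm{Cov}(X_{t+h,j},X_{t,k})$ and $f_{jk}(w)=\frac1{2\pi}\sum_{h\in\mathbb Z}e^{-iwh}\gamma_{jk}(h)$. *Assumption A(4).* For all $j,k$ the series defining $f_{jk}$ converges absolutely and $f_{jk}$ is four times continuously differentiable on $\mathbb R$. *Assumption B.* $\{X_t\}$ is strictly stationary and at least one of the following holds: (a) it is a linear process $X_t=\mu+\sum_{l\in\mathbb Z}\Psi_l\varepsilon_{t-l}$ (convergence in mean square), where the $\varepsilon_t$ are i.i.d. mean-zero random vectors in $\mathbb R^m$ whose components have finite fourth moments, and $\sum_l\|\Psi_l\|^2<\infty$; (b) all moments exist and, for every $r\ge 2$, all $a_1,\dots,a_r\in\{1,\dots,m\}$ and every $1\le i\le r-1$, $$\sum_{t_1,\dots,t_{r-1}\in\mathbb Z}(1+|t_i|)\,\bigl|\mathrm{cum}(X_{t_1,a_1},\dots,X_{t_{r-1},a_{r-1}},X_{0,a_r})\bigr|<\infty .$$ *Estimator.* From $X_1,\dots,X_n$,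 with sample mean $\bar X$, let $\hat\gamma_{jk}(h)=\frac1n\sum_{1\le t,\,t+h\le n}(X_{t+h,j}-\bar X_j)(X_{t,k}-\bar X_k)$ for $h\in\mathbb Z$ and $I_{jk}(w)=\frac1{2\pi}\sum_{|h|<n}e^{-iwh}\hat\gamma_{jk}(h)$. Let $w_s=2\pi s/n$, let $\delta=\delta_n$ be the bandwidth fraction and $M=\lfloor\delta n\rfloor$ (for instance $\delta=M/n$). For $\theta=0$ use the indices $s=1,\dots,M$; for $\theta=\pm\pi$ use $s=\lfloor n/2\rfloor-M+1,\dots,\lfloor n/2\rfloor$. Put $d_s=\bigl||\theta|-w_s\bigr|$ (so $-\pi$ is treated as $\pi$). Let $\mathbf X$ be the $M\times2$ matrix with rows $(1,d_s^2)$, $\mathbf Y$ the vector with entries $\mathrm{Re}\,I_{jk}(w_s)$, and $\mathbf W$ the diagonal matrix with entries $K_\delta(d_s)$, where $K_\delta(x)=(2\pi\delta)^{-1}K(x/(2\pi\delta))$. Here $K:[0,1]\to[0,\infty)$ is a Riemann integrable one-sided kernel with $\int_0^1K>0$ (in particular any strictly positive Riemann integrable $K$). Define $$\tilde f_{jk}(\theta)=[1,0]\,(\mathbf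 X'\mathbf W\mathbf X)^{-1}\mathbf X'\mathbf W\mathbf Y .$$ **Theorem.** Assume A(4) and B. Let $n\to\infty$, with $M\to\infty$ and $M/n\to0$. Then for all $j,k$ and each $\theta\in\{0,\pi,-\pi\}$, the matrix $\mathbf X'\mathbf W\mathbf X$ is invertible for all sufficiently large $n$, and $$\tilde f_{jk}(\theta)\longrightarrow f_{jk}(\theta)\quad\text{in probability.}$$ -/

import Mathlib

open MeasureTheory ProbabilityTheory Filter Topology

noncomputable section

namespace LocalQuad

variable {Ω : Type*} [MeasurableSpace Ω] {m : ℕ}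

/-- Strict stationarity of an `m`-vector time series indexed by `ℤ`: for every shift `h` the
process `t ↦ X (t + h)` has the same law, on the product space, as the process `X`. -/
def StrictlyStationary (P : Measure Ω) (X : ℤ → Ω → Fin m → ℝ) : Prop :=
  ∀ h : ℤ, IdentDistrib (fun ω (t : ℤ) => X (t + h) ω) (fun ω (t : ℤ) => X t ω) P P

/-- Autocovariance function `γ_{jk}(h) = Cov[X_{h,j}, X_{0,k}]`. -/
def autocov (P : Measure Ω) (X : ℤ → Ω → Fin m → ℝ) (j k : Fin m) (h : ℤ) : ℝ :=
  covariance (fun ω => X h ω j) (fun ω => X 0 ω k) P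

/-- Entries of the spectral density matrix,
`f_{jk}(w) = (2π)⁻¹ ∑_{h ∈ ℤ} e^{-iwh} γ_{jk}(h)`. -/
def specDensity (P : Measure Ω) (X : ℤ → Ω → Fin m → ℝ) (j k : Fin m) (w : ℝ) : ℂ :=
  (1 / (2 * Real.pi) : ℂ) *
    ∑' h : ℤ, Complex.exp (-Complex.I * w * h) * (autocov P X j k h : ℂ)

/-- Assumption A(p): the spectral density matrix is well defined (its series converges absolutely)
and each of its entries is `p` times continuously differentiable on `ℝ`. -/
structure AssumptionA (p : ℕ) (P : Measure Ω) (X : ℤ → Ω → Fin m → ℝ) : Prop where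
  summable : ∀ j k : Fin m, Summable (autocov P X j k)
  contDiff : ∀ j k : Fin m, ContDiff ℝ p (specDensity P X j k)

/-- Linear process `X_t = μ + ∑_{l ∈ ℤ} Ψ_l ε_{t-l}` (limit in mean square), with i.i.d. mean zero
inputs whose components have a finite fourth moment, and coefficient matrices with square summable
norm. The one-sided MA(∞) is the case `Ψ l = 0` for `l < 0`. -/
def IsLinearProcess (P : Measure Ω) (X : ℤ → Ω → Fin m → ℝ) : Prop :=
  ∃ (μ : Fin m → ℝ) (Ψ : ℤ → Matrix (Fin m) (Fin m) ℝ) (ε : ℤ → Ω → Fin m → ℝ),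
    (Summable fun l : ℤ => ∑ a, ∑ b, (Ψ l a b) ^ 2) ∧
    iIndepFun ε P ∧
    (∀ t : ℤ, IdentDistrib (ε t) (ε 0) P P) ∧
    (∀ a : Fin m, MemLp (fun ω => ε 0 ω a) 4 P) ∧
    (∀ a : Fin m, ∫ ω, ε 0 ω a ∂P = 0) ∧
    ∀ (t : ℤ) (a : Fin m),
      Tendsto (fun N : ℕ => eLpNorm (fun ω => X t ω a -
        (μ a + ∑ l ∈ Finset.Icc (-(N : ℤ)) N, (Matrix.mulVec (Ψ l) (ε (t - l) ω)) a)) 2 P)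
        atTop (𝓝 0)

/-- Joint cumulant of `Y_1, …, Y_r`, by the moment formula
`∑_π (-1)^{|π|-1} (|π|-1)! ∏_{B ∈ π} E[∏_{i ∈ B} Y_i]`, the sum being over the partitions `π` of the
index set. -/
def jointCumulant (P : Measure Ω) {r : ℕ} (Y : Fin r → Ω → ℝ) : ℝ :=
  ∑ π : Finpartition (Finset.univ : Finset (Fin r)),
    (-1 : ℝ) ^ (π.parts.card - 1) * ((π.parts.card - 1).factorial : ℝ) *
      ∏ B ∈ π.parts, ∫ ω, ∏ i ∈ B, Y i ω ∂P

/-- Autocumulant function of order `r + 1`: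
`c_a(t_1, …, t_r) = cum(X_{t_1,a_1}, …, X_{t_r,a_r}, X_{0,a_{r+1}})`. -/
def autocumulant (P : Measure Ω) (X : ℤ → Ω → Fin m → ℝ) {r : ℕ} (a : Fin (r + 1) → Fin m)
    (t : Fin r → ℤ) : ℝ :=
  jointCumulant P fun (i : Fin (r + 1)) ω => X (Fin.snoc (α := fun _ => ℤ) t 0 i) ω (a i)

/-- Cumulant summability: all moments exist and, for each order `r + 1 ≥ 2`, all component indices and
each `i`, `∑_{t_1, …, t_r} (1 + |t_i|) |c_a(t_1, …, t_r)| < ∞`. -/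
structure CumulantSummable (P : Measure Ω) (X : ℤ → Ω → Fin m → ℝ) : Prop where
  moments : ∀ (t : ℤ) (a : Fin m) (q : ℕ), MemLp (fun ω => X t ω a) q P
  summable : ∀ r : ℕ, 1 ≤ r → ∀ (a : Fin (r + 1) → Fin m) (i : Fin r),
    Summable fun t : Fin r → ℤ => (1 + |(t i : ℝ)|) * |autocumulant P X a t|

/-- Assumption B: strict stationarity, together with linearity or cumulant summability. -/
structure AssumptionB (P : Measure Ω) (X : ℤ → Ω → Fin m → ℝ) : Prop where
  stationary : StrictlyStationary P X
  linear_or_cumulant : IsLinearProcess P X ∨ CumulantSummable P X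

/-- Sample mean of the `j`-th component of the sample `x_1, …, x_n`. -/
def sampleMean (n : ℕ) (x : ℤ → Fin m → ℝ) (j : Fin m) : ℝ :=
  (∑ t ∈ Finset.Icc (1 : ℤ) n, x t j) / n

/-- Sample autocovariance `γ̂_{jk}(h) = n⁻¹ ∑_t (x_{t+h,j} - x̄_j)(x_{t,k} - x̄_k)`, over all `t` with
`1 ≤ t ≤ n` and `1 ≤ t + h ≤ n`. It vanishes for `|h| ≥ n`, and `γ̂_{jk}(-h) = γ̂_{kj}(h)`. -/
def sampleAutocov (n : ℕ) (x : ℤ → Fin m → ℝ) (j k : Fin m) (h : ℤ) : ℝ :=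
  (∑ t ∈ (Finset.Icc (1 : ℤ) n).filter (fun t => 1 ≤ t + h ∧ t + h ≤ n),
    (x (t + h) j - sampleMean n x j) * (x t k - sampleMean n x k)) / n

/-- Entries of the periodogram matrix, `I_{jk}(w) = (2π)⁻¹ ∑_{|h| < n} e^{-iwh} γ̂_{jk}(h)`. -/
def periodogram (n : ℕ) (x : ℤ → Fin m → ℝ) (j k : Fin m) (w : ℝ) : ℂ :=
  (1 / (2 * Real.pi) : ℂ) *
    ∑ h ∈ Finset.Ioo (-(n : ℤ)) n,
      Complex.exp (-Complex.I * w * h) * (sampleAutocov n x j k h : ℂ)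

/-- Number `M = [δ n]` of Fourier frequencies used for sample size `n` and bandwidth fraction
`δ`. -/
def numFreq (δ : ℝ) (n : ℕ) : ℕ := ⌊δ * n⌋₊

/-- Fourier frequencies used at the boundary point `θ ∈ {0, π, -π}`: `w_s = 2πs/n` with
`s = 1, …, M` if `θ = 0`, and with `s = [n/2]-M+1, …, [n/2]` if `θ = ±π`
(the point `-π` being treated as `π`). -/
def freq (θ δ : ℝ) (n : ℕ) (i : Fin (numFreq δ n)) : ℝ :=
  2 * Real.pi *
    ((if θ = 0 then (i : ℤ) + 1 else (n : ℤ) / 2 - (numFreq δ n : ℤ) + 1 + (i : ℤ) : ℤ) : ℝ) / n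

/-- Design matrix: a column of ones and a column of squared distances `(|θ| - w_s)²` to the
boundary frequency. -/
def designX (θ δ : ℝ) (n : ℕ) : Matrix (Fin (numFreq δ n)) (Fin 2) ℝ :=
  Matrix.of fun i c => if c = 0 then 1 else (|θ| - freq θ δ n i) ^ 2

/-- `K_δ(x) = (2πδ)⁻¹ K(x / (2πδ))`. -/
def scaledKernel (K : ℝ → ℝ) (δ x : ℝ) : ℝ :=
  (2 * Real.pi * δ)⁻¹ * K (x / (2 * Real.pi * δ))

/-- Diagonal weight matrix. The kernel is one-sided, so it is evaluated at the distance of the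
Fourier frequency from the boundary frequency. -/
def weightW (K : ℝ → ℝ) (θ δ : ℝ) (n : ℕ) :
    Matrix (Fin (numFreq δ n)) (Fin (numFreq δ n)) ℝ :=
  Matrix.diagonal fun i => scaledKernel K δ |(|θ| - freq θ δ n i)|

/-- Response vector: real parts of the periodogram ordinates. -/
def responseY (θ δ : ℝ) (n : ℕ) (x : ℤ → Fin m → ℝ) (j k : Fin m) : Fin (numFreq δ n) → ℝ :=
  fun i => (periodogram n x j k (freq θ δ n i)).re

/-- The normal matrix `X' W X`. -/
def gramXWX (K : ℝ → ℝ) (θ δ : ℝ) (n : ℕ) : Matrix (Fin 2) (Fin 2) ℝ :=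
  (designX θ δ n).transpose * weightW K θ δ n * designX θ δ n

/-- Local quadratic WLS estimator `[1,0] (X' W X)⁻¹ X' W Y` of `f_{jk}(θ)`. -/
def wlsEstimator (K : ℝ → ℝ) (θ δ : ℝ) (n : ℕ) (x : ℤ → Fin m → ℝ) (j k : Fin m) : ℝ :=
  (Matrix.mulVec ((gramXWX K θ δ n)⁻¹ * (designX θ δ n).transpose * weightW K θ δ n)
    (responseY θ δ n x j k)) 0

/-- Admissible one-sided kernels on `[0,1]`: nonnegative, Riemann integrable (bounded, and
continuous at almost every point), and of positive mass. Only the values on `[0,1]` matter. -/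
structure IsKernel (K : ℝ → ℝ) : Prop where
  nonneg : ∀ u ∈ Set.Icc (0 : ℝ) 1, 0 ≤ K u
  bounded : ∃ C : ℝ, ∀ u ∈ Set.Icc (0 : ℝ) 1, K u ≤ C
  ae_continuous : ∀ᵐ u ∂(volume.restrict (Set.Icc (0 : ℝ) 1)),
    ContinuousWithinAt K (Set.Icc (0 : ℝ) 1) u
  mass_pos : 0 < ∫ u in (0 : ℝ)..1, K u

end LocalQuad

end

/-! For large `n` the estimator is a weighted average `∑ w i * Re I(w_{s i})` with `∑ w i = 1` and
`|w i| ≤ C / M` (`exists_weights`). After rescaling distances by `2πδ`, the normal equations involve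
Riemann sums converging to the kernel moments `m0, m2, m4`. Their limiting determinant `m0 * m4 - m2
^ 2` is positive, being `m0` times a weighted sum of squares (`IsKernel.moment_det_pos`). Everything
after that concerns a generic average with bounded `M * |w i|`.

At Fourier frequencies `2πs/n` with `0 < s < n` constants are orthogonal to the exponentials, so the
sample mean may be exchanged for the true mean at no cost (`cosForm_sub_const`). The average then
becomes a quadratic form in the centred observations, with coefficients `cosWeight`.

Bias: the mean of this form is a weighted average of Fejér-smoothed autocovariance series at
frequencies within `2πM/n` of `|θ|`. Dominated convergence with dominating series `2|γ|` sends the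
error to zero (`abs_mean_sub_le`, `tendsto_tsum_min`).

Fluctuation: orthogonality of the exponentials bounds the sum of squared coefficients by `N * b ^
2`, which is of order `1/M` when `N = M` and `b = C/M` (`sum_sq_cosWeight_le`). A covariance of two
products splits into two pairings of autocovariances and a fourth cumulant, and Schur's test bounds
the pairings by `(∑|γ|)(∑|γ|)` times that sum of squares. The fourth cumulant is treated separately
in the two cases of Assumption B. If cumulants are summable, the pointwise bound `N * b / n` on the
coefficients is enough. For a linear process the coefficients are only square summable; the noise is
rotated to have uncorrelated components and the process is truncated to a finite moving average. The
cumulant part is a sum of squares over noise times, bounded by a supremum (Bessel's inequality)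
times a sum that is again expressed by covariances. The bound is kept in terms of the covariances of
the truncation, and the truncation is removed at fixed `n` before summability of `γ` is used. Since
this limit is in mean square, products converge only in `L¹`, so both cases are stated as bounds on
a mean absolute deviation. Markov's inequality concludes. -/

namespace LocalQuad

/-! ### Orthogonality at the Fourier frequencies -/

/-- The bilinear form `∑_{t,u=1}^n cos (w (t - u)) x_t y_u`. -/
noncomputable def cosForm (n : ℕ) (w : ℝ) (x y : ℤ → ℝ) : ℝ :=
  ∑ t ∈ Finset.Icc (1 : ℤ) n, ∑ u ∈ Finset.Icc (1 : ℤ) n, Real.cos (w * (t - u)) * x t * y u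

/-- The Fourier frequency `2πs/n`. -/
noncomputable def fourierFreq (n : ℕ) (s : ℤ) : ℝ := 2 * Real.pi * s / n

theorem sum_Icc_one_int {E : Type*} [AddCommMonoid E] (n : ℕ) (f : ℤ → E) :
    ∑ t ∈ Finset.Icc (1 : ℤ) n, f t = ∑ i ∈ Finset.range n, f (i + 1) := by
  symm
  refine Finset.sum_bij (fun (i : ℕ) _ => (i : ℤ) + 1) ?_ ?_ ?_ ?_
  · intro i hi; simp at hi ⊢; omega
  · intro i _ i' _ h; simpa using h
  · intro t ht
    simp at ht
    exact ⟨(t - 1).toNat, by simp; omega, by simp; omega⟩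
  · intros; rfl

theorem sum_exp_fourierFreq {n : ℕ} {d : ℤ} (hn : 0 < n) (hd : ¬ (n : ℤ) ∣ d) :
    ∑ t ∈ Finset.Icc (1 : ℤ) n, Complex.exp ((fourierFreq n d * t : ℝ) * Complex.I) = 0 := by
  have hn0 : (n : ℂ) ≠ 0 := by exact_mod_cast hn.ne'
  set z : ℂ := Complex.exp ((fourierFreq n d : ℝ) * Complex.I) with hz
  have hpow : ∀ i : ℕ, Complex.exp ((fourierFreq n d * ((i + 1 : ℤ) : ℝ) : ℝ) * Complex.I)
      = z * z ^ i := by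
    intro i
    rw [hz, ← Complex.exp_nat_mul, ← Complex.exp_add]
    congr 1; push_cast; ring
  rw [sum_Icc_one_int]
  simp_rw [hpow]
  rw [← Finset.mul_sum]
  have hz1 : z ≠ 1 := by
    intro h
    rw [hz, Complex.exp_eq_one_iff] at h
    obtain ⟨k, hk⟩ := h
    apply hd
    refine ⟨k, ?_⟩
    have hpi : (2 * (Real.pi : ℂ) * Complex.I) ≠ 0 := Complex.two_pi_I_ne_zero
    have : (2 * (Real.pi : ℂ) * Complex.I) * d = (2 * (Real.pi : ℂ) * Complex.I) * (n * k) := by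
      have h2 : ((fourierFreq n d : ℝ) : ℂ) * n = 2 * Real.pi * d := by
        rw [fourierFreq]; push_cast; field_simp
      calc _ = (((fourierFreq n d : ℝ) : ℂ) * n) * Complex.I := by rw [h2]; ring
        _ = (((fourierFreq n d : ℝ) : ℂ) * Complex.I) * n := by ring
        _ = _ := by rw [hk]; ring
    exact_mod_cast mul_left_cancel₀ hpi this
  have hzn : z ^ n = 1 := by
    rw [hz, ← Complex.exp_nat_mul, Complex.exp_eq_one_iff]
    refine ⟨d, ?_⟩
    rw [fourierFreq]; push_cast; field_simp
  rw [geom_sum_eq hz1, hzn]; simp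

theorem sum_exp_fourierFreq_self (n : ℕ) :
    ∑ t ∈ Finset.Icc (1 : ℤ) n, Complex.exp ((fourierFreq n 0 * t : ℝ) * Complex.I) = n := by
  simp [fourierFreq]

theorem not_dvd_of_mem_Ioo {n : ℕ} {s : ℤ} (hs : s ∈ Set.Ioo (0 : ℤ) n) : ¬ (n : ℤ) ∣ s := by
  intro h
  exact absurd (Int.le_of_dvd hs.1 h) (not_le.2 hs.2)

theorem not_dvd_sub_of_mem_Ioo {n : ℕ} {s s' : ℤ} (hs : s ∈ Set.Ioo (0 : ℤ) n)
    (hs' : s' ∈ Set.Ioo (0 : ℤ) n) (h : s ≠ s') : ¬ (n : ℤ) ∣ s - s' := by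
  intro hd
  have h1 := hs.1; have h2 := hs.2; have h3 := hs'.1; have h4 := hs'.2
  exact h (by linarith [Int.eq_zero_of_abs_lt_dvd hd (by rw [abs_lt]; constructor <;> linarith)])

theorem sum_cos_fourierFreq {n : ℕ} {s : ℤ} (hs : s ∈ Set.Ioo (0 : ℤ) n) :
    ∑ t ∈ Finset.Icc (1 : ℤ) n, Real.cos (fourierFreq n s * t) = 0 := by
  have hn : 0 < n := by have := hs.1; have := hs.2; omega
  have h := congrArg Complex.re (sum_exp_fourierFreq hn (not_dvd_of_mem_Ioo hs))
  rw [Complex.re_sum] at h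
  simpa only [Complex.exp_ofReal_mul_I_re, Complex.zero_re] using h

theorem sum_sin_fourierFreq {n : ℕ} {s : ℤ} (hs : s ∈ Set.Ioo (0 : ℤ) n) :
    ∑ t ∈ Finset.Icc (1 : ℤ) n, Real.sin (fourierFreq n s * t) = 0 := by
  have hn : 0 < n := by have := hs.1; have := hs.2; omega
  have h := congrArg Complex.im (sum_exp_fourierFreq hn (not_dvd_of_mem_Ioo hs))
  rw [Complex.im_sum] at h
  simpa only [Complex.exp_ofReal_mul_I_im, Complex.zero_im] using h

theorem cosForm_eq (n : ℕ) (w : ℝ) (x y : ℤ → ℝ) :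
    cosForm n w x y =
      (∑ t ∈ Finset.Icc (1 : ℤ) n, Real.cos (w * t) * x t) *
        (∑ t ∈ Finset.Icc (1 : ℤ) n, Real.cos (w * t) * y t) +
      (∑ t ∈ Finset.Icc (1 : ℤ) n, Real.sin (w * t) * x t) *
        (∑ t ∈ Finset.Icc (1 : ℤ) n, Real.sin (w * t) * y t) := by
  rw [Finset.sum_mul_sum, Finset.sum_mul_sum, ← Finset.sum_add_distrib, cosForm]
  refine Finset.sum_congr rfl fun t _ => ?_
  rw [← Finset.sum_add_distrib]
  refine Finset.sum_congr rfl fun u _ => ?_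
  rw [mul_sub, Real.cos_sub]; ring

/-- Sines and cosines at such a frequency sum to zero over the sample, so constants are annihilated.
Used once with the sample means and once with the true means, this exchanges one for the other
exactly. -/
theorem cosForm_sub_const {n : ℕ} {s : ℤ} (hs : s ∈ Set.Ioo (0 : ℤ) n) (x y : ℤ → ℝ) (a b : ℝ) :
    cosForm n (fourierFreq n s) (fun t => x t - a) (fun t => y t - b)
      = cosForm n (fourierFreq n s) x y := by
  simp only [cosForm_eq, mul_sub, Finset.sum_sub_distrib, ← Finset.sum_mul, sum_cos_fourierFreq hs,
    sum_sin_fourierFreq hs, zero_mul, sub_zero]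

theorem cosForm_self_nonneg (n : ℕ) (w : ℝ) (x : ℤ → ℝ) : 0 ≤ cosForm n w x x := by
  rw [cosForm_eq]; nlinarith [mul_self_nonneg (∑ t ∈ Finset.Icc (1 : ℤ) n, Real.cos (w * t) * x t),
    mul_self_nonneg (∑ t ∈ Finset.Icc (1 : ℤ) n, Real.sin (w * t) * x t)]

/-- The form is the real inner product of the discrete Fourier transforms of `x` and `y` at `w`,
regarded as plane vectors. This separates two different sequences into diagonal forms, to which
Bessel's inequality applies. -/
theorem abs_cosForm_le (n : ℕ) (w : ℝ) (x y : ℤ → ℝ) :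
    |cosForm n w x y| ≤ (cosForm n w x x + cosForm n w y y) / 2 := by
  simp only [cosForm_eq]
  generalize (∑ t ∈ Finset.Icc (1 : ℤ) n, Real.cos (w * t) * x t) = a
  generalize (∑ t ∈ Finset.Icc (1 : ℤ) n, Real.cos (w * t) * y t) = b
  generalize (∑ t ∈ Finset.Icc (1 : ℤ) n, Real.sin (w * t) * x t) = c
  generalize (∑ t ∈ Finset.Icc (1 : ℤ) n, Real.sin (w * t) * y t) = d
  rw [abs_le]
  constructor <;> nlinarith [sq_nonneg (a - b), sq_nonneg (c - d), sq_nonneg (a + b),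
    sq_nonneg (c + d)]

theorem inner_fourier {n : ℕ} {s s' : ℤ} (hs : s ∈ Set.Ioo (0 : ℤ) n)
    (hs' : s' ∈ Set.Ioo (0 : ℤ) n) :
    ∑ t ∈ Finset.Icc (1 : ℤ) n, Complex.exp ((fourierFreq n (s - s') * t : ℝ) * Complex.I)
      = if s = s' then (n : ℂ) else 0 := by
  have hn : 0 < n := by have := hs.1; have := hs.2; omega
  split_ifs with h
  · subst h; rw [sub_self, sum_exp_fourierFreq_self]
  · exact sum_exp_fourierFreq hn (not_dvd_sub_of_mem_Ioo hs hs' h)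

theorem normSq_sum_exp (n : ℕ) (w : ℝ) (x : ℤ → ℝ) :
    ‖∑ t ∈ Finset.Icc (1 : ℤ) n, x t * Complex.exp ((-(w * t) : ℝ) * Complex.I)‖ ^ 2
      = cosForm n w x x := by
  rw [← Complex.normSq_eq_norm_sq, Complex.normSq_apply, cosForm_eq, Complex.re_sum,
    Complex.im_sum]
  simp only [Complex.re_ofReal_mul, Complex.im_ofReal_mul, Complex.exp_ofReal_mul_I_re,
    Complex.exp_ofReal_mul_I_im, Real.cos_neg, Real.sin_neg, mul_neg, Finset.sum_neg_distrib]
  simp only [mul_comm]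
  ring

/-- Bessel's inequality for distinct Fourier frequencies. -/
theorem sum_cosForm_self_le {ι : Type*} [Fintype ι] {n : ℕ} {s : ι → ℤ}
    (hs : ∀ i, s i ∈ Set.Ioo (0 : ℤ) n) (hinj : Function.Injective s) (x : ℤ → ℝ) :
    ∑ i, cosForm n (fourierFreq n (s i)) x x ≤ n * ∑ t ∈ Finset.Icc (1 : ℤ) n, x t ^ 2 := by
  classical
  rcases isEmpty_or_nonempty ι with hι | ⟨⟨i0⟩⟩
  · simp only [Finset.univ_eq_empty, Finset.sum_empty]; positivity
  have hn : 0 < n := by have := (hs i0).1; have := (hs i0).2; omega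
  have hnR : (0 : ℝ) < n := by exact_mod_cast hn
  let T := Finset.Icc (1 : ℤ) n
  let v : ι → EuclideanSpace ℂ T := fun i => WithLp.toLp 2 fun t =>
    ((Real.sqrt n)⁻¹ : ℂ) * Complex.exp ((fourierFreq n (s i) * ((t : ℤ) : ℝ) : ℝ) * Complex.I)
  let X : EuclideanSpace ℂ T := WithLp.toLp 2 fun t => (x t : ℂ)
  have hsq : ((Real.sqrt n : ℝ) : ℂ)⁻¹ * ((Real.sqrt n : ℝ) : ℂ)⁻¹ = (n : ℂ)⁻¹ := by
    rw [← mul_inv, ← Complex.ofReal_mul, Real.mul_self_sqrt hnR.le]; simp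
  have hv : Orthonormal ℂ v := by
    rw [orthonormal_iff_ite]
    intro i i'
    have h1 : inner ℂ (v i) (v i') = (n : ℂ)⁻¹ * ∑ t ∈ Finset.Icc (1 : ℤ) n,
        Complex.exp ((fourierFreq n (s i' - s i) * t : ℝ) * Complex.I) := by
      rw [PiLp.inner_apply, Finset.mul_sum]
      refine Eq.trans (Finset.sum_congr rfl fun t _ => ?_) (Finset.sum_coe_sort T _)
      simp only [v, RCLike.inner_apply, map_mul, ← Complex.exp_conj, Complex.conj_I,
        map_inv₀, Complex.conj_ofReal]
      rw [mul_mul_mul_comm, hsq, ← Complex.exp_add]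
      congr 2
      simp only [fourierFreq]; push_cast; ring
    rw [h1, inner_fourier (hs i') (hs i)]
    have : (s i' = s i) ↔ (i = i') := ⟨fun h => (hinj h).symm, fun h => by rw [h]⟩
    simp only [this]
    split_ifs
    · exact inv_mul_cancel₀ (by exact_mod_cast hn.ne')
    · simp
  have hB := hv.sum_inner_products_le (x := X) (s := Finset.univ)
  have h2 : ∀ i, ‖inner ℂ (v i) X‖ ^ 2 = (n : ℝ)⁻¹ * cosForm n (fourierFreq n (s i)) x x := by
    intro i
    have : inner ℂ (v i) X = ((Real.sqrt n : ℝ) : ℂ)⁻¹ * ∑ t ∈ Finset.Icc (1 : ℤ) n,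
        x t * Complex.exp ((-(fourierFreq n (s i) * t) : ℝ) * Complex.I) := by
      rw [PiLp.inner_apply, Finset.mul_sum]
      refine Eq.trans (Finset.sum_congr rfl fun t _ => ?_) (Finset.sum_coe_sort T _)
      simp only [v, X, RCLike.inner_apply, map_mul, ← Complex.exp_conj, Complex.conj_I,
        map_inv₀, Complex.conj_ofReal]
      rw [mul_left_comm]
      congr 3
      push_cast; ring
    rw [this, norm_mul, mul_pow, normSq_sum_exp, norm_inv, Complex.norm_real, Real.norm_eq_abs,
      inv_pow, sq_abs, Real.sq_sqrt hnR.le]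
  have h3 : ‖X‖ ^ 2 = ∑ t ∈ Finset.Icc (1 : ℤ) n, x t ^ 2 := by
    rw [EuclideanSpace.norm_sq_eq]
    refine Eq.trans (Finset.sum_congr rfl fun t _ => ?_) (Finset.sum_coe_sort T _)
    simp [X]
  simp_rw [h2] at hB
  rw [h3, ← Finset.mul_sum, inv_mul_le_iff₀ hnR] at hB
  exact hB

/-- Each cosine kernel is the real part of the rank-one kernel `e_i(t) * conj (e_i(u))`. These
rank-one kernels are orthogonal on the square of the sample, with squared norm `n ^ 2`. The only
loss is in discarding imaginary parts. -/
theorem sum_sq_cos_le {ι : Type*} [Fintype ι] {n : ℕ} {s : ι → ℤ}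
    (hs : ∀ i, s i ∈ Set.Ioo (0 : ℤ) n) (hinj : Function.Injective s) (w : ι → ℝ) :
    ∑ t ∈ Finset.Icc (1 : ℤ) n, ∑ u ∈ Finset.Icc (1 : ℤ) n,
      (∑ i, w i * Real.cos (fourierFreq n (s i) * (t - u))) ^ 2 ≤ n ^ 2 * ∑ i, w i ^ 2 := by
  classical
  let E : ι → ℤ → ℂ := fun i t => Complex.exp ((fourierFreq n (s i) * t : ℝ) * Complex.I)
  have hE : ∀ i i', ∑ t ∈ Finset.Icc (1 : ℤ) n, E i t * (starRingEnd ℂ) (E i' t)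
      = if i = i' then (n : ℂ) else 0 := by
    intro i i'
    have h := inner_fourier (hs i) (hs i')
    simp only [hinj.eq_iff] at h
    rw [← h]
    refine Finset.sum_congr rfl fun t _ => ?_
    simp only [E, ← Complex.exp_conj, ← Complex.exp_add]
    congr 1
    simp only [fourierFreq, map_mul, Complex.conj_I, Complex.conj_ofReal]; push_cast; ring
  have h1 : ∀ t u : ℤ, (∑ i, w i * Real.cos (fourierFreq n (s i) * (t - u))) ^ 2 ≤
      ‖∑ i, (w i : ℂ) * (E i t * (starRingEnd ℂ) (E i u))‖ ^ 2 := by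
    intro t u
    have : (∑ i, w i * Real.cos (fourierFreq n (s i) * (t - u)))
        = (∑ i, (w i : ℂ) * (E i t * (starRingEnd ℂ) (E i u))).re := by
      rw [Complex.re_sum]
      refine Finset.sum_congr rfl fun i _ => ?_
      rw [Complex.re_ofReal_mul]
      congr 1
      simp only [E, ← Complex.exp_conj, ← Complex.exp_add]
      rw [← Complex.exp_ofReal_mul_I_re]
      congr 2
      simp only [map_mul, Complex.conj_I, Complex.conj_ofReal]; push_cast; ring
    rw [this]
    exact sq_le_sq'
      (by linarith [neg_abs_le (∑ i, (w i : ℂ) * (E i t * (starRingEnd ℂ) (E i u))).re,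
      Complex.abs_re_le_norm (∑ i, (w i : ℂ) * (E i t * (starRingEnd ℂ) (E i u)))])
      (Complex.re_le_norm _)
  refine (Finset.sum_le_sum fun t _ => Finset.sum_le_sum fun u _ => h1 t u).trans (le_of_eq ?_)
  apply Complex.ofReal_injective
  push_cast
  simp_rw [← Complex.conj_mul', map_sum, map_mul, Complex.conj_conj, Complex.conj_ofReal,
    Finset.sum_mul_sum]
  calc _ = ∑ i, ∑ i', (w i : ℂ) * w i' *
        ((∑ t ∈ Finset.Icc (1 : ℤ) n, E i' t * (starRingEnd ℂ) (E i t)) *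
          (∑ u ∈ Finset.Icc (1 : ℤ) n, E i u * (starRingEnd ℂ) (E i' u))) := by
        simp_rw [Finset.sum_mul_sum, Finset.mul_sum]
        rw [Finset.sum_congr rfl fun t _ => Finset.sum_comm, Finset.sum_comm]
        refine Finset.sum_congr rfl fun i _ => ?_
        rw [Finset.sum_congr rfl fun t _ => Finset.sum_comm, Finset.sum_comm]
        refine Finset.sum_congr rfl fun i' _ => Finset.sum_congr rfl fun t _ =>
          Finset.sum_congr rfl fun u _ => ?_
        ring
    _ = _ := by
        simp_rw [hE]
        rw [Finset.mul_sum]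
        refine Finset.sum_congr rfl fun i _ => ?_
        rw [Finset.sum_eq_single i]
        · simp; ring
        · intro i' _ h; simp [h]
        · simp

/-! ### Fourth-order joint cumulants -/

/-- A partition of `Fin r` is determined by the map sending each index to the least element of its
block. -/
noncomputable def blockMin {r : ℕ} (π : Finpartition (Finset.univ : Finset (Fin r))) (i : Fin r) : Fin r :=
  (π.part i).min' ⟨i, π.mem_part (Finset.mem_univ i)⟩

theorem blockMin_le {r : ℕ} (π : Finpartition (Finset.univ : Finset (Fin r))) (i : Fin r) :
    blockMin π i ≤ i := Finset.min'_le _ _ (π.mem_part (Finset.mem_univ i))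

theorem part_blockMin {r : ℕ} (π : Finpartition (Finset.univ : Finset (Fin r))) (i : Fin r) :
    π.part (blockMin π i) = π.part i :=
  π.part_eq_of_mem (π.part_mem.2 (Finset.mem_univ i)) (Finset.min'_mem _ _)

theorem blockMin_eq_iff {r : ℕ} (π : Finpartition (Finset.univ : Finset (Fin r))) (i j : Fin r) :
    blockMin π i = blockMin π j ↔ π.part i = π.part j := by
  constructor
  · intro h; rw [← part_blockMin, h, part_blockMin]
  · intro h; simp only [blockMin, h]

theorem blockMin_blockMin {r : ℕ} (π : Finpartition (Finset.univ : Finset (Fin r))) (i : Fin r) :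
    blockMin π (blockMin π i) = blockMin π i :=
  (blockMin_eq_iff _ _ _).2 (part_blockMin π i)

theorem parts_eq_image_blockMin {r : ℕ} (π : Finpartition (Finset.univ : Finset (Fin r))) :
    π.parts = Finset.univ.image fun i => Finset.univ.filter fun j => blockMin π j = blockMin π i := by
  have h : ∀ i, (Finset.univ.filter fun j => blockMin π j = blockMin π i) = π.part i := by
    intro i; ext j
    simp only [Finset.mem_filter, Finset.mem_univ, true_and, blockMin_eq_iff,
      π.mem_part_iff_part_eq_part (Finset.mem_univ j) (Finset.mem_univ i)]
  simp_rw [h]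
  ext B
  simp only [Finset.mem_image, Finset.mem_univ, true_and]
  constructor
  · intro hB
    obtain ⟨i, hi⟩ := π.nonempty_of_mem_parts hB
    exact ⟨i, π.part_eq_of_mem hB hi⟩
  · rintro ⟨i, rfl⟩; exact π.part_mem.2 (Finset.mem_univ i)

/-- Sending indices to block minima is a bijection from partitions onto idempotent maps with `f i ≤
i`; the blocks are the fibres. The sum over partitions thereby becomes a sum over a set of functions
that can be enumerated by evaluation. -/
theorem sum_finpartition {r : ℕ} (F : Finset (Finset (Fin r)) → ℝ) :
    ∑ π : Finpartition (Finset.univ : Finset (Fin r)), F π.parts =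
      ∑ f ∈ Finset.univ.filter (fun f : Fin r → Fin r => (∀ i, f i ≤ i) ∧ ∀ i, f (f i) = f i),
        F (Finset.univ.image fun i => Finset.univ.filter fun j => f j = f i) := by
  refine Finset.sum_bij (fun π _ => blockMin π) ?_ ?_ ?_ ?_
  · intro π _
    simpa using ⟨blockMin_le π, blockMin_blockMin π⟩
  · intro π _ π' _ h
    apply Finpartition.ext
    rw [parts_eq_image_blockMin, parts_eq_image_blockMin, h]
  · intro f hf
    simp only [Finset.mem_filter, Finset.mem_univ, true_and] at hf
    have : DecidableRel (Setoid.ker f) := fun i j => inferInstanceAs (Decidable (f i = f j))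
    refine ⟨Finpartition.ofSetoid (Setoid.ker f), Finset.mem_univ _, ?_⟩
    have hp : ∀ i j, j ∈ (Finpartition.ofSetoid (Setoid.ker f)).part i ↔ f i = f j := fun i j => by
      rw [Finpartition.mem_part_ofSetoid_iff_rel]; rfl
    funext i
    -- `f i` lies in the class of `i` by idempotence, and any `j` in that class satisfies `f i = f j
    -- ≤ j`.
    apply le_antisymm
    · exact Finset.min'_le _ _ ((hp _ _).2 (hf.2 i).symm)
    · refine Finset.le_min' _ _ _ fun j hj => ?_
      rw [(hp _ _).1 hj]; exact hf.1 j
  · intro π _; rw [← parts_eq_image_blockMin]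

/-- These are the 15 partitions of a four-element set, coded by block minima. -/
theorem restrictedGrowth_four :
    (Finset.univ.filter (fun f : Fin 4 → Fin 4 => (∀ i, f i ≤ i) ∧ ∀ i, f (f i) = f i)) = 
  ({![0,0,0,0], ![0,0,0,3], ![0,0,2,0],![0,1,0,0],![0,1,1,1],![0,0,2,2],![0,1,0,1],![0,1,1,0],
   ![0,0,2,3],![0,1,0,3],![0,1,2,0],![0,1,1,3],![0,1,2,1],![0,1,2,2],![0,1,2,3]} : Finset (Fin 4 → Fin 4)) := by
  decide +kernel

theorem jointCumulant_four {Ω : Type*} [MeasurableSpace Ω] (P : Measure Ω) (Y : Fin 4 → Ω → ℝ) :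
    jointCumulant P Y =
      (∫ ω, Y 0 ω * Y 1 ω * Y 2 ω * Y 3 ω ∂P)
      - (∫ ω, Y 0 ω * Y 1 ω * Y 2 ω ∂P) * (∫ ω, Y 3 ω ∂P)
      - (∫ ω, Y 0 ω * Y 1 ω * Y 3 ω ∂P) * (∫ ω, Y 2 ω ∂P)
      - (∫ ω, Y 0 ω * Y 2 ω * Y 3 ω ∂P) * (∫ ω, Y 1 ω ∂P)
      - (∫ ω, Y 1 ω * Y 2 ω * Y 3 ω ∂P) * (∫ ω, Y 0 ω ∂P)
      - (∫ ω, Y 0 ω * Y 1 ω ∂P) * (∫ ω, Y 2 ω * Y 3 ω ∂P)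
      - (∫ ω, Y 0 ω * Y 2 ω ∂P) * (∫ ω, Y 1 ω * Y 3 ω ∂P)
      - (∫ ω, Y 0 ω * Y 3 ω ∂P) * (∫ ω, Y 1 ω * Y 2 ω ∂P)
      + 2 * ((∫ ω, Y 0 ω * Y 1 ω ∂P) * (∫ ω, Y 2 ω ∂P) * (∫ ω, Y 3 ω ∂P)
        + (∫ ω, Y 0 ω * Y 2 ω ∂P) * (∫ ω, Y 1 ω ∂P) * (∫ ω, Y 3 ω ∂P)
        + (∫ ω, Y 0 ω * Y 3 ω ∂P) * (∫ ω, Y 1 ω ∂P) * (∫ ω, Y 2 ω ∂P)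
        + (∫ ω, Y 1 ω * Y 2 ω ∂P) * (∫ ω, Y 0 ω ∂P) * (∫ ω, Y 3 ω ∂P)
        + (∫ ω, Y 1 ω * Y 3 ω ∂P) * (∫ ω, Y 0 ω ∂P) * (∫ ω, Y 2 ω ∂P)
        + (∫ ω, Y 2 ω * Y 3 ω ∂P) * (∫ ω, Y 0 ω ∂P) * (∫ ω, Y 1 ω ∂P))
      - 6 * ((∫ ω, Y 0 ω ∂P) * (∫ ω, Y 1 ω ∂P) * (∫ ω, Y 2 ω ∂P) * (∫ ω, Y 3 ω ∂P)) := by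
  let G : Finset (Fin 4) → ℝ := fun B => ∫ ω, ∏ i ∈ B, Y i ω ∂P
  have key := sum_finpartition (r := 4) (fun S => (-1 : ℝ) ^ (S.card - 1) *
    ((S.card - 1).factorial : ℝ) * ∏ B ∈ S, G B)
  rw [restrictedGrowth_four] at key
  -- This is the identity implication. It gives `rw` an equation whose right side is an explicit
  -- list of blocks, checked by evaluation.
  have hI : ∀ (f : Fin 4 → Fin 4) (S : Finset (Finset (Fin 4))),
    (Finset.univ.image fun i => Finset.univ.filter fun j => f j = f i) = S → 
    (Finset.univ.image fun i => Finset.univ.filter fun j => f j = f i) = S := fun _ _ h => h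
  rw [jointCumulant]
  refine key.trans ?_
  repeat rw [Finset.sum_insert (by decide)]
  rw [Finset.sum_singleton]
  rw [hI ![0,0,0,0] {{0,1,2,3}} (by decide),
    hI ![0,0,0,3] {{0,1,2},{3}} (by decide),
    hI ![0,0,2,0] {{0,1,3},{2}} (by decide),
    hI ![0,1,0,0] {{0,2,3},{1}} (by decide),
    hI ![0,1,1,1] {{1,2,3},{0}} (by decide),
    hI ![0,0,2,2] {{0,1},{2,3}} (by decide),
    hI ![0,1,0,1] {{0,2},{1,3}} (by decide),
    hI ![0,1,1,0] {{0,3},{1,2}} (by decide),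
    hI ![0,0,2,3] {{0,1},{2},{3}} (by decide),
    hI ![0,1,0,3] {{0,2},{1},{3}} (by decide),
    hI ![0,1,2,0] {{0,3},{1},{2}} (by decide),
    hI ![0,1,1,3] {{1,2},{0},{3}} (by decide),
    hI ![0,1,2,1] {{1,3},{0},{2}} (by decide),
    hI ![0,1,2,2] {{2,3},{0},{1}} (by decide),
    hI ![0,1,2,3] {{0},{1},{2},{3}} (by decide)]
  repeat rw [Finset.card_insert_of_notMem (by decide)]
  repeat rw [Finset.prod_insert (f := G) (by decide)]
  simp only [Finset.prod_singleton, Finset.card_singleton]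
  have g1 : ∀ a, G {a} = ∫ ω, Y a ω ∂P := fun a => by simp [G]
  have g2 : ∀ a b, a ≠ b → G {a, b} = ∫ ω, Y a ω * Y b ω ∂P := fun a b h => by
    simp [G, Finset.prod_insert, h]
  have g3 : ∀ a b c, a ≠ b → a ≠ c → b ≠ c → G {a, b, c} = ∫ ω, Y a ω * Y b ω * Y c ω ∂P :=
    fun a b c h h' h'' => by simp [G, Finset.prod_insert, h, h', h'', mul_assoc]
  have g4 : G {0, 1, 2, 3} = ∫ ω, Y 0 ω * Y 1 ω * Y 2 ω * Y 3 ω ∂P := by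
    simp [G, Finset.prod_insert, mul_assoc]
  rw [g4, g3 0 1 2 (by decide) (by decide) (by decide), g3 0 1 3 (by decide) (by decide) (by decide),
    g3 0 2 3 (by decide) (by decide) (by decide), g3 1 2 3 (by decide) (by decide) (by decide),
    g2 0 1 (by decide), g2 0 2 (by decide), g2 0 3 (by decide), g2 1 2 (by decide),
    g2 1 3 (by decide), g2 2 3 (by decide)]
  simp only [g1]
  norm_num [Nat.factorial]
  ring

theorem integrable_mul_of_memLp_four {Ω : Type*} [MeasurableSpace Ω] {P : Measure Ω}
    [IsProbabilityMeasure P] {f g : Ω → ℝ} (hf : MemLp f 4 P) (hg : MemLp g 4 P) :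
    Integrable (fun ω => f ω * g ω) P :=
  (hf.mono_exponent (p := 2) (by norm_num)).integrable_mul (hg.mono_exponent (p := 2) (by norm_num))

theorem memLp_two_mul_of_memLp_four {Ω : Type*} [MeasurableSpace Ω] {P : Measure Ω}
    {f g : Ω → ℝ} (hf : MemLp f 4 P) (hg : MemLp g 4 P) :
    MemLp (fun ω => f ω * g ω) 2 P :=
  hg.mul' (hpqr := ⟨by
    rw [← two_mul, show (4 : ENNReal) = 2 * 2 by norm_num, ENNReal.mul_inv (by simp) (by simp),
      ← mul_assoc, ENNReal.mul_inv_cancel (by simp) (by simp), one_mul]⟩) hf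

theorem integrable_mul₃_of_memLp_four {Ω : Type*} [MeasurableSpace Ω] {P : Measure Ω}
    [IsProbabilityMeasure P] {f g h : Ω → ℝ} (hf : MemLp f 4 P) (hg : MemLp g 4 P)
    (hh : MemLp h 4 P) : Integrable (fun ω => f ω * g ω * h ω) P :=
  (memLp_two_mul_of_memLp_four hf hg).integrable_mul (hh.mono_exponent (p := 2) (by norm_num))

theorem integrable_mul₄_of_memLp_four {Ω : Type*} [MeasurableSpace Ω] {P : Measure Ω}
    {f g h k : Ω → ℝ} (hf : MemLp f 4 P) (hg : MemLp g 4 P)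
    (hh : MemLp h 4 P) (hk : MemLp k 4 P) : Integrable (fun ω => f ω * g ω * h ω * k ω) P := by
  refine ((memLp_two_mul_of_memLp_four hf hg).integrable_mul
    (memLp_two_mul_of_memLp_four hh hk)).congr (.of_forall fun ω => ?_)
  simp only [Pi.mul_apply]; ring

/-- The fourth cumulant is unchanged by translating the variables, and for centred variables every
partition with a singleton block contributes zero; the full block and the three pairings remain. The
verification is by direct expansion. -/
theorem jointCumulant_four_centered {Ω : Type*} [MeasurableSpace Ω] (P : Measure Ω)
    [IsProbabilityMeasure P] (Y : Fin 4 → Ω → ℝ) (hY : ∀ i, MemLp (Y i) 4 P) (μ : Fin 4 → ℝ)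
    (hμ : ∀ i, ∫ ω, Y i ω ∂P = μ i) :
    jointCumulant P Y =
      (∫ ω, (Y 0 ω - μ 0) * (Y 1 ω - μ 1) * (Y 2 ω - μ 2) * (Y 3 ω - μ 3) ∂P)
      - (∫ ω, (Y 0 ω - μ 0) * (Y 1 ω - μ 1) ∂P) * (∫ ω, (Y 2 ω - μ 2) * (Y 3 ω - μ 3) ∂P)
      - (∫ ω, (Y 0 ω - μ 0) * (Y 2 ω - μ 2) ∂P) * (∫ ω, (Y 1 ω - μ 1) * (Y 3 ω - μ 3) ∂P)
      - (∫ ω, (Y 0 ω - μ 0) * (Y 3 ω - μ 3) ∂P) * (∫ ω, (Y 1 ω - μ 1) * (Y 2 ω - μ 2) ∂P) := by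
  have i1 : ∀ i, Integrable (fun ω => Y i ω) P := fun i => (hY i).integrable (by norm_num)
  have i2 : ∀ i j, Integrable (fun ω => Y i ω * Y j ω) P := fun i j =>
    integrable_mul_of_memLp_four (hY i) (hY j)
  have i3 : ∀ i j k, Integrable (fun ω => Y i ω * Y j ω * Y k ω) P := fun i j k =>
    integrable_mul₃_of_memLp_four (hY i) (hY j) (hY k)
  have i4 : Integrable (fun ω => Y 0 ω * Y 1 ω * Y 2 ω * Y 3 ω) P :=
    integrable_mul₄_of_memLp_four (hY 0) (hY 1) (hY 2) (hY 3)
  have c2 : ∀ i j, ∫ ω, (Y i ω - μ i) * (Y j ω - μ j) ∂P = (∫ ω, Y i ω * Y j ω ∂P) - μ i * μ j := by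
    intro i j
    have : ∀ ω, (Y i ω - μ i) * (Y j ω - μ j) = Y i ω * Y j ω - μ j * Y i ω - μ i * Y j ω
      + μ i * μ j := fun ω => by ring
    simp_rw [this]
    rw [integral_add, integral_sub, integral_sub, integral_const_mul, integral_const_mul, hμ, hμ,
      integral_const]
    · simp; ring
    all_goals fun_prop (disch := assumption)
  have c4 : ∫ ω, (Y 0 ω - μ 0) * (Y 1 ω - μ 1) * (Y 2 ω - μ 2) * (Y 3 ω - μ 3) ∂P =
      (∫ ω, Y 0 ω * Y 1 ω * Y 2 ω * Y 3 ω ∂P)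
      - μ 3 * (∫ ω, Y 0 ω * Y 1 ω * Y 2 ω ∂P) - μ 2 * (∫ ω, Y 0 ω * Y 1 ω * Y 3 ω ∂P)
      - μ 1 * (∫ ω, Y 0 ω * Y 2 ω * Y 3 ω ∂P) - μ 0 * (∫ ω, Y 1 ω * Y 2 ω * Y 3 ω ∂P)
      + μ 2 * μ 3 * (∫ ω, Y 0 ω * Y 1 ω ∂P) + μ 1 * μ 3 * (∫ ω, Y 0 ω * Y 2 ω ∂P)
      + μ 1 * μ 2 * (∫ ω, Y 0 ω * Y 3 ω ∂P) + μ 0 * μ 3 * (∫ ω, Y 1 ω * Y 2 ω ∂P)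
      + μ 0 * μ 2 * (∫ ω, Y 1 ω * Y 3 ω ∂P) + μ 0 * μ 1 * (∫ ω, Y 2 ω * Y 3 ω ∂P)
      - 3 * (μ 0 * μ 1 * μ 2 * μ 3) := by
    have : ∀ ω, (Y 0 ω - μ 0) * (Y 1 ω - μ 1) * (Y 2 ω - μ 2) * (Y 3 ω - μ 3) =
      Y 0 ω * Y 1 ω * Y 2 ω * Y 3 ω
      - μ 3 * (Y 0 ω * Y 1 ω * Y 2 ω) - μ 2 * (Y 0 ω * Y 1 ω * Y 3 ω)
      - μ 1 * (Y 0 ω * Y 2 ω * Y 3 ω) - μ 0 * (Y 1 ω * Y 2 ω * Y 3 ω)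
      + μ 2 * μ 3 * (Y 0 ω * Y 1 ω) + μ 1 * μ 3 * (Y 0 ω * Y 2 ω)
      + μ 1 * μ 2 * (Y 0 ω * Y 3 ω) + μ 0 * μ 3 * (Y 1 ω * Y 2 ω)
      + μ 0 * μ 2 * (Y 1 ω * Y 3 ω) + μ 0 * μ 1 * (Y 2 ω * Y 3 ω)
      - μ 1 * μ 2 * μ 3 * Y 0 ω - μ 0 * μ 2 * μ 3 * Y 1 ω - μ 0 * μ 1 * μ 3 * Y 2 ω
      - μ 0 * μ 1 * μ 2 * Y 3 ω + μ 0 * μ 1 * μ 2 * μ 3 := fun ω => by ring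
    simp_rw [this]
    rw [integral_add, integral_sub, integral_sub, integral_sub, integral_sub, integral_add,
      integral_add, integral_add, integral_add, integral_add, integral_add, integral_sub,
      integral_sub, integral_sub, integral_sub, integral_const]
    · simp only [integral_const_mul, hμ]; simp; ring
    all_goals fun_prop (disch := assumption)
  rw [jointCumulant_four, c4]
  simp only [c2, hμ]
  ring

/-! ### Size of the cosine coefficients, and Schur bounds -/

/-- The coefficients of the quadratic form `∑ i, w i * Re I (2π s i / n)` in the observations. -/
noncomputable def cosWeight {ι : Type*} [Fintype ι] (n : ℕ) (s : ι → ℤ) (w : ι → ℝ) (t u : ℤ) : ℝ :=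
  (2 * Real.pi * n)⁻¹ * ∑ i, w i * Real.cos (fourierFreq n (s i) * (t - u))

theorem sum_cosWeight_mul {ι : Type*} [Fintype ι] (n : ℕ) (s : ι → ℤ) (w : ι → ℝ) (x y : ℤ → ℝ) :
    ∑ t ∈ Finset.Icc (1 : ℤ) n, ∑ u ∈ Finset.Icc (1 : ℤ) n, cosWeight n s w t u * (x t * y u)
      = (2 * Real.pi * n)⁻¹ * ∑ i, w i * cosForm n (fourierFreq n (s i)) x y := by
  simp only [cosWeight, cosForm, Finset.mul_sum, Finset.sum_mul]
  rw [Finset.sum_congr rfl fun t _ => Finset.sum_comm, Finset.sum_comm]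
  refine Finset.sum_congr rfl fun i _ => Finset.sum_congr rfl fun t _ =>
    Finset.sum_congr rfl fun u _ => ?_
  ring

theorem two_pi_inv_le_one : (2 * Real.pi)⁻¹ ≤ 1 :=
  inv_le_one_of_one_le₀ (by linarith [Real.pi_gt_three])

/-- The factor `n ^ 2` from orthogonality cancels the normalisation `n⁻²` of the coefficients. With
`N` frequencies and weights of order `1/N` the bound is of order `1/N`, which is the rate of every
variance estimate below. -/
theorem sum_sq_cosWeight_le {ι : Type*} [Fintype ι] {n : ℕ} {s : ι → ℤ}
    (hs : ∀ i, s i ∈ Set.Ioo (0 : ℤ) n) (hinj : Function.Injective s) {w : ι → ℝ} {b : ℝ}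
    (hw : ∀ i, |w i| ≤ b) :
    ∑ t ∈ Finset.Icc (1 : ℤ) n, ∑ u ∈ Finset.Icc (1 : ℤ) n, cosWeight n s w t u ^ 2
      ≤ Fintype.card ι * b ^ 2 := by
  rcases isEmpty_or_nonempty ι with hι | ⟨⟨i0⟩⟩
  · simp [cosWeight]
  have hn : 0 < n := by have := (hs i0).1; have := (hs i0).2; omega
  have hnR : (0 : ℝ) < n := by exact_mod_cast hn
  have h1 : ∑ i, w i ^ 2 ≤ Fintype.card ι * b ^ 2 := by
    calc ∑ i, w i ^ 2 ≤ ∑ _i : ι, b ^ 2 := Finset.sum_le_sum fun i _ => by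
          rw [← sq_abs]; exact pow_le_pow_left₀ (abs_nonneg _) (hw i) 2
      _ = _ := by simp
  simp only [cosWeight, mul_pow, ← Finset.mul_sum]
  have h2 : ((2 * Real.pi * n)⁻¹ : ℝ) ^ 2 * n ^ 2 = (2 * Real.pi)⁻¹ ^ 2 := by
    field_simp
  calc _ ≤ ((2 * Real.pi * n)⁻¹ : ℝ) ^ 2 * (n ^ 2 * ∑ i, w i ^ 2) :=
        mul_le_mul_of_nonneg_left (sum_sq_cos_le hs hinj w) (by positivity)
    _ = (2 * Real.pi)⁻¹ ^ 2 * ∑ i, w i ^ 2 := by rw [← mul_assoc, h2]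
    _ ≤ 1 * (Fintype.card ι * b ^ 2) := by
        refine mul_le_mul ?_ h1 (Finset.sum_nonneg fun i _ => sq_nonneg _) zero_le_one
        exact pow_le_one₀ (by positivity) two_pi_inv_le_one
    _ = _ := one_mul _

/-- The sum of squares does not control a fourth-cumulant sum with no product structure; this
pointwise bound serves there. -/
theorem abs_cosWeight_le {ι : Type*} [Fintype ι] (n : ℕ) (s : ι → ℤ) {w : ι → ℝ} {b : ℝ}
    (hw : ∀ i, |w i| ≤ b) (t u : ℤ) :
    |cosWeight n s w t u| ≤ Fintype.card ι * b / n := by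
  have h1 : |∑ i, w i * Real.cos (fourierFreq n (s i) * (t - u))| ≤ Fintype.card ι * b := by
    refine (Finset.abs_sum_le_sum_abs _ _).trans ?_
    calc _ ≤ ∑ _i : ι, b := Finset.sum_le_sum fun i _ => by
          rw [abs_mul]
          exact (mul_le_of_le_one_right (abs_nonneg _) (Real.abs_cos_le_one _)).trans (hw i)
      _ = _ := by simp
  rw [cosWeight, abs_mul, mul_inv, abs_mul, abs_of_nonneg (by positivity : (0 : ℝ) ≤ (2 * Real.pi)⁻¹),
    abs_of_nonneg (by positivity : (0 : ℝ) ≤ (n : ℝ)⁻¹), div_eq_inv_mul, mul_assoc]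
  refine (mul_le_of_le_one_left (by positivity) two_pi_inv_le_one).trans ?_
  exact mul_le_mul_of_nonneg_left h1 (by positivity)

/-- Schur's test for a nonnegative kernel with bounded row and column sums. -/
theorem schur_test {κ : Type*} (S : Finset κ) (a : κ → ℝ) (k : κ → κ → ℝ) {B : ℝ}
    (hk : ∀ p q, 0 ≤ k p q) (hrow : ∀ p ∈ S, ∑ q ∈ S, k p q ≤ B) (hcol : ∀ q ∈ S, ∑ p ∈ S, k p q ≤ B) :
    ∑ p ∈ S, ∑ q ∈ S, |a p| * |a q| * k p q ≤ B * ∑ p ∈ S, a p ^ 2 := by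
  have h1 : ∑ p ∈ S, ∑ q ∈ S, |a p| * |a q| * k p q ≤
      ∑ p ∈ S, ∑ q ∈ S, (a p ^ 2 * k p q / 2 + a q ^ 2 * k p q / 2) := by
    refine Finset.sum_le_sum fun p _ => Finset.sum_le_sum fun q _ => ?_
    have h : |a p| * |a q| ≤ (a p ^ 2 + a q ^ 2) / 2 := by
      nlinarith [sq_nonneg (|a p| - |a q|), sq_abs (a p), sq_abs (a q)]
    exact (mul_le_mul_of_nonneg_right h (hk p q)).trans (le_of_eq (by ring))
  refine h1.trans ?_
  simp only [Finset.sum_add_distrib]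
  rw [Finset.sum_comm (f := fun p q => a q ^ 2 * k p q / 2)]
  have h2 : ∑ p ∈ S, ∑ q ∈ S, a p ^ 2 * k p q / 2 ≤ ∑ p ∈ S, a p ^ 2 * B / 2 := by
    refine Finset.sum_le_sum fun p hp => ?_
    rw [← Finset.sum_div, ← Finset.mul_sum]
    have := mul_le_mul_of_nonneg_left (hrow p hp) (sq_nonneg (a p))
    linarith
  have h3 : ∑ q ∈ S, ∑ p ∈ S, a q ^ 2 * k p q / 2 ≤ ∑ p ∈ S, a p ^ 2 * B / 2 := by
    refine Finset.sum_le_sum fun p hp => ?_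
    rw [← Finset.sum_div, ← Finset.mul_sum]
    have := mul_le_mul_of_nonneg_left (hcol p hp) (sq_nonneg (a p))
    linarith
  refine (add_le_add h2 h3).trans (le_of_eq ?_)
  rw [Finset.mul_sum, ← Finset.sum_add_distrib]
  refine Finset.sum_congr rfl fun p _ => ?_
  ring

theorem sum_abs_shift_le {g : ℤ → ℝ} (hg : Summable g) (T : Finset ℤ) (e : ℤ → ℤ)
    (he : Function.Injective e) : ∑ t ∈ T, |g (e t)| ≤ ∑' h, |g h| := by
  exact (Finset.sum_map T ⟨e, he⟩ fun h => |g h|).symm.le.trans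
    (hg.abs.sum_le_tsum _ fun _ _ => abs_nonneg _)

/-- The two pairings of a bilinear form with a product of summable Toeplitz kernels. -/
theorem sum_toeplitz_le {g h : ℤ → ℝ} (hg : Summable g) (hh : Summable h) (T : Finset ℤ)
    (A : ℤ × ℤ → ℝ) :
    ∑ p ∈ T ×ˢ T, ∑ q ∈ T ×ˢ T, |A p| * |A q| * (|g (p.1 - q.1)| * |h (p.2 - q.2)|)
      ≤ (∑' i, |g i|) * (∑' i, |h i|) * ∑ p ∈ T ×ˢ T, A p ^ 2 := by
  have hG : 0 ≤ ∑' i, |g i| := tsum_nonneg fun _ => abs_nonneg _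
  refine schur_test _ A (fun p q => |g (p.1 - q.1)| * |h (p.2 - q.2)|) (fun _ _ => by positivity)
    (fun p _ => ?_) (fun q _ => ?_)
  · rw [Finset.sum_product]
    dsimp only
    rw [← Finset.sum_mul_sum]
    exact mul_le_mul (sum_abs_shift_le hg T (fun i => p.1 - i) sub_right_injective)
      (sum_abs_shift_le hh T (fun i => p.2 - i) sub_right_injective)
      (Finset.sum_nonneg fun _ _ => abs_nonneg _) hG
  · rw [Finset.sum_product]
    dsimp only
    rw [← Finset.sum_mul_sum]
    exact mul_le_mul (sum_abs_shift_le hg T (fun i => i - q.1) sub_left_injective)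
      (sum_abs_shift_le hh T (fun i => i - q.2) sub_left_injective)
      (Finset.sum_nonneg fun _ _ => abs_nonneg _) hG

/-- Exchanging the two coordinates of `q` preserves injectivity of the differences, so the same row
and column bounds hold for Schur's test. -/
theorem sum_toeplitz_cross_le {g h : ℤ → ℝ} (hg : Summable g) (hh : Summable h) (T : Finset ℤ)
    (A : ℤ × ℤ → ℝ) :
    ∑ p ∈ T ×ˢ T, ∑ q ∈ T ×ˢ T, |A p| * |A q| * (|g (p.1 - q.2)| * |h (p.2 - q.1)|)
      ≤ (∑' i, |g i|) * (∑' i, |h i|) * ∑ p ∈ T ×ˢ T, A p ^ 2 := by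
  have hG : 0 ≤ ∑' i, |g i| := tsum_nonneg fun _ => abs_nonneg _
  refine schur_test _ A (fun p q => |g (p.1 - q.2)| * |h (p.2 - q.1)|) (fun _ _ => by positivity)
    (fun p _ => ?_) (fun q _ => ?_)
  · rw [Finset.sum_product_right]
    dsimp only
    rw [← Finset.sum_mul_sum]
    exact mul_le_mul (sum_abs_shift_le hg T (fun i => p.1 - i) sub_right_injective)
      (sum_abs_shift_le hh T (fun i => p.2 - i) sub_right_injective)
      (Finset.sum_nonneg fun _ _ => abs_nonneg _) hG
  · rw [Finset.sum_product]
    dsimp only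
    rw [← Finset.sum_mul_sum]
    exact mul_le_mul (sum_abs_shift_le hg T (fun i => i - q.2) sub_left_injective)
      (sum_abs_shift_le hh T (fun i => i - q.1) sub_left_injective)
      (Finset.sum_nonneg fun _ _ => abs_nonneg _) hG

/-! ### Deviations, variances and stationarity -/

section Probability

variable {Ω : Type*} [MeasurableSpace Ω] {P : Measure Ω} [IsProbabilityMeasure P]

/-- The mean absolute deviation is at most the standard deviation. -/
theorem integral_abs_sub_integral_le {Y : Ω → ℝ} (hY : MemLp Y 2 P) :
    ∫ ω, |Y ω - ∫ ω', Y ω' ∂P| ∂P ≤ Real.sqrt (variance Y P) := by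
  have hZ : MemLp (fun ω => |Y ω - ∫ ω', Y ω' ∂P|) 2 P := (hY.sub (memLp_const _)).abs
  apply Real.le_sqrt_of_sq_le
  -- Nonnegativity of the variance of `|Y - E Y|` is the inequality `(E|Y - E Y|) ^ 2 ≤ Var Y`.
  have h := variance_nonneg (fun ω => |Y ω - ∫ ω', Y ω' ∂P|) P
  rw [variance_eq_sub hZ] at h
  rw [variance_eq_integral hY.aemeasurable]
  simpa [sq_abs] using h

theorem variance_linearCombination {κ : Type*} (S : Finset κ) (a : κ → ℝ) {W : κ → Ω → ℝ}
    (hW : ∀ p, MemLp (W p) 2 P) :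
    variance (fun ω => ∑ p ∈ S, a p * W p ω) P =
      ∑ p ∈ S, ∑ q ∈ S, a p * a q *
        ((∫ ω, W p ω * W q ω ∂P) - (∫ ω, W p ω ∂P) * ∫ ω, W q ω ∂P) := by
  have h1 : (fun ω => ∑ p ∈ S, a p * W p ω) = ∑ p ∈ S, fun ω => a p * W p ω := by
    ext ω; simp
  rw [h1, variance_sum' fun p _ => (hW p).const_mul (a p)]
  refine Finset.sum_congr rfl fun p _ => Finset.sum_congr rfl fun q _ => ?_
  rw [covariance_const_mul_left, covariance_const_mul_right, covariance_eq_sub (hW p) (hW q)]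
  simp only [Pi.mul_apply]; ring

end Probability

section Stationary

variable {Ω : Type*} [MeasurableSpace Ω] {P : Measure Ω} {m : ℕ} {X : ℤ → Ω → Fin m → ℝ}

theorem StrictlyStationary.integral_shift (hX : StrictlyStationary P X) (h : ℤ)
    {F : (ℤ → Fin m → ℝ) → ℝ} (hF : Measurable F) :
    ∫ ω, F (fun t => X (t + h) ω) ∂P = ∫ ω, F (fun t => X t ω) ∂P :=
  ((hX h).comp hF).integral_eq

/-- Every moment in the partition formula is the expectation of a measurable function of the path,
so shift invariance applies block by block. It brings the last time index to `0`, the normalisation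
of `autocumulant`. -/
theorem StrictlyStationary.jointCumulant_shift (hX : StrictlyStationary P X) (h : ℤ) {r : ℕ}
    (t : Fin r → ℤ) (a : Fin r → Fin m) :
    jointCumulant P (fun i ω => X (t i + h) ω (a i)) =
      jointCumulant P fun i ω => X (t i) ω (a i) := by
  unfold jointCumulant
  refine Finset.sum_congr rfl fun π _ => ?_
  congr 1
  refine Finset.prod_congr rfl fun B _ => ?_
  exact hX.integral_shift h (F := fun x => ∏ i ∈ B, x (t i) (a i))
    (Finset.measurable_fun_prod _ fun i _ => by fun_prop)

theorem StrictlyStationary.integral_eq (hX : StrictlyStationary P X) (t : ℤ) (a : Fin m) :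
    ∫ ω, X t ω a ∂P = ∫ ω, X 0 ω a ∂P := by
  have := hX.integral_shift t (F := fun x => x 0 a) (by fun_prop)
  simpa using this

theorem StrictlyStationary.integral_centered_mul (hX : StrictlyStationary P X) (j k : Fin m)
    (t u : ℤ) :
    ∫ ω, (X t ω j - ∫ ω', X 0 ω' j ∂P) * (X u ω k - ∫ ω', X 0 ω' k ∂P) ∂P
      = autocov P X j k (t - u) := by
  have := hX.integral_shift u (F := fun x => (x (t - u) j - ∫ ω', X 0 ω' j ∂P) *
    (x 0 k - ∫ ω', X 0 ω' k ∂P)) (by fun_prop)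
  simp only [sub_add_cancel, zero_add] at this
  rw [this, autocov, covariance, hX.integral_eq (t - u)]

end Stationary

/-! ### Concentration under cumulant summability -/

section Cumulant

variable {Ω : Type*} [MeasurableSpace Ω] {P : Measure Ω} [IsProbabilityMeasure P] {m : ℕ}
  {X : ℤ → Ω → Fin m → ℝ}

/-- Concentration of weighted periodogram averages under cumulant summability. -/
theorem CumulantSummable.exists_integral_abs_le (hX : StrictlyStationary P X)
    (hC : CumulantSummable P X) (hγ : ∀ j k, Summable (autocov P X j k)) (j k : Fin m) :
    ∃ C : ℝ, 0 ≤ C ∧ ∀ (N : ℕ) (n : ℕ) (s : Fin N → ℤ) (w : Fin N → ℝ) (b : ℝ),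
      (∀ i, s i ∈ Set.Ioo (0 : ℤ) n) → Function.Injective s → (∀ i, |w i| ≤ b) →
      ∫ ω, |(∑ p ∈ Finset.Icc (1 : ℤ) n ×ˢ Finset.Icc (1 : ℤ) n, cosWeight n s w p.1 p.2 *
          ((X p.1 ω j - ∫ ω', X 0 ω' j ∂P) * (X p.2 ω k - ∫ ω', X 0 ω' k ∂P))) -
        ∑ p ∈ Finset.Icc (1 : ℤ) n ×ˢ Finset.Icc (1 : ℤ) n, cosWeight n s w p.1 p.2 *
          autocov P X j k (p.1 - p.2)| ∂P ≤ Real.sqrt (C * (N * b ^ 2)) := by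
  set μ : Fin m → ℝ := fun a => ∫ ω', X 0 ω' a ∂P with hμ
  let c : (Fin 3 → ℤ) → ℝ := autocumulant P X ![j, k, j, k]
  have hc : Summable c := by
    have h := hC.summable 3 (by norm_num) ![j, k, j, k] 0
    -- The weight `1 + |t 0|` is at least `1`, so plain absolute summability follows.
    refine Summable.of_norm_bounded h fun t => ?_
    rw [Real.norm_eq_abs]
    exact le_mul_of_one_le_left (abs_nonneg _) (by linarith [abs_nonneg ((t 0 : ℤ) : ℝ)])
  let G : Fin m → Fin m → ℝ := fun a b => ∑' h, |autocov P X a b h|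
  have hG : ∀ a b, 0 ≤ G a b := fun a b => tsum_nonneg fun _ => abs_nonneg _
  have hK : 0 ≤ ∑' f, |c f| := tsum_nonneg fun _ => abs_nonneg _
  refine ⟨G j j * G k k + G j k * G k j + ∑' f, |c f|, by
    have := mul_nonneg (hG j j) (hG k k); have := mul_nonneg (hG j k) (hG k j); linarith, ?_⟩
  intro N n s w b hs hinj hw
  set T := Finset.Icc (1 : ℤ) n
  let A : ℤ × ℤ → ℝ := fun p => cosWeight n s w p.1 p.2
  let W : ℤ × ℤ → Ω → ℝ := fun p ω => (X p.1 ω j - μ j) * (X p.2 ω k - μ k)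
  have h4 : ∀ t a, MemLp (fun ω => X t ω a - μ a) 4 P := fun t a =>
    (hC.moments t a 4).sub (memLp_const _)
  have hW : ∀ p, MemLp (W p) 2 P := fun p => memLp_two_mul_of_memLp_four (h4 _ _) (h4 _ _)
  have hWint : ∀ p, ∫ ω, W p ω ∂P = autocov P X j k (p.1 - p.2) := fun p =>
    hX.integral_centered_mul j k p.1 p.2
  have hQ : MemLp (fun ω => ∑ p ∈ T ×ˢ T, A p * W p ω) 2 P :=
    memLp_finsetSum _ fun p _ => (hW p).const_mul _
  have hmean : ∫ ω, ∑ p ∈ T ×ˢ T, A p * W p ω ∂P =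
      ∑ p ∈ T ×ˢ T, A p * autocov P X j k (p.1 - p.2) := by
    rw [integral_finsetSum _ fun p _ => ((hW p).integrable (by norm_num)).const_mul _]
    simp_rw [integral_const_mul, hWint]
  have hmain := integral_abs_sub_integral_le hQ
  rw [hmean] at hmain
  refine hmain.trans (Real.sqrt_le_sqrt ?_)
  rw [variance_linearCombination _ _ hW]
  -- Of the three pairings of the four variables, the one that pairs within `p` and within `q` is
  -- cancelled by the product of the means; two pairings and the fourth cumulant remain.
  have hcov : ∀ p q : ℤ × ℤ, (∫ ω, W p ω * W q ω ∂P) - (∫ ω, W p ω ∂P) * ∫ ω, W q ω ∂P =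
      autocov P X j j (p.1 - q.1) * autocov P X k k (p.2 - q.2) +
      autocov P X j k (p.1 - q.2) * autocov P X k j (p.2 - q.1) +
      c ![p.1 - q.2, p.2 - q.2, q.1 - q.2] := by
    intro p q
    let τ : Fin 4 → ℤ := ![p.1, p.2, q.1, q.2]
    let a : Fin 4 → Fin m := ![j, k, j, k]
    have e1 : c ![p.1 - q.2, p.2 - q.2, q.1 - q.2] =
        jointCumulant P fun i ω => X (τ i) ω (a i) := by
      rw [← hX.jointCumulant_shift (-q.2) τ a]
      simp only [c, autocumulant]
      congr 1
      funext i ω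
      fin_cases i <;> simp [τ, a, Fin.snoc, sub_eq_add_neg]
      rfl
    rw [e1, jointCumulant_four_centered P _ (fun i => hC.moments (τ i) (a i) 4) (fun i => μ (a i))
      fun i => hX.integral_eq _ _]
    have e2 : ∀ i l : Fin 4, ∫ ω, (X (τ i) ω (a i) - μ (a i)) * (X (τ l) ω (a l) - μ (a l)) ∂P =
        autocov P X (a i) (a l) (τ i - τ l) := fun i l => hX.integral_centered_mul _ _ _ _
    simp only [e2]
    have e3 : ∫ ω, W p ω * W q ω ∂P = ∫ ω, (X (τ 0) ω (a 0) - μ (a 0)) *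
        (X (τ 1) ω (a 1) - μ (a 1)) * (X (τ 2) ω (a 2) - μ (a 2)) *
        (X (τ 3) ω (a 3) - μ (a 3)) ∂P := by
      refine integral_congr_ae (.of_forall fun ω => ?_)
      change (X p.1 ω j - μ j) * (X p.2 ω k - μ k) * ((X q.1 ω j - μ j) * (X q.2 ω k - μ k)) =
        (X p.1 ω j - μ j) * (X p.2 ω k - μ k) * (X q.1 ω j - μ j) * (X q.2 ω k - μ k)
      ring
    rw [e3, hWint, hWint]
    change _ = _ + (_ - autocov P X j k (p.1 - p.2) * autocov P X j k (q.1 - q.2) -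
      autocov P X j j (p.1 - q.1) * autocov P X k k (p.2 - q.2) -
      autocov P X j k (p.1 - q.2) * autocov P X k j (p.2 - q.1))
    ring
  have hF : ∑ p ∈ T ×ˢ T, A p ^ 2 ≤ N * b ^ 2 := by
    rw [Finset.sum_product]
    simpa using sum_sq_cosWeight_le hs hinj hw
  have hA : ∀ p, |A p| ≤ N * b / n := fun p => by simpa using abs_cosWeight_le n s hw p.1 p.2
  -- With the last time fixed, the other three differences range injectively, so the sum over them
  -- is at most `∑|c|`; the last time contributes a factor `n`. Then `n * (N * b / n) ^ 2 = N * b ^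
  -- 2 * (N / n)`, and `N ≤ n` because the `s i` are distinct integers in `(0, n)`.
  have hκ : ∑ p ∈ T ×ˢ T, ∑ q ∈ T ×ˢ T, |A p| * |A q| * |c ![p.1 - q.2, p.2 - q.2, q.1 - q.2]| ≤
      (∑' f, |c f|) * (N * b ^ 2) := by
    rcases Nat.eq_zero_or_pos n with hn | hn
    · subst hn
      have : T = ∅ := by simp [T]
      rw [this]
      simpa using mul_nonneg hK (by positivity)
    have hnR : (0 : ℝ) < n := by exact_mod_cast hn
    have hNn : (N : ℝ) ≤ n := by
      have : Fintype.card (Fin N) ≤ (Finset.Ioo (0 : ℤ) n).card := by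
        rw [← Finset.card_univ]
        exact Finset.card_le_card_of_injOn s (fun i _ => by simpa using hs i) hinj.injOn
      rw [Fintype.card_fin, Int.card_Ioo] at this
      exact_mod_cast (by omega : N ≤ n)
    calc _ ≤ ∑ p ∈ T ×ˢ T, ∑ q ∈ T ×ˢ T, (N * b / n) ^ 2 *
            |c ![p.1 - q.2, p.2 - q.2, q.1 - q.2]| := by
          refine Finset.sum_le_sum fun p _ => Finset.sum_le_sum fun q _ => ?_
          rw [pow_two]
          exact mul_le_mul_of_nonneg_right (mul_le_mul (hA p) (hA q) (abs_nonneg _)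
            ((abs_nonneg _).trans (hA p))) (abs_nonneg _)
      _ = (N * b / n) ^ 2 * ∑ v ∈ T, ∑ z ∈ (T ×ˢ T) ×ˢ T,
            |c ![z.1.1 - v, z.1.2 - v, z.2 - v]| := by
          simp_rw [← Finset.mul_sum]
          congr 1
          simp only [Finset.sum_product]
          rw [Finset.sum_congr rfl fun t _ => Finset.sum_congr rfl fun u _ => Finset.sum_comm,
            Finset.sum_congr rfl fun t _ => Finset.sum_comm, Finset.sum_comm]
      _ ≤ (N * b / n) ^ 2 * ∑ v ∈ T, ∑' f, |c f| := by
          refine mul_le_mul_of_nonneg_left (Finset.sum_le_sum fun v _ => ?_) (sq_nonneg _)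
          let e : (ℤ × ℤ) × ℤ ↪ (Fin 3 → ℤ) := ⟨fun z => ![z.1.1 - v, z.1.2 - v, z.2 - v], by
            rintro ⟨⟨x, y⟩, z⟩ ⟨⟨x', y'⟩, z'⟩ h
            have h0 := congrFun h 0; have h1 := congrFun h 1; have h2 := congrFun h 2
            simp at h0 h1 h2
            simp [h0, h1, h2]⟩
          have : ∑ z ∈ (T ×ˢ T) ×ˢ T, |c ![z.1.1 - v, z.1.2 - v, z.2 - v]| =
            ∑ f ∈ ((T ×ˢ T) ×ˢ T).map e, |c f| := by rw [Finset.sum_map]; rfl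
          rw [this]
          exact hc.abs.sum_le_tsum _ fun _ _ => abs_nonneg _
      _ = (∑' f, |c f|) * (N * b ^ 2) * (N / n) := by
          have hT : T.card = n := by simp [T]
          rw [Finset.sum_const, hT, nsmul_eq_mul]
          field_simp
      _ ≤ (∑' f, |c f|) * (N * b ^ 2) * 1 := by
          refine mul_le_mul_of_nonneg_left ?_ (mul_nonneg hK (by positivity))
          rwa [div_le_one hnR]
      _ = _ := mul_one _
  have hb1 := (sum_toeplitz_le (hγ j j) (hγ k k) T A).trans
    (mul_le_mul_of_nonneg_left hF (mul_nonneg (hG j j) (hG k k)))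
  have hb2 := (sum_toeplitz_cross_le (hγ j k) (hγ k j) T A).trans
    (mul_le_mul_of_nonneg_left hF (mul_nonneg (hG j k) (hG k j)))
  refine le_trans ?_ ((add_le_add (add_le_add hb1 hb2) hκ).trans (le_of_eq (by ring)))
  rw [← Finset.sum_add_distrib, ← Finset.sum_add_distrib]
  refine Finset.sum_le_sum fun p _ => ?_
  rw [← Finset.sum_add_distrib, ← Finset.sum_add_distrib]
  refine Finset.sum_le_sum fun q _ => ?_
  rw [hcov, ← mul_add, ← mul_add, ← abs_mul, ← abs_mul, ← abs_mul]
  refine (le_abs_self _).trans ?_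
  rw [abs_mul]
  exact mul_le_mul_of_nonneg_left ((abs_add_le _ _).trans (by gcongr; exact abs_add_le _ _))
    (abs_nonneg _)

end Cumulant

/-! ### Fourth moments of the noise and variances of its quadratic forms -/

/-- An i.i.d. centred sequence of random vectors with finite fourth moments and uncorrelated
components of variances `D`. -/
structure IsDiagNoise {Ω : Type*} [MeasurableSpace Ω] {m : ℕ} (P : Measure Ω)
    (ε : ℤ → Ω → Fin m → ℝ) (D : Fin m → ℝ) : Prop where
  indep : iIndepFun ε P
  ident : ∀ t : ℤ, IdentDistrib (ε t) (ε 0) P P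
  memLp : ∀ a : Fin m, MemLp (fun ω => ε 0 ω a) 4 P
  mean : ∀ a : Fin m, ∫ ω, ε 0 ω a ∂P = 0
  cov : ∀ a b : Fin m, ∫ ω, ε 0 ω a * ε 0 ω b ∂P = if a = b then D a else 0

namespace IsDiagNoise

variable {Ω : Type*} [MeasurableSpace Ω] {m : ℕ} {P : Measure Ω}
  {ε : ℤ → Ω → Fin m → ℝ} {D : Fin m → ℝ}

theorem aemeasurable (h : IsDiagNoise P ε D) (t : ℤ) : AEMeasurable (ε t) P :=
  (h.ident t).aemeasurable_fst

theorem memLp_apply (h : IsDiagNoise P ε D) (t : ℤ) (a : Fin m) :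
    MemLp (fun ω => ε t ω a) 4 P :=
  ((h.ident t).comp (u := fun x : Fin m → ℝ => x a) (by fun_prop)).memLp_iff.2 (h.memLp a)

theorem integral_comp (h : IsDiagNoise P ε D) (t : ℤ) {F : (Fin m → ℝ) → ℝ} (hF : Measurable F) :
    ∫ ω, F (ε t ω) ∂P = ∫ ω, F (ε 0 ω) ∂P :=
  ((h.ident t).comp hF).integral_eq

theorem integral_apply (h : IsDiagNoise P ε D) (t : ℤ) (a : Fin m) : ∫ ω, ε t ω a ∂P = 0 := by
  rw [h.integral_comp t (F := fun x => x a) (by fun_prop), h.mean]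

theorem nonneg (h : IsDiagNoise P ε D) (a : Fin m) : 0 ≤ D a := by
  have := h.cov a a
  rw [if_pos rfl] at this
  rw [← this]
  exact integral_nonneg fun ω => mul_self_nonneg _

theorem integral_mul (h : IsDiagNoise P ε D) (p q : ℤ × Fin m) :
    ∫ ω, ε p.1 ω p.2 * ε q.1 ω q.2 ∂P = if p = q then D p.2 else 0 := by
  obtain ⟨t, a⟩ := p
  obtain ⟨u, b⟩ := q
  by_cases htu : t = u
  · subst htu
    simp only
    rw [h.integral_comp t (F := fun x => x a * x b) (by fun_prop), h.cov]
    simp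
  · have hi : IndepFun (fun ω => ε t ω a) (fun ω => ε u ω b) P :=
      (h.indep.indepFun htu).comp (φ := fun x : Fin m → ℝ => x a) (ψ := fun x : Fin m → ℝ => x b) (by fun_prop)
        (by fun_prop)
    rw [if_neg (by simp [htu])]
    have := hi.integral_fun_mul_eq_mul_integral (h.memLp_apply t a).aestronglyMeasurable
      (h.memLp_apply u b).aestronglyMeasurable
    rw [this, h.integral_apply, zero_mul]

/-- The factor at the isolated time is independent of the other three and has mean zero. -/
theorem integral_mul₄_of_isolated [IsProbabilityMeasure P] (h : IsDiagNoise P ε D)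
    {p q r s : ℤ × Fin m} (hq : p.1 ≠ q.1) (hr : p.1 ≠ r.1) (hs : p.1 ≠ s.1) :
    ∫ ω, ε p.1 ω p.2 * (ε q.1 ω q.2 * ε r.1 ω r.2 * ε s.1 ω s.2) ∂P = 0 := by
  have hd : Disjoint ({p.1} : Finset ℤ) {q.1, r.1, s.1} := by
    simp [hq, hr, hs]
  have hi := h.indep.indepFun_finset₀ _ _ hd h.aemeasurable
  let q' : ({q.1, r.1, s.1} : Finset ℤ) := ⟨q.1, by simp⟩
  let r' : ({q.1, r.1, s.1} : Finset ℤ) := ⟨r.1, by simp⟩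
  let s' : ({q.1, r.1, s.1} : Finset ℤ) := ⟨s.1, by simp⟩
  have hi2 : IndepFun (fun ω => ε p.1 ω p.2)
      (fun ω => ε q.1 ω q.2 * ε r.1 ω r.2 * ε s.1 ω s.2) P :=
    hi.comp (φ := fun x : ({p.1} : Finset ℤ) → Fin m → ℝ => x ⟨p.1, by simp⟩ p.2)
      (ψ := fun x : ({q.1, r.1, s.1} : Finset ℤ) → Fin m → ℝ => x q' q.2 * x r' r.2 * x s' s.2)
      (by fun_prop) (by fun_prop)
  rw [hi2.integral_fun_mul_eq_mul_integral (h.memLp_apply _ _).aestronglyMeasurable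
    (integrable_mul₃_of_memLp_four (h.memLp_apply _ _) (h.memLp_apply _ _)
      (h.memLp_apply _ _)).aestronglyMeasurable, h.integral_apply, zero_mul]

theorem integral_mul₄_of_pair [IsProbabilityMeasure P] (h : IsDiagNoise P ε D)
    {p q r s : ℤ × Fin m} (hpq : p.1 = q.1) (hrs : r.1 = s.1) (hpr : p.1 ≠ r.1) :
    ∫ ω, (ε p.1 ω p.2 * ε q.1 ω q.2) * (ε r.1 ω r.2 * ε s.1 ω s.2) ∂P =
      (if p = q then D p.2 else 0) * if r = s then D r.2 else 0 := by
  have hi : IndepFun (fun ω => ε p.1 ω p.2 * ε q.1 ω q.2) (fun ω => ε r.1 ω r.2 * ε s.1 ω s.2) P := by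
    rw [← hpq, ← hrs]
    exact (h.indep.indepFun hpr).comp (φ := fun x : Fin m → ℝ => x p.2 * x q.2)
      (ψ := fun x : Fin m → ℝ => x r.2 * x s.2) (by fun_prop) (by fun_prop)
  rw [hi.integral_fun_mul_eq_mul_integral
    (integrable_mul_of_memLp_four (h.memLp_apply _ _) (h.memLp_apply _ _)).aestronglyMeasurable
    (integrable_mul_of_memLp_four (h.memLp_apply _ _) (h.memLp_apply _ _)).aestronglyMeasurable,
    h.integral_mul, h.integral_mul]

/-- The fourth order cumulants of the components of the noise at a given time. -/
noncomputable def _root_.LocalQuad.noiseCumulant (P : Measure Ω) (ε : ℤ → Ω → Fin m → ℝ)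
    (D : Fin m → ℝ) (a b c d : Fin m) : ℝ :=
  (∫ ω, ε 0 ω a * ε 0 ω b * ε 0 ω c * ε 0 ω d ∂P)
    - (if a = b then D a else 0) * (if c = d then D c else 0)
    - (if a = c then D a else 0) * (if b = d then D b else 0)
    - (if a = d then D a else 0) * (if b = c then D b else 0)

/-- The expectation can be nonzero only if no time is isolated, that is, if the times form two
distinct pairs or all coincide. Two distinct pairs give the corresponding product of variances; when
all times coincide, `noiseCumulant` is by definition the correction to the three pairings. -/
theorem integral_mul₄ [IsProbabilityMeasure P] (h : IsDiagNoise P ε D) (p q r s : ℤ × Fin m) :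
    ∫ ω, (ε p.1 ω p.2 * ε q.1 ω q.2) * (ε r.1 ω r.2 * ε s.1 ω s.2) ∂P =
      (if p = q then D p.2 else 0) * (if r = s then D r.2 else 0)
      + (if p = r then D p.2 else 0) * (if q = s then D q.2 else 0)
      + (if p = s then D p.2 else 0) * (if q = r then D q.2 else 0)
      + if p.1 = q.1 ∧ p.1 = r.1 ∧ p.1 = s.1 then noiseCumulant P ε D p.2 q.2 r.2 s.2 else 0 := by
  have ne : ∀ {x y : ℤ × Fin m}, x.1 ≠ y.1 → x ≠ y := fun hxy he => hxy (congrArg Prod.fst he)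
  by_cases hp : p.1 ≠ q.1 ∧ p.1 ≠ r.1 ∧ p.1 ≠ s.1
  · obtain ⟨h1, h2, h3⟩ := hp
    have key : ∫ ω, (ε p.1 ω p.2 * ε q.1 ω q.2) * (ε r.1 ω r.2 * ε s.1 ω s.2) ∂P = 0 := by
      rw [← h.integral_mul₄_of_isolated h1 h2 h3]
      exact integral_congr_ae (.of_forall fun ω => by simp only; ring)
    rw [key, if_neg (ne h1), if_neg (ne h2), if_neg (ne h3),
      if_neg fun hh : p.1 = q.1 ∧ p.1 = r.1 ∧ p.1 = s.1 => h1 hh.1]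
    ring
  by_cases hq : q.1 ≠ p.1 ∧ q.1 ≠ r.1 ∧ q.1 ≠ s.1
  · obtain ⟨h1, h2, h3⟩ := hq
    have key : ∫ ω, (ε p.1 ω p.2 * ε q.1 ω q.2) * (ε r.1 ω r.2 * ε s.1 ω s.2) ∂P = 0 := by
      rw [← h.integral_mul₄_of_isolated h1 h2 h3]
      exact integral_congr_ae (.of_forall fun ω => by simp only; ring)
    rw [key, if_neg (ne h1).symm, if_neg (ne h2), if_neg (ne h3),
      if_neg fun hh : p.1 = q.1 ∧ p.1 = r.1 ∧ p.1 = s.1 => h1 hh.1.symm]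
    ring
  by_cases hr : r.1 ≠ p.1 ∧ r.1 ≠ q.1 ∧ r.1 ≠ s.1
  · obtain ⟨h1, h2, h3⟩ := hr
    have key : ∫ ω, (ε p.1 ω p.2 * ε q.1 ω q.2) * (ε r.1 ω r.2 * ε s.1 ω s.2) ∂P = 0 := by
      rw [← h.integral_mul₄_of_isolated h1 h2 h3]
      exact integral_congr_ae (.of_forall fun ω => by simp only; ring)
    rw [key, if_neg (ne h1).symm, if_neg (ne h2).symm, if_neg (ne h3),
      if_neg fun hh : p.1 = q.1 ∧ p.1 = r.1 ∧ p.1 = s.1 => h1 hh.2.1.symm]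
    ring
  by_cases hs : s.1 ≠ p.1 ∧ s.1 ≠ q.1 ∧ s.1 ≠ r.1
  · obtain ⟨h1, h2, h3⟩ := hs
    have key : ∫ ω, (ε p.1 ω p.2 * ε q.1 ω q.2) * (ε r.1 ω r.2 * ε s.1 ω s.2) ∂P = 0 := by
      rw [← h.integral_mul₄_of_isolated h1 h2 h3]
      exact integral_congr_ae (.of_forall fun ω => by simp only; ring)
    rw [key, if_neg (ne h1).symm, if_neg (ne h2).symm, if_neg (ne h3).symm,
      if_neg fun hh : p.1 = q.1 ∧ p.1 = r.1 ∧ p.1 = s.1 => h1 hh.2.2.symm]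
    ring
  by_cases hall : p.1 = q.1 ∧ p.1 = r.1 ∧ p.1 = s.1
  · rw [if_pos hall]
    obtain ⟨t, a⟩ := p
    obtain ⟨t1, b⟩ := q
    obtain ⟨t2, c⟩ := r
    obtain ⟨t3, d⟩ := s
    obtain ⟨rfl, rfl, rfl⟩ := hall
    have h1 := h.integral_comp t (F := fun x => (x a * x b) * (x c * x d)) (by fun_prop)
    have h2 : ∫ ω, (ε 0 ω a * ε 0 ω b) * (ε 0 ω c * ε 0 ω d) ∂P =
        ∫ ω, ε 0 ω a * ε 0 ω b * ε 0 ω c * ε 0 ω d ∂P :=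
      integral_congr_ae (.of_forall fun ω => by simp only; ring)
    simp only at h1 ⊢
    rw [h1, h2, noiseCumulant]
    simp only [Prod.mk.injEq, true_and]
    ring
  rw [if_neg hall]
  -- No time is isolated and the four are not all equal, so they split into two pairs at different
  -- times. The partner of `p` selects the pairing.
  by_cases hpq : p.1 = q.1
  · have hpr : p.1 ≠ r.1 := by intro hh; omega
    have hps : p.1 ≠ s.1 := by intro hh; omega
    rw [h.integral_mul₄_of_pair hpq (by omega) hpr, if_neg (ne hpr), if_neg (ne hps)]
    ring
  by_cases hpr : p.1 = r.1
  · have hqs : q.1 = s.1 := by omega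
    have hps : p.1 ≠ s.1 := by omega
    have := h.integral_mul₄_of_pair hpr hqs hpq
    rw [if_neg (ne hpq), if_neg (ne hps), zero_mul, zero_mul, zero_add, add_zero, add_zero, ← this]
    refine integral_congr_ae (.of_forall fun ω => ?_)
    simp only; ring
  · have hps : p.1 = s.1 := by omega
    have hqr : q.1 = r.1 := by omega
    have := h.integral_mul₄_of_pair hps hqr hpq
    rw [if_neg (ne hpq), if_neg (ne hpr), zero_mul, zero_mul, zero_add, add_zero, zero_add, ← this]
    refine integral_congr_ae (.of_forall fun ω => ?_)
    simp only; ring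

theorem ae_eq_zero [IsProbabilityMeasure P] (h : IsDiagNoise P ε D) {a : Fin m} (ha : D a = 0) :
    ∀ᵐ ω ∂P, ε 0 ω a = 0 := by
  have h1 := h.cov a a
  rw [if_pos rfl, ha] at h1
  have h2 := (integral_eq_zero_iff_of_nonneg (fun ω => mul_self_nonneg _)
    (integrable_mul_of_memLp_four (h.memLp a) (h.memLp a))).1 h1
  filter_upwards [h2] with ω hω
  simpa using hω

/-- A component of variance zero vanishes almost surely, so the fourth moment and each of the three
pairings containing it vanish. -/
theorem noiseCumulant_eq_zero [IsProbabilityMeasure P] (h : IsDiagNoise P ε D) {a b c d : Fin m}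
    (h0 : (D a * D b) * (D c * D d) = 0) : noiseCumulant P ε D a b c d = 0 := by
  have hI : ∀ {e}, D e = 0 → (e = a ∨ e = b ∨ e = c ∨ e = d) →
      ∫ ω, ε 0 ω a * ε 0 ω b * ε 0 ω c * ε 0 ω d ∂P = 0 := by
    intro e he hcase
    refine integral_eq_zero_of_ae ?_
    filter_upwards [h.ae_eq_zero he] with ω hω
    rcases hcase with rfl | rfl | rfl | rfl <;> simp [hω]
  have hl : ∀ {x y : Fin m}, D x = 0 → (if x = y then D x else 0) = 0 := fun hx => by simp [hx]
  have hr : ∀ {x y : Fin m}, D y = 0 → (if x = y then D x else 0) = 0 := fun {x y} hy => by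
    split_ifs with hxy
    · rw [hxy, hy]
    · rfl
  rw [noiseCumulant]
  rcases mul_eq_zero.1 h0 with h0 | h0 <;> rcases mul_eq_zero.1 h0 with h0 | h0
  · rw [hI h0 (by simp), hl h0, hl h0, hl h0]; ring
  · rw [hI h0 (by simp), hr h0, hl h0, hl h0]; ring
  · rw [hI h0 (by simp), hl h0, hr h0, hr h0]; ring
  · rw [hI h0 (by simp), hr h0, hr h0, hr h0]; ring

/-- There are finitely many quadruples of components, so the sum of the ratios is a valid constant;
where the denominator vanishes the cumulant does too. The product form on the right is what later
turns a fourfold component sum into a square weighted by the variances. -/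
theorem exists_noiseCumulant_le [IsProbabilityMeasure P] (h : IsDiagNoise P ε D) :
    ∃ C : ℝ, 0 ≤ C ∧ ∀ a b c d, |noiseCumulant P ε D a b c d| ≤ C * ((D a * D b) * (D c * D d)) := by
  let v : Fin m × Fin m × Fin m × Fin m → ℝ := fun z => (D z.1 * D z.2.1) * (D z.2.2.1 * D z.2.2.2)
  let f : Fin m × Fin m × Fin m × Fin m → ℝ := fun z =>
    |noiseCumulant P ε D z.1 z.2.1 z.2.2.1 z.2.2.2| / v z
  have hv : ∀ z, 0 ≤ v z := fun z => mul_nonneg (mul_nonneg (h.nonneg _) (h.nonneg _))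
    (mul_nonneg (h.nonneg _) (h.nonneg _))
  have hf : ∀ z, 0 ≤ f z := fun z => div_nonneg (abs_nonneg _) (hv z)
  refine ⟨∑ z, f z, Finset.sum_nonneg fun z _ => hf z, fun a b c d => ?_⟩
  by_cases h0 : (D a * D b) * (D c * D d) = 0
  · rw [h.noiseCumulant_eq_zero h0, h0]; simp
  · have h1 : |noiseCumulant P ε D a b c d| = f (a, b, c, d) * v (a, b, c, d) := by
      rw [div_mul_cancel₀ _ h0]
    rw [h1]
    exact mul_le_mul_of_nonneg_right
      (Finset.single_le_sum (fun z _ => hf z) (Finset.mem_univ (a, b, c, d))) (hv _)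

/-- Variance of a quadratic form in the noise. -/
theorem exists_variance_quadraticForm_le [IsProbabilityMeasure P] (h : IsDiagNoise P ε D) :
    ∃ C : ℝ, 0 ≤ C ∧ ∀ (R : Finset ℤ) (c : ℤ × Fin m → ℤ × Fin m → ℝ),
      variance (fun ω => ∑ z ∈ (R ×ˢ Finset.univ) ×ˢ (R ×ˢ Finset.univ),
        c z.1 z.2 * (ε z.1.1 ω z.1.2 * ε z.2.1 ω z.2.2)) P ≤
      2 * ∑ p ∈ R ×ˢ Finset.univ, ∑ q ∈ R ×ˢ Finset.univ, D p.2 * D q.2 * c p q ^ 2 +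
      C * ∑ τ ∈ R, (∑ a, ∑ b, D a * D b * |c (τ, a) (τ, b)|) ^ 2 := by
  obtain ⟨C, hC0, hC⟩ := h.exists_noiseCumulant_le
  refine ⟨C, hC0, fun R c => ?_⟩
  set S : Finset (ℤ × Fin m) := R ×ˢ Finset.univ with hS
  rw [variance_linearCombination _ (fun z : (ℤ × Fin m) × (ℤ × Fin m) => c z.1 z.2)
    (W := fun z ω => ε z.1.1 ω z.1.2 * ε z.2.1 ω z.2.2)
    fun z => memLp_two_mul_of_memLp_four (h.memLp_apply _ _) (h.memLp_apply _ _)]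
  -- The pairing within `z` and within `z'` cancels against the product of means. The others force
  -- `z' = z` or `z' = z.swap`, and the cumulant forces all four times to agree.
  have hcov : ∀ z z' : (ℤ × Fin m) × (ℤ × Fin m), c z.1 z.2 * c z'.1 z'.2 *
      ((∫ ω, (ε z.1.1 ω z.1.2 * ε z.2.1 ω z.2.2) * (ε z'.1.1 ω z'.1.2 * ε z'.2.1 ω z'.2.2) ∂P) -
        (∫ ω, ε z.1.1 ω z.1.2 * ε z.2.1 ω z.2.2 ∂P) * ∫ ω, ε z'.1.1 ω z'.1.2 * ε z'.2.1 ω z'.2.2 ∂P)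
      = (if z = z' then D z.1.2 * D z.2.2 * (c z.1 z.2 * c z'.1 z'.2) else 0) +
        (if z.swap = z' then D z.1.2 * D z.2.2 * (c z.1 z.2 * c z'.1 z'.2) else 0) +
        (if z.1.1 = z.2.1 ∧ z.1.1 = z'.1.1 ∧ z.1.1 = z'.2.1 then c z.1 z.2 * c z'.1 z'.2 *
          noiseCumulant P ε D z.1.2 z.2.2 z'.1.2 z'.2.2 else 0) := by
    intro z z'
    obtain ⟨p, q⟩ := z
    obtain ⟨r, s⟩ := z'
    rw [h.integral_mul₄, h.integral_mul, h.integral_mul]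
    simp only [Prod.mk.injEq, Prod.swap_prod_mk]
    have e1 : (if p = r ∧ q = s then D p.2 * D q.2 * (c p q * c r s) else 0) =
      c p q * c r s * ((if p = r then D p.2 else 0) * (if q = s then D q.2 else 0)) := by
      by_cases h1 : p = r <;> by_cases h2 : q = s <;> simp [h1, h2]; ring
    have e2 : (if q = r ∧ p = s then D p.2 * D q.2 * (c p q * c r s) else 0) =
      c p q * c r s * ((if p = s then D p.2 else 0) * (if q = r then D q.2 else 0)) := by
      by_cases h1 : p = s <;> by_cases h2 : q = r <;> simp [h1, h2]; ring
    rw [e1, e2]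
    split_ifs <;> ring
  simp_rw [hcov, Finset.sum_add_distrib]
  have b1 : ∑ z ∈ S ×ˢ S, ∑ z' ∈ S ×ˢ S,
      (if z = z' then D z.1.2 * D z.2.2 * (c z.1 z.2 * c z'.1 z'.2) else 0) =
      ∑ p ∈ S, ∑ q ∈ S, D p.2 * D q.2 * c p q ^ 2 := by
    refine Eq.trans (Finset.sum_congr rfl fun z hz => ?_)
      (Finset.sum_product' S S fun p q => D p.2 * D q.2 * c p q ^ 2)
    rw [Finset.sum_ite_eq, if_pos hz]; ring
  -- The swapped pairing yields `c p q * c q p`, at most the mean of the two squares; by symmetry it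
  -- is dominated by the direct pairing, whence the factor 2 in the statement.
  have b2 : ∑ z ∈ S ×ˢ S, ∑ z' ∈ S ×ˢ S,
      (if z.swap = z' then D z.1.2 * D z.2.2 * (c z.1 z.2 * c z'.1 z'.2) else 0) ≤
      ∑ p ∈ S, ∑ q ∈ S, D p.2 * D q.2 * c p q ^ 2 := by
    have e : ∑ z ∈ S ×ˢ S, ∑ z' ∈ S ×ˢ S,
        (if z.swap = z' then D z.1.2 * D z.2.2 * (c z.1 z.2 * c z'.1 z'.2) else 0) =
        ∑ p ∈ S, ∑ q ∈ S, D p.2 * D q.2 * (c p q * c q p) := by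
      refine Eq.trans (Finset.sum_congr rfl fun z hz => ?_)
        (Finset.sum_product' S S fun p q => D p.2 * D q.2 * (c p q * c q p))
      rw [Finset.sum_ite_eq, if_pos (by simpa [and_comm] using hz)]; simp
    rw [e]
    calc _ ≤ ∑ p ∈ S, ∑ q ∈ S, (D p.2 * D q.2 * c p q ^ 2 / 2 + D q.2 * D p.2 * c q p ^ 2 / 2) := by
          refine Finset.sum_le_sum fun p _ => Finset.sum_le_sum fun q _ => ?_
          have := mul_nonneg (mul_nonneg (h.nonneg p.2) (h.nonneg q.2)) (sq_nonneg (c p q - c q p))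
          nlinarith
      _ = _ := by
          simp only [Finset.sum_add_distrib]
          rw [Finset.sum_comm (f := fun p q => D q.2 * D p.2 * c q p ^ 2 / 2),
            ← Finset.sum_add_distrib]
          refine Finset.sum_congr rfl fun p _ => ?_
          rw [← Finset.sum_add_distrib]
          refine Finset.sum_congr rfl fun q _ => ?_
          ring
  have b3 : ∑ z ∈ S ×ˢ S, ∑ z' ∈ S ×ˢ S,
      (if z.1.1 = z.2.1 ∧ z.1.1 = z'.1.1 ∧ z.1.1 = z'.2.1 then c z.1 z.2 * c z'.1 z'.2 *
          noiseCumulant P ε D z.1.2 z.2.2 z'.1.2 z'.2.2 else 0) ≤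
      C * ∑ τ ∈ R, (∑ a, ∑ b, D a * D b * |c (τ, a) (τ, b)|) ^ 2 := by
    have e : ∑ z ∈ S ×ˢ S, ∑ z' ∈ S ×ˢ S,
      (if z.1.1 = z.2.1 ∧ z.1.1 = z'.1.1 ∧ z.1.1 = z'.2.1 then c z.1 z.2 * c z'.1 z'.2 *
          noiseCumulant P ε D z.1.2 z.2.2 z'.1.2 z'.2.2 else 0) =
        ∑ τ ∈ R, ∑ a, ∑ b, ∑ a', ∑ b', c (τ, a) (τ, b) * c (τ, a') (τ, b') *
          noiseCumulant P ε D a b a' b' := by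
      simp only [hS, Finset.sum_product]
      refine Finset.sum_congr rfl fun τ hτ => Finset.sum_congr rfl fun a _ => ?_
      rw [Finset.sum_comm]
      refine Finset.sum_congr rfl fun b _ => ?_
      rw [Finset.sum_eq_single τ (fun σ _ hσ => ?_) (fun hh => absurd hτ hh)]
      swap
      · simp [hσ.symm]
      rw [Finset.sum_eq_single τ (fun σ _ hσ => ?_) (fun hh => absurd hτ hh)]
      swap
      · simp [hσ.symm]
      refine Finset.sum_congr rfl fun a' _ => ?_
      rw [Finset.sum_comm]
      refine Finset.sum_congr rfl fun b' _ => ?_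
      rw [Finset.sum_eq_single τ (fun σ _ hσ => ?_) (fun hh => absurd hτ hh)]
      · simp
      · simp [hσ.symm]
    rw [e, Finset.mul_sum]
    refine Finset.sum_le_sum fun τ _ => ?_
    -- The bound on the cumulant factorises over the two pairs of components, so the sum is a
    -- perfect square.
    calc _ ≤ ∑ a, ∑ b, ∑ a', ∑ b', C * ((D a * D b * |c (τ, a) (τ, b)|) *
          (D a' * D b' * |c (τ, a') (τ, b')|)) := by
          refine Finset.sum_le_sum fun a _ => Finset.sum_le_sum fun b _ =>
            Finset.sum_le_sum fun a' _ => Finset.sum_le_sum fun b' _ => ?_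
          refine (le_abs_self _).trans ?_
          rw [abs_mul, abs_mul]
          refine (mul_le_mul_of_nonneg_left (hC a b a' b') (by positivity)).trans (le_of_eq ?_)
          ring
      _ = _ := by
          simp only [← Finset.mul_sum]
          rw [pow_two]
          simp only [← Finset.sum_mul]
  linarith

end IsDiagNoise

/-! ### Reduction to uncorrelated noise, and mean-square limits -/

theorem exists_orthogonal_diagonalization {m : ℕ} (S : Matrix (Fin m) (Fin m) ℝ)
    (hS : S.IsHermitian) :
    ∃ (U : Matrix (Fin m) (Fin m) ℝ) (D : Fin m → ℝ), U * U.transpose = 1 ∧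
      U.transpose * S * U = Matrix.diagonal D := by
  have h1 : (hS.eigenvectorUnitary : Matrix (Fin m) (Fin m) ℝ) *
      (hS.eigenvectorUnitary : Matrix (Fin m) (Fin m) ℝ).transpose = 1 := by
    have := Unitary.coe_mul_star_self hS.eigenvectorUnitary
    rwa [Unitary.coe_star, Matrix.star_eq_conjTranspose, Matrix.conjTranspose_eq_transpose_of_trivial]
      at this
  have h2 : (hS.eigenvectorUnitary : Matrix (Fin m) (Fin m) ℝ).transpose *
      (hS.eigenvectorUnitary : Matrix (Fin m) (Fin m) ℝ) = 1 := by
    have := Unitary.coe_star_mul_self hS.eigenvectorUnitary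
    rwa [Matrix.star_eq_conjTranspose, Matrix.conjTranspose_eq_transpose_of_trivial] at this
  refine ⟨hS.eigenvectorUnitary, hS.eigenvalues, h1, ?_⟩
  have h3 := hS.spectral_theorem
  rw [Unitary.conjStarAlgAut_apply, Matrix.star_eq_conjTranspose,
    Matrix.conjTranspose_eq_transpose_of_trivial] at h3
  have h4 : (RCLike.ofReal ∘ hS.eigenvalues : Fin m → ℝ) = hS.eigenvalues := by ext; simp
  rw [h4] at h3
  generalize (hS.eigenvectorUnitary : Matrix (Fin m) (Fin m) ℝ) = U at h2 h3
  calc _ = U.transpose * (U * Matrix.diagonal hS.eigenvalues * U.transpose) * U := by rw [← h3]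
    _ = (U.transpose * U) * Matrix.diagonal hS.eigenvalues * (U.transpose * U) := by
        simp only [Matrix.mul_assoc]
    _ = _ := by rw [h2]; simp

theorem sum_sq_mul_orthogonal {m : ℕ} (A U : Matrix (Fin m) (Fin m) ℝ)
    (hU : U * U.transpose = 1) :
    ∑ a, ∑ b, (A * U) a b ^ 2 = ∑ a, ∑ b, A a b ^ 2 := by
  have h : ∀ B : Matrix (Fin m) (Fin m) ℝ, ∑ a, ∑ b, B a b ^ 2 = (B * B.transpose).trace := by
    intro B
    simp [Matrix.trace, Matrix.mul_apply, pow_two]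
  rw [h, h, Matrix.transpose_mul, Matrix.mul_assoc, ← Matrix.mul_assoc U, hU, Matrix.one_mul]

section Linear

variable {Ω : Type*} [MeasurableSpace Ω] {P : Measure Ω} [IsProbabilityMeasure P] {m : ℕ}
  {X : ℤ → Ω → Fin m → ℝ}

/-- In a linear process the noise may be taken with uncorrelated components. -/
theorem IsLinearProcess.exists_isDiagNoise (hX : IsLinearProcess P X) :
    ∃ (μ : Fin m → ℝ) (Ψ : ℤ → Matrix (Fin m) (Fin m) ℝ) (ε : ℤ → Ω → Fin m → ℝ) (D : Fin m → ℝ),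
      (Summable fun l : ℤ => ∑ a, ∑ b, (Ψ l a b) ^ 2) ∧ IsDiagNoise P ε D ∧
      ∀ (t : ℤ) (a : Fin m),
        Tendsto (fun N : ℕ => eLpNorm (fun ω => X t ω a -
          (μ a + ∑ l ∈ Finset.Icc (-(N : ℤ)) N, (Matrix.mulVec (Ψ l) (ε (t - l) ω)) a)) 2 P)
          atTop (𝓝 0) := by
  obtain ⟨μ, Ψ, ε, hΨ, hind, hid, h4, hmean, hlim⟩ := hX
  let S : Matrix (Fin m) (Fin m) ℝ := Matrix.of fun a b => ∫ ω, ε 0 ω a * ε 0 ω b ∂P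
  have hS : S.IsHermitian := by
    ext a b
    simp [S, mul_comm]
  obtain ⟨U, D, hU, hD⟩ := exists_orthogonal_diagonalization S hS
  have hmeas : Measurable fun x : Fin m → ℝ => U.transpose.mulVec x := by
    refine measurable_pi_lambda _ fun a => ?_
    simp only [Matrix.mulVec, dotProduct]
    fun_prop
  -- Rotating the noise by `Uᵀ` and the coefficients by `U` leaves each product `Ψ l * ε` and each
  -- Frobenius norm unchanged, while the noise covariance becomes diagonal.
  refine ⟨μ, fun l => Ψ l * U, fun t ω => U.transpose.mulVec (ε t ω), D, ?_, ⟨?_, ?_, ?_, ?_, ?_⟩, ?_⟩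
  · simpa only [sum_sq_mul_orthogonal _ U hU] using hΨ
  · exact hind.comp (fun _ x => U.transpose.mulVec x) fun _ => hmeas
  · exact fun t => (hid t).comp hmeas
  · intro a
    simp only [Matrix.mulVec, dotProduct]
    exact memLp_finsetSum _ fun b _ => (h4 b).const_mul _
  · intro a
    simp only [Matrix.mulVec, dotProduct]
    rw [integral_finsetSum _ fun b _ => ((h4 b).integrable (by norm_num)).const_mul _]
    simp [integral_const_mul, hmean]
  · intro a b
    have e : ∀ ω, U.transpose.mulVec (ε 0 ω) a * U.transpose.mulVec (ε 0 ω) b =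
        ∑ c, ∑ d, U c a * U d b * (ε 0 ω c * ε 0 ω d) := by
      intro ω
      simp only [Matrix.mulVec, dotProduct, Matrix.transpose_apply, Finset.sum_mul_sum]
      refine Finset.sum_congr rfl fun c _ => Finset.sum_congr rfl fun d _ => ?_
      ring
    simp_rw [e]
    rw [integral_finsetSum _ fun c _ => integrable_finsetSum _ fun d _ =>
      (integrable_mul_of_memLp_four (h4 c) (h4 d)).const_mul _]
    have e2 : ∀ c, ∫ ω, ∑ d, U c a * U d b * (ε 0 ω c * ε 0 ω d) ∂P =
        ∑ d, U c a * U d b * S c d := by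
      intro c
      rw [integral_finsetSum _ fun d _ => (integrable_mul_of_memLp_four (h4 c) (h4 d)).const_mul _]
      simp [integral_const_mul, S]
    simp_rw [e2]
    have e3 := congrFun (congrFun hD a) b
    rw [Matrix.diagonal_apply] at e3
    rw [← e3, Matrix.mul_apply]
    simp only [Matrix.mul_apply, Matrix.transpose_apply, Finset.sum_mul]
    rw [Finset.sum_comm]
    refine Finset.sum_congr rfl fun c _ => Finset.sum_congr rfl fun d _ => ?_
    ring
  · intro t a
    have e : ∀ l ω, (Ψ l * U).mulVec (U.transpose.mulVec (ε (t - l) ω)) =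
        (Ψ l).mulVec (ε (t - l) ω) := by
      intro l ω
      rw [Matrix.mulVec_mulVec, Matrix.mul_assoc, hU, Matrix.mul_one]
    simp_rw [e]
    exact hlim t a

end Linear

section Limit

variable {Ω : Type*} [MeasurableSpace Ω] {P : Measure Ω}

/-- Write `fg - FG = f(g - G) + (f - F)g - (f - F)(g - G)` and apply Cauchy–Schwarz to each term.
Mean-square convergence of the factors thus suffices for `L¹` convergence of the products. -/
theorem tendsto_integral_abs_mul_sub {f g : Ω → ℝ} {F G : ℕ → Ω → ℝ} (hf : MemLp f 2 P)
    (hg : MemLp g 2 P) (hF : ∀ N, MemLp (F N) 2 P) (hG : ∀ N, MemLp (G N) 2 P)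
    (hFf : Tendsto (fun N => eLpNorm (fun ω => f ω - F N ω) 2 P) atTop (𝓝 0))
    (hGg : Tendsto (fun N => eLpNorm (fun ω => g ω - G N ω) 2 P) atTop (𝓝 0)) :
    Tendsto (fun N => ∫ ω, |f ω * g ω - F N ω * G N ω| ∂P) atTop (𝓝 0) := by
  have hmul : ∀ u v : Ω → ℝ, MemLp u 2 P → MemLp v 2 P →
      ∫ ω, |u ω * v ω| ∂P ≤ (eLpNorm u 2 P).toReal * (eLpNorm v 2 P).toReal := by
    intro u v hu hv
    have h1 : eLpNorm (u • v) 1 P ≤ eLpNorm u 2 P * eLpNorm v 2 P :=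
      eLpNorm_smul_le_mul_eLpNorm (p := 2) (q := 2) (r := 1) hv.1 hu.1
    have h2 : ∫ ω, |u ω * v ω| ∂P = (eLpNorm (u • v) 1 P).toReal := by
      rw [eLpNorm_one_eq_lintegral_enorm, ← integral_norm_eq_lintegral_enorm (hu.1.smul hv.1)]
      rfl
    rw [h2, ← ENNReal.toReal_mul]
    exact ENNReal.toReal_mono (ENNReal.mul_ne_top hu.2.ne hv.2.ne) h1
  have a0 := (ENNReal.tendsto_toReal ENNReal.zero_ne_top).comp hFf
  have b0 := (ENNReal.tendsto_toReal ENNReal.zero_ne_top).comp hGg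
  simp only [ENNReal.toReal_zero] at a0 b0
  have hlim := ((b0.const_mul (eLpNorm f 2 P).toReal).add
    (a0.mul_const (eLpNorm g 2 P).toReal)).add (a0.mul b0)
  simp only [mul_zero, zero_mul, add_zero] at hlim
  refine squeeze_zero (fun N => integral_nonneg fun ω => abs_nonneg _) (fun N => ?_) hlim
  have da : MemLp (fun ω => f ω - F N ω) 2 P := hf.sub (hF N)
  have db : MemLp (fun ω => g ω - G N ω) 2 P := hg.sub (hG N)
  have i1 : Integrable (fun ω => |f ω * (g ω - G N ω)|) P := (hf.integrable_mul db).abs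
  have i2 : Integrable (fun ω => |(f ω - F N ω) * g ω|) P := (da.integrable_mul hg).abs
  have i3 : Integrable (fun ω => |(f ω - F N ω) * (g ω - G N ω)|) P := (da.integrable_mul db).abs
  have i12 : Integrable (fun ω => |f ω * (g ω - G N ω)| + |(f ω - F N ω) * g ω|) P := i1.add i2
  calc ∫ ω, |f ω * g ω - F N ω * G N ω| ∂P
      ≤ ∫ ω, (|f ω * (g ω - G N ω)| + |(f ω - F N ω) * g ω| +
          |(f ω - F N ω) * (g ω - G N ω)|) ∂P := by
        refine integral_mono (((hf.integrable_mul hg).sub ((hF N).integrable_mul (hG N))).abs)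
          (i12.add i3) fun ω => ?_
        simp only
        have : f ω * g ω - F N ω * G N ω = f ω * (g ω - G N ω) + (f ω - F N ω) * g ω -
          (f ω - F N ω) * (g ω - G N ω) := by ring
        rw [this]
        exact (abs_sub _ _).trans (by gcongr; exact abs_add_le _ _)
    _ = _ := by rw [integral_add i12 i3, integral_add i1 i2]
    _ ≤ _ := add_le_add (add_le_add (hmul _ _ hf db) (hmul _ _ da hg)) (hmul _ _ da db)

theorem tendsto_integral_mul {f g : Ω → ℝ} {F G : ℕ → Ω → ℝ} (hf : MemLp f 2 P)
    (hg : MemLp g 2 P) (hF : ∀ N, MemLp (F N) 2 P) (hG : ∀ N, MemLp (G N) 2 P)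
    (hFf : Tendsto (fun N => eLpNorm (fun ω => f ω - F N ω) 2 P) atTop (𝓝 0))
    (hGg : Tendsto (fun N => eLpNorm (fun ω => g ω - G N ω) 2 P) atTop (𝓝 0)) :
    Tendsto (fun N => ∫ ω, F N ω * G N ω ∂P) atTop (𝓝 (∫ ω, f ω * g ω ∂P)) := by
  rw [tendsto_iff_dist_tendsto_zero]
  refine squeeze_zero (fun _ => dist_nonneg) (fun N => ?_)
    (tendsto_integral_abs_mul_sub hf hg hF hG hFf hGg)
  rw [dist_comm, Real.dist_eq]
  have i1 : Integrable (fun ω => f ω * g ω) P := hf.integrable_mul hg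
  have i2 : Integrable (fun ω => F N ω * G N ω) P := (hF N).integrable_mul (hG N)
  rw [← integral_sub i1 i2]
  exact abs_integral_le_integral_abs

end Limit

/-! ### Concentration for linear processes -/

theorem sum_comm_pairs {α β E : Type*} [AddCommMonoid E] (S S' : Finset α) (Z Z' : Finset β)
    (F : α → α → β → β → E) :
    ∑ p ∈ S, ∑ q ∈ S', ∑ z ∈ Z, ∑ z' ∈ Z', F p q z z' =
      ∑ z ∈ Z, ∑ z' ∈ Z', ∑ p ∈ S, ∑ q ∈ S', F p q z z' := by
  rw [Finset.sum_congr rfl fun p _ => Finset.sum_comm, Finset.sum_comm]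
  refine Finset.sum_congr rfl fun z _ => ?_
  rw [Finset.sum_congr rfl fun p _ => Finset.sum_comm, Finset.sum_comm]

/-- With `d` the noise variances and `x` the filter coefficients, the inner sum on the right is the
covariance of the moving average. Periodogram energies of the coefficients are thus converted into
covariances. -/
theorem sum_cosForm_weighted {κ : Type*} (n : ℕ) (w : ℝ) (S : Finset κ) (d : κ → ℝ)
    (x : ℤ → κ → ℝ) :
    ∑ p ∈ S, d p * cosForm n w (fun t => x t p) (fun t => x t p) =
      ∑ t ∈ Finset.Icc (1 : ℤ) n, ∑ u ∈ Finset.Icc (1 : ℤ) n,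
        Real.cos (w * (t - u)) * ∑ p ∈ S, d p * x t p * x u p := by
  simp only [cosForm, Finset.mul_sum]
  rw [Finset.sum_comm]
  refine Finset.sum_congr rfl fun t _ => ?_
  rw [Finset.sum_comm]
  refine Finset.sum_congr rfl fun u _ => Finset.sum_congr rfl fun p _ => ?_
  ring

namespace IsDiagNoise

variable {Ω : Type*} [MeasurableSpace Ω] {m : ℕ} {P : Measure Ω} [IsProbabilityMeasure P]
  {ε : ℤ → Ω → Fin m → ℝ} {D : Fin m → ℝ}

/-- Variance of a weighted periodogram average of two finite moving averages. -/
theorem exists_variance_periodogram_le (h : IsDiagNoise P ε D) :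
    ∃ C : ℝ, 0 ≤ C ∧ ∀ (R : Finset ℤ) (N n : ℕ) (s : Fin N → ℤ) (w : Fin N → ℝ) (b B : ℝ)
      (x y : ℤ → ℤ × Fin m → ℝ),
      (∀ i, s i ∈ Set.Ioo (0 : ℤ) n) → Function.Injective s → 0 ≤ b → (∀ i, |w i| ≤ b) → 0 ≤ B →
      (∀ τ, ∑ a, ∑ t ∈ Finset.Icc (1 : ℤ) n, x t (τ, a) ^ 2 ≤ B) →
      (∀ τ, ∑ a, ∑ t ∈ Finset.Icc (1 : ℤ) n, y t (τ, a) ^ 2 ≤ B) →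
      variance (fun ω => ∑ z ∈ Finset.Icc (1 : ℤ) n ×ˢ Finset.Icc (1 : ℤ) n,
        cosWeight n s w z.1 z.2 * ((∑ p ∈ R ×ˢ Finset.univ, x z.1 p * ε p.1 ω p.2) *
          (∑ p ∈ R ×ˢ Finset.univ, y z.2 p * ε p.1 ω p.2))) P ≤
      2 * (∑ z ∈ Finset.Icc (1 : ℤ) n ×ˢ Finset.Icc (1 : ℤ) n,
        ∑ z' ∈ Finset.Icc (1 : ℤ) n ×ˢ Finset.Icc (1 : ℤ) n,
          cosWeight n s w z.1 z.2 * cosWeight n s w z'.1 z'.2 *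
          ((∑ p ∈ R ×ˢ Finset.univ, D p.2 * x z.1 p * x z'.1 p) *
          (∑ p ∈ R ×ˢ Finset.univ, D p.2 * y z.2 p * y z'.2 p))) +
      C * (B * b ^ 2 / n) * ∑ i, ∑ t ∈ Finset.Icc (1 : ℤ) n, ∑ u ∈ Finset.Icc (1 : ℤ) n,
        Real.cos (fourierFreq n (s i) * (t - u)) *
          ((∑ p ∈ R ×ˢ Finset.univ, D p.2 * x t p * x u p) +
            ∑ p ∈ R ×ˢ Finset.univ, D p.2 * y t p * y u p) := by
  obtain ⟨C, hC0, hC⟩ := h.exists_variance_quadraticForm_le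
  set d : ℝ := ∑ a, D a with hd
  have hd0 : 0 ≤ d := Finset.sum_nonneg fun a _ => h.nonneg a
  have hDd : ∀ a, D a ≤ d := fun a =>
    Finset.single_le_sum (f := D) (fun a _ => h.nonneg a) (Finset.mem_univ a)
  -- The product of the bound `d ^ 2 * B * b` for `H τ` and the prefactor `b / n * (d / 2)` of `∑ H
  -- τ` is `d ^ 3 / 2 * (B * b ^ 2 / n)`.
  refine ⟨C * d ^ 3 / 2, by positivity, ?_⟩
  intro R N n s w b B x y hs hinj hb hw hB hx hy
  set T := Finset.Icc (1 : ℤ) n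
  set S : Finset (ℤ × Fin m) := R ×ˢ Finset.univ with hS
  let A : ℤ × ℤ → ℝ := fun z => cosWeight n s w z.1 z.2
  let c : ℤ × Fin m → ℤ × Fin m → ℝ := fun p q => ∑ z ∈ T ×ˢ T, A z * (x z.1 p * y z.2 q)
  have hQ : (fun ω => ∑ z ∈ T ×ˢ T, cosWeight n s w z.1 z.2 *
      ((∑ p ∈ S, x z.1 p * ε p.1 ω p.2) * (∑ p ∈ S, y z.2 p * ε p.1 ω p.2))) =
      fun ω => ∑ z ∈ S ×ˢ S, c z.1 z.2 * (ε z.1.1 ω z.1.2 * ε z.2.1 ω z.2.2) := by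
    funext ω
    calc _ = ∑ z ∈ T ×ˢ T, ∑ p ∈ S ×ˢ S, A z * (x z.1 p.1 * y z.2 p.2) *
          (ε p.1.1 ω p.1.2 * ε p.2.1 ω p.2.2) := by
          refine Finset.sum_congr rfl fun z _ => ?_
          rw [Finset.sum_mul_sum, ← Finset.sum_product', Finset.mul_sum]
          refine Finset.sum_congr rfl fun p _ => ?_
          simp only [A]; ring
      _ = _ := by
          rw [Finset.sum_comm]
          refine Finset.sum_congr rfl fun p _ => ?_
          rw [Finset.sum_mul]
  rw [hQ]
  refine (hC R c).trans (add_le_add (le_of_eq ?_) ?_)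
  · congr 1
    have e1 : ∀ p q, D p.2 * D q.2 * c p q ^ 2 = ∑ z ∈ T ×ˢ T, ∑ z' ∈ T ×ˢ T, D p.2 * D q.2 *
        (A z * (x z.1 p * y z.2 q) * (A z' * (x z'.1 p * y z'.2 q))) := by
      intro p q
      rw [pow_two, Finset.sum_mul_sum, Finset.mul_sum]
      simp only [Finset.mul_sum]
    have e2 : ∀ z z' : ℤ × ℤ, A z * A z' * ((∑ p ∈ S, D p.2 * x z.1 p * x z'.1 p) *
        (∑ p ∈ S, D p.2 * y z.2 p * y z'.2 p)) = ∑ p ∈ S, ∑ q ∈ S, A z * A z' *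
        ((D p.2 * x z.1 p * x z'.1 p) * (D q.2 * y z.2 q * y z'.2 q)) := by
      intro z z'
      rw [Finset.sum_mul_sum, Finset.mul_sum]
      simp only [Finset.mul_sum]
    refine (Finset.sum_congr rfl fun p _ => Finset.sum_congr rfl fun q _ => e1 p q).trans ?_
    refine Eq.trans ?_ (Finset.sum_congr rfl fun z _ => Finset.sum_congr rfl fun z' _ =>
      (e2 z z').symm)
    rw [sum_comm_pairs]
    refine Finset.sum_congr rfl fun z _ => Finset.sum_congr rfl fun z' _ =>
      Finset.sum_congr rfl fun p _ => Finset.sum_congr rfl fun q _ => ?_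
    ring
  · let α : Fin N → ℤ × Fin m → ℝ := fun i p =>
      cosForm n (fourierFreq n (s i)) (fun t => x t p) (fun t => x t p)
    let β : Fin N → ℤ × Fin m → ℝ := fun i p =>
      cosForm n (fourierFreq n (s i)) (fun t => y t p) (fun t => y t p)
    have hα : ∀ i p, 0 ≤ α i p := fun i p => cosForm_self_nonneg _ _ _
    have hβ : ∀ i p, 0 ≤ β i p := fun i p => cosForm_self_nonneg _ _ _
    -- The mixed form of `x` and `y` is split into a part depending on `p` and a part depending on
    -- `q`, so that each can be summed separately.
    have hc : ∀ p q, |c p q| ≤ b / n * ∑ i, (α i p + β i q) / 2 := by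
      intro p q
      have e : c p q = (2 * Real.pi * n)⁻¹ * ∑ i, w i *
          cosForm n (fourierFreq n (s i)) (fun t => x t p) (fun t => y t q) := by
        rw [← sum_cosWeight_mul]
        exact Finset.sum_product _ _ _
      rw [e, abs_mul, mul_inv, abs_mul, abs_of_nonneg (by positivity : (0 : ℝ) ≤ (2 * Real.pi)⁻¹),
        abs_of_nonneg (by positivity : (0 : ℝ) ≤ (n : ℝ)⁻¹), mul_assoc, div_eq_inv_mul, mul_assoc]
      refine (mul_le_of_le_one_left (by positivity) two_pi_inv_le_one).trans ?_
      refine mul_le_mul_of_nonneg_left ?_ (by positivity)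
      refine (Finset.abs_sum_le_sum_abs _ _).trans ?_
      rw [Finset.mul_sum]
      refine Finset.sum_le_sum fun i _ => ?_
      rw [abs_mul]
      exact mul_le_mul (hw i) (abs_cosForm_le _ _ _ _) (abs_nonneg _) hb
    let H : ℤ → ℝ := fun τ => b / n * (d / 2) * ∑ i, ((∑ a, D a * α i (τ, a)) +
      ∑ a, D a * β i (τ, a))
    have hH0 : ∀ τ, 0 ≤ H τ := fun τ => mul_nonneg (by positivity)
      (Finset.sum_nonneg fun i _ => add_nonneg
        (Finset.sum_nonneg fun a _ => mul_nonneg (h.nonneg a) (hα _ _))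
        (Finset.sum_nonneg fun a _ => mul_nonneg (h.nonneg a) (hβ _ _)))
    have hcH : ∀ τ, ∑ a, ∑ a', D a * D a' * |c (τ, a) (τ, a')| ≤ H τ := by
      intro τ
      calc _ ≤ ∑ a, ∑ a', D a * D a' * (b / n * ∑ i, (α i (τ, a) + β i (τ, a')) / 2) :=
            Finset.sum_le_sum fun a _ => Finset.sum_le_sum fun a' _ =>
              mul_le_mul_of_nonneg_left (hc _ _) (mul_nonneg (h.nonneg _) (h.nonneg _))
        _ = b / n * ∑ i, ∑ a, ∑ a', (D a * α i (τ, a) * D a' + D a * (D a' * β i (τ, a'))) / 2 := by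
            simp only [Finset.mul_sum]
            rw [Finset.sum_congr rfl fun a _ => Finset.sum_comm, Finset.sum_comm]
            refine Finset.sum_congr rfl fun i _ => Finset.sum_congr rfl fun a _ =>
              Finset.sum_congr rfl fun a' _ => ?_
            ring
        _ = H τ := by
            simp only [H]
            rw [mul_assoc]
            congr 1
            rw [Finset.mul_sum]
            refine Finset.sum_congr rfl fun i _ => ?_
            simp only [← Finset.sum_div, Finset.sum_add_distrib, ← Finset.mul_sum,
              ← Finset.sum_mul]
            rw [← hd]; ring
    -- Bessel's inequality, summed over the distinct frequencies, bounds the energies by `n` times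
    -- the squared norm of the coefficients of the noise at time `τ`; the `n` cancels. The bound is
    -- uniform in `τ`.
    have hHB : ∀ τ, H τ ≤ d ^ 2 * B * b := by
      intro τ
      have e : ∀ (v : ℤ → ℤ × Fin m → ℝ),
          (∀ τ, ∑ a, ∑ t ∈ T, v t (τ, a) ^ 2 ≤ B) →
          ∑ i, ∑ a, D a * cosForm n (fourierFreq n (s i)) (fun t => v t (τ, a))
            (fun t => v t (τ, a)) ≤ d * (n * B) := by
        intro v hv
        rw [Finset.sum_comm]
        calc _ ≤ ∑ a, d * (n * ∑ t ∈ T, v t (τ, a) ^ 2) := by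
              refine Finset.sum_le_sum fun a _ => ?_
              rw [← Finset.mul_sum]
              exact mul_le_mul (hDd a) (sum_cosForm_self_le hs hinj _)
                (Finset.sum_nonneg fun i _ => cosForm_self_nonneg _ _ _) hd0
          _ ≤ _ := by
              rw [← Finset.mul_sum, ← Finset.mul_sum]
              exact mul_le_mul_of_nonneg_left (mul_le_mul_of_nonneg_left (hv τ) (by positivity)) hd0
      have e1 := e x hx
      have e2 := e y hy
      calc H τ ≤ b / n * (d / 2) * (d * (n * B) + d * (n * B)) := by
            refine mul_le_mul_of_nonneg_left ?_ (by positivity)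
            rw [Finset.sum_add_distrib]
            exact add_le_add e1 e2
        _ = (d ^ 2 * B * b) * (n / n) := by ring
        _ ≤ _ := mul_le_of_le_one_right (by positivity) (div_self_le_one _)
    have hsum : ∑ τ ∈ R, H τ = b / n * (d / 2) * ∑ i, ∑ t ∈ T, ∑ u ∈ T,
        Real.cos (fourierFreq n (s i) * (t - u)) *
          ((∑ p ∈ S, D p.2 * x t p * x u p) + ∑ p ∈ S, D p.2 * y t p * y u p) := by
      simp only [H]
      rw [← Finset.mul_sum, Finset.sum_comm]
      congr 1
      refine Finset.sum_congr rfl fun i _ => ?_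
      simp only [mul_add, Finset.sum_add_distrib]
      rw [← sum_cosForm_weighted n _ S (fun p => D p.2) x,
        ← sum_cosForm_weighted n _ S (fun p => D p.2) y, hS, Finset.sum_product,
        Finset.sum_product]
    -- A sum of squares is at most the supremum times the sum; the supremum is controlled by the
    -- coefficients and the sum by covariances.
    calc _ ≤ C * ∑ τ ∈ R, (d ^ 2 * B * b) * H τ := by
          refine mul_le_mul_of_nonneg_left (Finset.sum_le_sum fun τ _ => ?_) hC0
          calc _ ≤ H τ ^ 2 := pow_le_pow_left₀ (Finset.sum_nonneg fun a _ =>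
                Finset.sum_nonneg fun a' _ => mul_nonneg (mul_nonneg (h.nonneg _) (h.nonneg _))
                  (abs_nonneg _)) (hcH τ) 2
            _ ≤ _ := by rw [pow_two]; exact mul_le_mul_of_nonneg_right (hHB τ) (hH0 τ)
      _ = _ := by
          rw [← Finset.mul_sum, hsum]
          ring

end IsDiagNoise

section Linear

variable {Ω : Type*} [MeasurableSpace Ω] {P : Measure Ω} [IsProbabilityMeasure P] {m : ℕ}
  {X : ℤ → Ω → Fin m → ℝ}

/-- Concentration of weighted periodogram averages of linear processes. -/
theorem IsLinearProcess.exists_integral_abs_le (hX : StrictlyStationary P X)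
    (hL2 : ∀ (t : ℤ) (a : Fin m), MemLp (fun ω => X t ω a) 2 P)
    (hL : IsLinearProcess P X) (hγ : ∀ j k, Summable (autocov P X j k)) (j k : Fin m) :
    ∃ C : ℝ, 0 ≤ C ∧ ∀ (N : ℕ) (n : ℕ) (s : Fin N → ℤ) (w : Fin N → ℝ) (b : ℝ),
      (∀ i, s i ∈ Set.Ioo (0 : ℤ) n) → Function.Injective s → (∀ i, |w i| ≤ b) →
      ∫ ω, |(∑ p ∈ Finset.Icc (1 : ℤ) n ×ˢ Finset.Icc (1 : ℤ) n, cosWeight n s w p.1 p.2 *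
          ((X p.1 ω j - ∫ ω', X 0 ω' j ∂P) * (X p.2 ω k - ∫ ω', X 0 ω' k ∂P))) -
        ∑ p ∈ Finset.Icc (1 : ℤ) n ×ˢ Finset.Icc (1 : ℤ) n, cosWeight n s w p.1 p.2 *
          autocov P X j k (p.1 - p.2)| ∂P ≤ Real.sqrt (C * (N * b ^ 2)) := by
  obtain ⟨μ, Ψ, ε, D, hΨ, hε, hlim⟩ := hL.exists_isDiagNoise
  obtain ⟨C, hC0, hC⟩ := hε.exists_variance_periodogram_le
  set B : ℝ := ∑' l, ∑ a, ∑ b, (Ψ l a b) ^ 2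
  have hB0 : 0 ≤ B := tsum_nonneg fun l => by positivity
  let V : ℕ → ℤ → Fin m → Ω → ℝ := fun L t a ω =>
    ∑ l ∈ Finset.Icc (-(L : ℤ)) L, (Matrix.mulVec (Ψ l) (ε (t - l) ω)) a
  have hV2 : ∀ L t a, MemLp (V L t a) 2 P := fun L t a => by
    refine memLp_finsetSum _ fun l _ => ?_
    simp only [Matrix.mulVec, dotProduct]
    exact memLp_finsetSum _ fun b _ =>
      ((hε.memLp_apply _ _).mono_exponent (p := 2) (by norm_num)).const_mul _
  have hV0 : ∀ L t a, ∫ ω, V L t a ω ∂P = 0 := fun L t a => by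
    have hi : ∀ l b, Integrable (fun ω => Ψ l a b * ε (t - l) ω b) P := fun l b =>
      ((hε.memLp_apply _ _).integrable (by norm_num)).const_mul _
    simp only [V, Matrix.mulVec, dotProduct]
    rw [integral_finsetSum _ fun l _ => integrable_finsetSum _ fun b _ => hi l b]
    refine Finset.sum_eq_zero fun l _ => ?_
    rw [integral_finsetSum _ fun b _ => hi l b]
    simp [integral_const_mul, hε.integral_apply]
  have hU2 : ∀ t a, MemLp (fun ω => X t ω a - μ a) 2 P := fun t a => (hL2 t a).sub (memLp_const _)
  have hVlim : ∀ t a, Tendsto (fun L => eLpNorm (fun ω => (X t ω a - μ a) - V L t a ω) 2 P) atTop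
      (𝓝 0) := fun t a => by simpa only [sub_sub] using hlim t a
  have hμ : ∀ a, ∫ ω, X 0 ω a ∂P = μ a := by
    intro a
    have h1 := tendsto_integral_mul (hU2 0 a) (memLp_const (1 : ℝ)) (hV2 · 0 a)
      (fun _ => memLp_const (1 : ℝ)) (hVlim 0 a) (by simp)
    simp only [mul_one, hV0] at h1
    have h2 := tendsto_nhds_unique h1 tendsto_const_nhds
    rw [integral_sub ((hL2 0 a).integrable (by norm_num)) (integrable_const _)] at h2
    simp only [integral_const, probReal_univ, one_smul] at h2
    linarith
  have hγlim : ∀ t u a a', Tendsto (fun L => ∫ ω, V L t a ω * V L u a' ω ∂P) atTop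
      (𝓝 (autocov P X a a' (t - u))) := by
    intro t u a a'
    rw [← hX.integral_centered_mul, hμ, hμ]
    exact tendsto_integral_mul (hU2 t a) (hU2 u a') (hV2 · t a) (hV2 · u a') (hVlim t a) (hVlim u a')
  let G : Fin m → Fin m → ℝ := fun a b => ∑' h, |autocov P X a b h|
  have hG : ∀ a b, 0 ≤ G a b := fun a b => tsum_nonneg fun _ => abs_nonneg _
  -- The first part comes from the two noise pairings, both reduced to the direct one; the second
  -- comes from the fourth cumulants of the noise.
  refine ⟨2 * (G j j * G k k) + C * B * (G j j + G k k), add_nonneg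
    (mul_nonneg zero_le_two (mul_nonneg (hG _ _) (hG _ _)))
    (mul_nonneg (mul_nonneg hC0 hB0) (add_nonneg (hG _ _) (hG _ _))), ?_⟩
  intro N n s w b hs hinj hw
  set T := Finset.Icc (1 : ℤ) n with hT
  let A : ℤ × ℤ → ℝ := fun p => cosWeight n s w p.1 p.2
  -- The bound is left in terms of the covariances of the truncation, since their absolute sums are
  -- not controlled uniformly in `L`. For fixed `n` only finitely many occur, and each converges to
  -- `γ`. The absolute value of `b` appears because `b` may be negative when `N = 0`.
  let bound : ℕ → ℝ := fun L =>
    2 * (∑ z ∈ T ×ˢ T, ∑ z' ∈ T ×ˢ T, A z * A z' *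
      ((∫ ω, V L z.1 j ω * V L z'.1 j ω ∂P) * ∫ ω, V L z.2 k ω * V L z'.2 k ω ∂P)) +
    C * (B * |b| ^ 2 / n) * ∑ i, ∑ t ∈ T, ∑ u ∈ T, Real.cos (fourierFreq n (s i) * (t - u)) *
      ((∫ ω, V L t j ω * V L u j ω ∂P) + ∫ ω, V L t k ω * V L u k ω ∂P)
  have hvar : ∀ L, MemLp (fun ω => ∑ z ∈ T ×ˢ T, A z * (V L z.1 j ω * V L z.2 k ω)) 2 P ∧
      variance (fun ω => ∑ z ∈ T ×ˢ T, A z * (V L z.1 j ω * V L z.2 k ω)) P ≤ bound L := by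
    intro L
    let x : Fin m → ℤ → ℤ × Fin m → ℝ := fun a t p =>
      if t - p.1 ∈ Finset.Icc (-(L : ℤ)) L then Ψ (t - p.1) a p.2 else 0
    -- These are the noise times within `L` of some observation time in `[1, n]`.
    let R : Finset ℤ := Finset.Icc (1 - (L : ℤ)) (n + L)
    have hVx : ∀ t ∈ T, ∀ a ω, V L t a ω = ∑ p ∈ R ×ˢ Finset.univ, x a t p * ε p.1 ω p.2 := by
      intro t ht a ω
      rw [Finset.mem_Icc] at ht
      rw [Finset.sum_product]
      have e : ∀ τ, ∑ c, x a t (τ, c) * ε τ ω c =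
          if t - τ ∈ Finset.Icc (-(L : ℤ)) L then (Matrix.mulVec (Ψ (t - τ)) (ε τ ω)) a else 0 := by
        intro τ
        simp only [x, Matrix.mulVec, dotProduct]
        split_ifs <;> simp
      simp only [e]
      rw [← Finset.sum_filter]
      refine Finset.sum_nbij' (fun l => t - l) (fun τ => t - τ) ?_ ?_ ?_ ?_ ?_
      · intro l hl
        simp only [R, Finset.mem_filter, Finset.mem_Icc] at hl ⊢
        omega
      · intro τ hτ
        exact (Finset.mem_filter.1 hτ).2
      · intro l _; simp
      · intro τ _; simp
      · intro l _; simp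
    have hg : ∀ t ∈ T, ∀ u ∈ T, ∀ a, ∫ ω, V L t a ω * V L u a ω ∂P =
        ∑ p ∈ R ×ˢ Finset.univ, D p.2 * x a t p * x a u p := by
      intro t ht u hu a
      have e : ∀ ω, V L t a ω * V L u a ω = ∑ p ∈ R ×ˢ Finset.univ, ∑ q ∈ R ×ˢ Finset.univ,
          x a t p * x a u q * (ε p.1 ω p.2 * ε q.1 ω q.2) := by
        intro ω
        rw [hVx t ht, hVx u hu, Finset.sum_mul_sum]
        refine Finset.sum_congr rfl fun p _ => Finset.sum_congr rfl fun q _ => ?_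
        ring
      have hi : ∀ p q : ℤ × Fin m, Integrable (fun ω => x a t p * x a u q *
          (ε p.1 ω p.2 * ε q.1 ω q.2)) P := fun p q =>
        (integrable_mul_of_memLp_four (hε.memLp_apply _ _) (hε.memLp_apply _ _)).const_mul _
      simp_rw [e]
      rw [integral_finsetSum _ fun p _ => integrable_finsetSum _ fun q _ => hi p q]
      refine Finset.sum_congr rfl fun p hp => ?_
      rw [integral_finsetSum _ fun q _ => hi p q]
      simp only [integral_const_mul, hε.integral_mul, mul_ite, mul_zero]
      rw [Finset.sum_ite_eq, if_pos hp]
      ring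
    have hxB : ∀ a τ, ∑ c, ∑ t ∈ T, x a t (τ, c) ^ 2 ≤ B := by
      intro a τ
      rw [Finset.sum_comm]
      calc _ ≤ ∑ t ∈ T, ∑ a, ∑ c, Ψ (t - τ) a c ^ 2 := by
            refine Finset.sum_le_sum fun t _ => ?_
            refine le_trans (Finset.sum_le_sum fun c _ => ?_) (Finset.single_le_sum
              (f := fun a => ∑ c, Ψ (t - τ) a c ^ 2) (fun a _ => by positivity) (Finset.mem_univ a))
            simp only [x]
            split_ifs
            · exact le_rfl
            · simpa using sq_nonneg _
        _ = ∑ l ∈ T.map ⟨fun t => t - τ, sub_left_injective⟩, ∑ a, ∑ c, Ψ l a c ^ 2 :=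
            (Finset.sum_map T ⟨fun t => t - τ, sub_left_injective⟩ fun l =>
              ∑ a, ∑ c, Ψ l a c ^ 2).symm
        _ ≤ B := hΨ.sum_le_tsum _ fun l _ => by positivity
    have hQ : (fun ω => ∑ z ∈ T ×ˢ T, A z * (V L z.1 j ω * V L z.2 k ω)) = fun ω =>
        ∑ z ∈ T ×ˢ T, cosWeight n s w z.1 z.2 * ((∑ p ∈ R ×ˢ Finset.univ, x j z.1 p * ε p.1 ω p.2) *
          (∑ p ∈ R ×ˢ Finset.univ, x k z.2 p * ε p.1 ω p.2)) := by
      funext ω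
      refine Finset.sum_congr rfl fun z hz => ?_
      rw [Finset.mem_product] at hz
      rw [hVx _ hz.1, hVx _ hz.2]
    rw [hQ]
    constructor
    · have h4 : ∀ a t, MemLp (fun ω => ∑ p ∈ R ×ˢ Finset.univ, x a t p * ε p.1 ω p.2) 4 P :=
        fun a t => memLp_finsetSum _ fun p _ => (hε.memLp_apply _ _).const_mul _
      exact memLp_finsetSum _ fun z _ => (memLp_two_mul_of_memLp_four (h4 _ _) (h4 _ _)).const_mul _
    · refine (hC R N n s w |b| B (x j) (x k) hs hinj (abs_nonneg _)
        (fun i => (hw i).trans (le_abs_self _)) hB0 (hxB j) (hxB k)).trans (le_of_eq ?_)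
      simp only [bound]
      congr 2
      · refine Finset.sum_congr rfl fun z hz => Finset.sum_congr rfl fun z' hz' => ?_
        rw [Finset.mem_product] at hz hz'
        rw [hg _ hz.1 _ hz'.1, hg _ hz.2 _ hz'.2]
      · refine Finset.sum_congr rfl fun i _ => Finset.sum_congr rfl fun t ht =>
          Finset.sum_congr rfl fun u hu => ?_
        rw [hg t ht u hu, hg t ht u hu]
  have hbound : Tendsto bound atTop (𝓝 (2 * (∑ z ∈ T ×ˢ T, ∑ z' ∈ T ×ˢ T, A z * A z' *
      (autocov P X j j (z.1 - z'.1) * autocov P X k k (z.2 - z'.2))) +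
      C * (B * |b| ^ 2 / n) * ∑ i, ∑ t ∈ T, ∑ u ∈ T, Real.cos (fourierFreq n (s i) * (t - u)) *
      (autocov P X j j (t - u) + autocov P X k k (t - u)))) :=
    ((tendsto_finsetSum _ fun z _ => tendsto_finsetSum _ fun z' _ =>
      ((hγlim _ _ _ _).mul (hγlim _ _ _ _)).const_mul _).const_mul _).add
      ((tendsto_finsetSum _ fun i _ => tendsto_finsetSum _ fun t _ => tendsto_finsetSum _ fun u _ =>
        ((hγlim _ _ _ _).add (hγlim _ _ _ _)).const_mul _).const_mul _)
  have hF : ∑ p ∈ T ×ˢ T, A p ^ 2 ≤ N * b ^ 2 := by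
    rw [Finset.sum_product]
    simpa using sum_sq_cosWeight_le hs hinj hw
  have hb1 : 2 * (∑ z ∈ T ×ˢ T, ∑ z' ∈ T ×ˢ T, A z * A z' *
      (autocov P X j j (z.1 - z'.1) * autocov P X k k (z.2 - z'.2))) ≤
      2 * (G j j * G k k) * (N * b ^ 2) := by
    rw [mul_assoc]
    refine mul_le_mul_of_nonneg_left ?_ zero_le_two
    refine le_trans ?_ ((sum_toeplitz_le (hγ j j) (hγ k k) T A).trans
      (mul_le_mul_of_nonneg_left hF (mul_nonneg (hG j j) (hG k k))))
    refine Finset.sum_le_sum fun z _ => Finset.sum_le_sum fun z' _ => ?_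
    rw [← abs_mul, ← abs_mul, ← abs_mul]
    exact le_abs_self _
  have hb2 : C * (B * |b| ^ 2 / n) * (∑ i, ∑ t ∈ T, ∑ u ∈ T,
      Real.cos (fourierFreq n (s i) * (t - u)) *
      (autocov P X j j (t - u) + autocov P X k k (t - u))) ≤
      C * B * (G j j + G k k) * (N * b ^ 2) := by
    have h1 : (∑ i, ∑ t ∈ T, ∑ u ∈ T, Real.cos (fourierFreq n (s i) * (t - u)) *
      (autocov P X j j (t - u) + autocov P X k k (t - u))) ≤ N * (n * (G j j + G k k)) := by
      calc _ ≤ ∑ _i : Fin N, ∑ _t ∈ T, (G j j + G k k) := by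
            refine Finset.sum_le_sum fun i _ => Finset.sum_le_sum fun t _ => ?_
            calc _ ≤ ∑ u ∈ T, (|autocov P X j j (t - u)| + |autocov P X k k (t - u)|) := by
                  refine Finset.sum_le_sum fun u _ => ?_
                  refine (le_abs_self _).trans ?_
                  rw [abs_mul]
                  exact (mul_le_of_le_one_left (abs_nonneg _) (Real.abs_cos_le_one _)).trans
                    (abs_add_le _ _)
              _ ≤ _ := by
                  rw [Finset.sum_add_distrib]
                  exact add_le_add (sum_abs_shift_le (hγ j j) T (fun u => t - u)
                    sub_right_injective) (sum_abs_shift_le (hγ k k) T (fun u => t - u)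
                    sub_right_injective)
        _ = _ := by
            simp only [hT, Finset.sum_const, Int.card_Icc, Finset.card_univ, Fintype.card_fin, nsmul_eq_mul]
            simp
    refine (mul_le_mul_of_nonneg_left h1 (by positivity)).trans ?_
    have h2 : 0 ≤ C * B * (G j j + G k k) * (N * b ^ 2) := mul_nonneg
      (mul_nonneg (mul_nonneg hC0 hB0) (add_nonneg (hG _ _) (hG _ _))) (by positivity)
    calc _ = C * B * (G j j + G k k) * (N * b ^ 2) * (n / n) := by rw [sq_abs]; ring
      _ ≤ _ := mul_le_of_le_one_right h2 (div_self_le_one _)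
  let U : ℤ → Fin m → Ω → ℝ := fun t a ω => X t ω a - μ a
  simp only [hμ]
  set q : ℝ := ∑ p ∈ T ×ˢ T, A p * autocov P X j k (p.1 - p.2) with hq
  let qL : ℕ → ℝ := fun L => ∑ p ∈ T ×ˢ T, A p * ∫ ω, V L p.1 j ω * V L p.2 k ω ∂P
  have hqL : Tendsto (fun L => |qL L - q|) atTop (𝓝 0) := by
    have : Tendsto qL atTop (𝓝 q) := tendsto_finsetSum _ fun z _ => (hγlim _ _ _ _).const_mul _
    simpa using (this.sub_const q).abs
  have hiU : ∀ z : ℤ × ℤ, Integrable (fun ω => U z.1 j ω * U z.2 k ω) P := fun z =>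
    (hU2 z.1 j).integrable_mul (hU2 z.2 k)
  have hiV : ∀ L (z : ℤ × ℤ), Integrable (fun ω => V L z.1 j ω * V L z.2 k ω) P := fun L z =>
    (hV2 L z.1 j).integrable_mul (hV2 L z.2 k)
  have hdiff : ∀ L, ∫ ω, |(∑ z ∈ T ×ˢ T, A z * (U z.1 j ω * U z.2 k ω)) -
      ∑ z ∈ T ×ˢ T, A z * (V L z.1 j ω * V L z.2 k ω)| ∂P ≤
      ∑ z ∈ T ×ˢ T, |A z| * ∫ ω, |U z.1 j ω * U z.2 k ω - V L z.1 j ω * V L z.2 k ω| ∂P := by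
    intro L
    have hi : ∀ z : ℤ × ℤ, Integrable (fun ω =>
        |A z| * |U z.1 j ω * U z.2 k ω - V L z.1 j ω * V L z.2 k ω|) P := fun z =>
      (((hiU z).sub (hiV L z)).abs).const_mul _
    simp_rw [← integral_const_mul]
    rw [← integral_finsetSum _ fun z _ => hi z]
    refine integral_mono_of_nonneg (.of_forall fun ω => abs_nonneg _)
      (integrable_finsetSum _ fun z _ => hi z) (.of_forall fun ω => ?_)
    simp only
    rw [← Finset.sum_sub_distrib]
    refine (Finset.abs_sum_le_sum_abs _ _).trans (Finset.sum_le_sum fun z _ => ?_)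
    rw [← mul_sub, abs_mul]
  have hdlim : Tendsto (fun L => ∑ z ∈ T ×ˢ T, |A z| *
      ∫ ω, |U z.1 j ω * U z.2 k ω - V L z.1 j ω * V L z.2 k ω| ∂P) atTop (𝓝 0) := by
    have := tendsto_finsetSum (T ×ˢ T) fun z _ => (tendsto_integral_abs_mul_sub (hU2 z.1 j)
      (hU2 z.2 k) (hV2 · z.1 j) (hV2 · z.2 k) (hVlim z.1 j) (hVlim z.2 k)).const_mul |A z|
    simpa using this
  -- Three errors are added: replacing the process by its truncation, the deviation of the truncated
  -- form from its mean, and the difference of the two means. As `L → ∞` the first and last vanish.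
  have hstep : ∀ L, ∫ ω, |(∑ z ∈ T ×ˢ T, A z * (U z.1 j ω * U z.2 k ω)) - q| ∂P ≤
      (∑ z ∈ T ×ˢ T, |A z| * ∫ ω, |U z.1 j ω * U z.2 k ω - V L z.1 j ω * V L z.2 k ω| ∂P) +
      Real.sqrt (bound L) + |qL L - q| := by
    intro L
    have iQ : Integrable (fun ω => ∑ z ∈ T ×ˢ T, A z * (U z.1 j ω * U z.2 k ω)) P :=
      integrable_finsetSum _ fun z _ => (hiU z).const_mul _
    have iQL : Integrable (fun ω => ∑ z ∈ T ×ˢ T, A z * (V L z.1 j ω * V L z.2 k ω)) P :=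
      integrable_finsetSum _ fun z _ => (hiV L z).const_mul _
    have i1 : Integrable (fun ω => |(∑ z ∈ T ×ˢ T, A z * (U z.1 j ω * U z.2 k ω)) -
      ∑ z ∈ T ×ˢ T, A z * (V L z.1 j ω * V L z.2 k ω)|) P := (iQ.sub iQL).abs
    have i2 : Integrable (fun ω => |(∑ z ∈ T ×ˢ T, A z * (V L z.1 j ω * V L z.2 k ω)) - qL L|) P :=
      (iQL.sub (integrable_const _)).abs
    have i12 : Integrable (fun ω => |(∑ z ∈ T ×ˢ T, A z * (U z.1 j ω * U z.2 k ω)) -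
      ∑ z ∈ T ×ˢ T, A z * (V L z.1 j ω * V L z.2 k ω)| +
      |(∑ z ∈ T ×ˢ T, A z * (V L z.1 j ω * V L z.2 k ω)) - qL L|) P := i1.add i2
    have hmean : ∫ ω, ∑ z ∈ T ×ˢ T, A z * (V L z.1 j ω * V L z.2 k ω) ∂P = qL L := by
      rw [integral_finsetSum _ fun z _ => (hiV L z).const_mul _]
      simp_rw [integral_const_mul]
      rfl
    have hdev := integral_abs_sub_integral_le (hvar L).1
    rw [hmean] at hdev
    calc _ ≤ ∫ ω, (|(∑ z ∈ T ×ˢ T, A z * (U z.1 j ω * U z.2 k ω)) -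
            ∑ z ∈ T ×ˢ T, A z * (V L z.1 j ω * V L z.2 k ω)| +
            |(∑ z ∈ T ×ˢ T, A z * (V L z.1 j ω * V L z.2 k ω)) - qL L| + |qL L - q|) ∂P := by
          refine integral_mono (iQ.sub (integrable_const _)).abs
            (i12.add (integrable_const _)) fun ω => ?_
          simp only
          exact (abs_sub_le _ (qL L) _).trans (by gcongr; exact abs_sub_le _ _ _)
      _ = _ := by
          rw [integral_add i12 (integrable_const _), integral_add i1 i2]
      _ ≤ _ := by
          refine add_le_add (add_le_add (hdiff L)
            (hdev.trans (Real.sqrt_le_sqrt (hvar L).2))) (by simp)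
  have hlimit := (hdlim.add ((Real.continuous_sqrt.tendsto _).comp hbound)).add hqL
  refine (ge_of_tendsto' hlimit hstep).trans ?_
  rw [zero_add, add_zero]
  exact Real.sqrt_le_sqrt ((add_le_add hb1 hb2).trans (le_of_eq (by ring)))

end Linear

/-! ### Riemann sums and kernel moments -/

/-- The step function on `[0,1]` with `⌊L⌋₊` steps of width `1 / L` whose integral is a Riemann sum
of `g`. -/
noncomputable def riemannStep (g : ℝ → ℝ) (c L x : ℝ) : ℝ :=
  ∑ i ∈ Finset.range ⌊L⌋₊, (Set.Ico ((i : ℝ) / L) ((i + 1) / L)).indicator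
    (fun _ => g ((c + i) / L)) x

theorem riemannStep_eq (g : ℝ → ℝ) {c L x : ℝ} (hL : 0 < L) (hx : 0 ≤ x) :
    riemannStep g c L x = if ⌊L * x⌋₊ < ⌊L⌋₊ then g ((c + ⌊L * x⌋₊) / L) else 0 := by
  have h : ∀ i : ℕ, (Set.Ico ((i : ℝ) / L) ((i + 1) / L)).indicator
      (fun _ => g ((c + i) / L)) x = if ⌊L * x⌋₊ = i then g ((c + i) / L) else 0 := by
    intro i
    rw [Set.indicator_apply]
    congr 1
    rw [Nat.floor_eq_iff (by positivity), Set.mem_Ico, div_le_iff₀' hL, lt_div_iff₀' hL]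
  simp only [riemannStep, h]
  rw [Finset.sum_ite_eq]
  simp only [Finset.mem_range]

theorem riemannStep_of_neg (g : ℝ → ℝ) {c L x : ℝ} (hL : 0 < L) (hx : x < 0) :
    riemannStep g c L x = 0 := by
  refine Finset.sum_eq_zero fun i _ => Set.indicator_of_notMem (fun h => ?_) _
  have : 0 ≤ (i : ℝ) / L := by positivity
  linarith [h.1]

theorem riemannStep_of_one_le (g : ℝ → ℝ) {c L x : ℝ} (hL : 0 < L) (hx : 1 ≤ x) :
    riemannStep g c L x = 0 := by
  rw [riemannStep_eq g hL (by linarith), if_neg]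
  exact not_lt.2 (Nat.floor_le_floor (le_mul_of_one_le_right hL.le hx))

theorem riemann_point_mem {c L : ℝ} (hc : c ∈ Set.Icc (0 : ℝ) 1) (hL : 0 < L) {i : ℕ}
    (hi : i < ⌊L⌋₊) : (c + i) / L ∈ Set.Icc (0 : ℝ) 1 := by
  have h1 : ((i + 1 : ℕ) : ℝ) ≤ L := (Nat.le_floor_iff hL.le).1 hi
  push_cast at h1
  exact ⟨div_nonneg (add_nonneg hc.1 (by positivity)) hL.le,
    (div_le_one hL).2 (by linarith [hc.2])⟩

theorem abs_riemannStep_le {g : ℝ → ℝ} {C c L : ℝ} (hg : ∀ u ∈ Set.Icc (0 : ℝ) 1, |g u| ≤ C)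
    (hc : c ∈ Set.Icc (0 : ℝ) 1) (hL : 0 < L) (x : ℝ) :
    |riemannStep g c L x| ≤ (Set.Icc (0 : ℝ) 1).indicator (fun _ => C) x := by
  have hC : 0 ≤ C := (abs_nonneg _).trans (hg 0 (by simp))
  rcases lt_or_ge x 0 with hx | hx
  · rw [riemannStep_of_neg g hL hx, abs_zero]
    exact Set.indicator_nonneg (fun _ _ => hC) _
  rcases le_or_gt 1 x with hx1 | hx1
  · rw [riemannStep_of_one_le g hL hx1, abs_zero]
    exact Set.indicator_nonneg (fun _ _ => hC) _
  rw [Set.indicator_of_mem (show x ∈ Set.Icc (0 : ℝ) 1 from ⟨hx, hx1.le⟩), riemannStep_eq g hL hx]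
  split_ifs with h
  · exact hg _ (riemann_point_mem hc hL h)
  · simpa using hC

/-- For `0 ≤ x < 1` the evaluation point is within `1 / L` of `x` and stays in `[0,1]`, so
continuity within the interval suffices. The number `L` is real because `δ n` need not be an
integer. -/
theorem tendsto_riemannStep {g : ℝ → ℝ} {c L : ℕ → ℝ} (hc : ∀ n, c n ∈ Set.Icc (0 : ℝ) 1)
    (hL : Tendsto L atTop atTop) {x : ℝ}
    (hg : x ∈ Set.Icc (0 : ℝ) 1 → ContinuousWithinAt g (Set.Icc (0 : ℝ) 1) x) :
    Tendsto (fun n => riemannStep g (c n) (L n) x) atTop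
      (𝓝 ((Set.Ico (0 : ℝ) 1).indicator g x)) := by
  have hL0 : ∀ᶠ n in atTop, 0 < L n := hL.eventually_gt_atTop 0
  by_cases hx : x ∈ Set.Ico (0 : ℝ) 1
  swap
  · rw [Set.indicator_of_notMem hx]
    refine tendsto_const_nhds.congr' ?_
    filter_upwards [hL0] with n hn
    rcases lt_or_ge x 0 with h | h
    · exact (riemannStep_of_neg g hn h).symm
    · exact (riemannStep_of_one_le g hn (not_lt.1 fun h1 => hx ⟨h, h1⟩)).symm
  rw [Set.indicator_of_mem hx]
  have hlt : ∀ᶠ n in atTop, ⌊L n * x⌋₊ < ⌊L n⌋₊ := by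
    -- Once `L * (1 - x) ≥ 1`, the cell containing `x` is one of the `⌊L⌋₊` complete cells.
    filter_upwards [hL0, hL.eventually_ge_atTop (1 / (1 - x))] with n hn h1
    rw [div_le_iff₀ (by linarith [hx.2])] at h1
    refine Nat.succ_le_iff.1 (Nat.le_floor ?_)
    have := Nat.floor_le (mul_nonneg hn.le hx.1)
    push_cast
    linarith
  have hpt : Tendsto (fun n => (c n + ⌊L n * x⌋₊) / L n) atTop (𝓝[Set.Icc (0 : ℝ) 1] x) := by
    refine tendsto_nhdsWithin_iff.2 ⟨?_, ?_⟩
    · rw [tendsto_iff_dist_tendsto_zero]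
      refine squeeze_zero' (.of_forall fun _ => dist_nonneg) ?_ hL.inv_tendsto_atTop
      filter_upwards [hL0] with n hn
      have h1 := Nat.floor_le (mul_nonneg hn.le hx.1)
      have h2 := Nat.lt_floor_add_one (L n * x)
      rw [Real.dist_eq, Pi.inv_apply, abs_le]
      have e : (c n + ⌊L n * x⌋₊) / L n - x = (c n + ⌊L n * x⌋₊ - L n * x) * (L n)⁻¹ := by
        field_simp
      rw [e]
      have hi : 0 < (L n)⁻¹ := inv_pos.2 hn
      constructor
      · nlinarith [(hc n).1]
      · nlinarith [(hc n).2]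
    · filter_upwards [hL0, hlt] with n hn h using riemann_point_mem (hc n) hn h
  refine ((hg ⟨hx.1, hx.2.le⟩).tendsto.comp hpt).congr' ?_
  filter_upwards [hL0, hlt] with n hn h
  rw [riemannStep_eq g hn hx.1, if_pos h]
  rfl

theorem ae_tendsto_riemannStep {g : ℝ → ℝ} {c L : ℕ → ℝ} (hc : ∀ n, c n ∈ Set.Icc (0 : ℝ) 1)
    (hL : Tendsto L atTop atTop)
    (hg : ∀ᵐ u ∂(volume.restrict (Set.Icc (0 : ℝ) 1)),
      ContinuousWithinAt g (Set.Icc (0 : ℝ) 1) u) :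
    ∀ᵐ x : ℝ, Tendsto (fun n => riemannStep g (c n) (L n) x) atTop
      (𝓝 ((Set.Ico (0 : ℝ) 1).indicator g x)) := by
  filter_upwards [(ae_restrict_iff' measurableSet_Icc).1 hg] with x hx
  exact tendsto_riemannStep hc hL hx

theorem measurable_riemannStep (g : ℝ → ℝ) (c L : ℝ) : Measurable (riemannStep g c L) := by
  unfold riemannStep
  exact Finset.measurable_fun_sum _ fun i _ => measurable_const.indicator measurableSet_Ico

theorem integral_riemannStep (g : ℝ → ℝ) {c L : ℝ} (hL : 0 < L) :
    ∫ x, riemannStep g c L x = L⁻¹ * ∑ i ∈ Finset.range ⌊L⌋₊, g ((c + i) / L) := by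
  unfold riemannStep
  rw [integral_finsetSum, Finset.mul_sum]
  · refine Finset.sum_congr rfl fun i _ => ?_
    rw [integral_indicator_const _ measurableSet_Ico, measureReal_def, Real.volume_Ico,
      ENNReal.toReal_ofReal (by rw [← sub_div]; simp [hL.le]), smul_eq_mul, ← sub_div]
    simp
  · intro i _
    exact (integrable_indicator_iff measurableSet_Ico).2 (integrableOn_const (by simp))

/-- Convergence of Riemann sums of bounded almost everywhere continuous functions. -/
theorem tendsto_riemannSum {g : ℝ → ℝ} {C : ℝ} (hb : ∀ u ∈ Set.Icc (0 : ℝ) 1, |g u| ≤ C)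
    (hg : ∀ᵐ u ∂(volume.restrict (Set.Icc (0 : ℝ) 1)),
      ContinuousWithinAt g (Set.Icc (0 : ℝ) 1) u)
    {c L : ℕ → ℝ} (hc : ∀ n, c n ∈ Set.Icc (0 : ℝ) 1) (hL : Tendsto L atTop atTop) :
    Tendsto (fun n => (L n)⁻¹ * ∑ i ∈ Finset.range ⌊L n⌋₊, g ((c n + i) / L n)) atTop
      (𝓝 (∫ u in (0 : ℝ)..1, g u)) := by
  have hL0 : ∀ᶠ n in atTop, 0 < L n := hL.eventually_gt_atTop 0
  have hlim := tendsto_integral_filter_of_dominated_convergence (μ := volume)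
    (F := fun n x => riemannStep g (c n) (L n) x) (f := (Set.Ico (0 : ℝ) 1).indicator g)
    (l := atTop) ((Set.Icc (0 : ℝ) 1).indicator fun _ => C)
    (.of_forall fun n => (measurable_riemannStep g _ _).aestronglyMeasurable)
    (by filter_upwards [hL0] with n hn using .of_forall (abs_riemannStep_le hb (hc n) hn))
    ((integrable_indicator_iff measurableSet_Icc).2 (integrableOn_const (by simp)))
    (ae_tendsto_riemannStep hc hL hg)
  rw [integral_indicator measurableSet_Ico, integral_Ico_eq_integral_Ioo,
    ← integral_Ioc_eq_integral_Ioo, ← intervalIntegral.integral_of_le zero_le_one] at hlim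
  refine hlim.congr' ?_
  filter_upwards [hL0] with n hn using integral_riemannStep g hn

/-- Measurability is not assumed; it holds almost everywhere because the step functions converge to
`g` almost everywhere on the interval. -/
theorem intervalIntegrable_of_ae_continuous {g : ℝ → ℝ} {C : ℝ}
    (hb : ∀ u ∈ Set.Icc (0 : ℝ) 1, |g u| ≤ C)
    (hg : ∀ᵐ u ∂(volume.restrict (Set.Icc (0 : ℝ) 1)),
      ContinuousWithinAt g (Set.Icc (0 : ℝ) 1) u) : IntervalIntegrable g volume 0 1 := by
  have hm : AEStronglyMeasurable ((Set.Ico (0 : ℝ) 1).indicator g) volume :=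
    aestronglyMeasurable_of_tendsto_ae (f := fun (n : ℕ) x => riemannStep g 0 n x) atTop
      (fun n => (measurable_riemannStep g _ _).aestronglyMeasurable)
      (ae_tendsto_riemannStep (fun _ => by simp) tendsto_natCast_atTop_atTop hg)
  rw [intervalIntegrable_iff_integrableOn_Ico_of_le zero_le_one,
    ← integrable_indicator_iff measurableSet_Ico]
  refine Integrable.mono' (g := (Set.Icc (0 : ℝ) 1).indicator fun _ => C)
    ((integrable_indicator_iff measurableSet_Icc).2 (integrableOn_const (by simp))) hm
    (.of_forall fun x => ?_)
  by_cases hx : x ∈ Set.Ico (0 : ℝ) 1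
  · rw [Set.indicator_of_mem hx, Set.indicator_of_mem (Set.Ico_subset_Icc_self hx)]
    exact hb x ⟨hx.1, hx.2.le⟩
  · rw [Set.indicator_of_notMem hx, norm_zero]
    exact Set.indicator_nonneg (fun _ _ => (abs_nonneg _).trans (hb 0 (by simp))) _

namespace IsKernel

variable {K : ℝ → ℝ}

theorem exists_abs_le (hK : IsKernel K) :
    ∃ C : ℝ, 0 ≤ C ∧ ∀ u ∈ Set.Icc (0 : ℝ) 1, |K u| ≤ C := by
  obtain ⟨C, hC⟩ := hK.bounded
  have h : ∀ u ∈ Set.Icc (0 : ℝ) 1, |K u| ≤ C := fun u hu => by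
    rw [abs_of_nonneg (hK.nonneg u hu)]; exact hC u hu
  exact ⟨C, (abs_nonneg _).trans (h 0 (by simp)), h⟩

theorem ae_continuous_mul (hK : IsKernel K) {φ : ℝ → ℝ} (hφ : Continuous φ) :
    ∀ᵐ u ∂(volume.restrict (Set.Icc (0 : ℝ) 1)),
      ContinuousWithinAt (fun u => K u * φ u) (Set.Icc (0 : ℝ) 1) u := by
  filter_upwards [hK.ae_continuous] with u hu using hu.mul hφ.continuousWithinAt

theorem abs_mul_pow_le {C : ℝ} (hC : ∀ u ∈ Set.Icc (0 : ℝ) 1, |K u| ≤ C) (r : ℕ) :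
    ∀ u ∈ Set.Icc (0 : ℝ) 1, |K u * u ^ r| ≤ C := fun u hu => by
  rw [abs_mul, abs_pow, abs_of_nonneg hu.1]
  exact (mul_le_of_le_one_right (abs_nonneg _) (pow_le_one₀ hu.1 hu.2)).trans (hC u hu)

theorem intervalIntegrable_mul_pow (hK : IsKernel K) (r : ℕ) :
    IntervalIntegrable (fun u => K u * u ^ r) volume 0 1 := by
  obtain ⟨C, _, hC⟩ := hK.exists_abs_le
  exact intervalIntegrable_of_ae_continuous (abs_mul_pow_le hC r)
    (hK.ae_continuous_mul (continuous_pow r))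

theorem tendsto_moment (hK : IsKernel K) (r : ℕ) {c L : ℕ → ℝ}
    (hc : ∀ n, c n ∈ Set.Icc (0 : ℝ) 1) (hL : Tendsto L atTop atTop) :
    Tendsto (fun n => (L n)⁻¹ * ∑ i ∈ Finset.range ⌊L n⌋₊,
      K ((c n + i) / L n) * ((c n + i) / L n) ^ r) atTop (𝓝 (∫ u in (0 : ℝ)..1, K u * u ^ r)) := by
  obtain ⟨C, _, hC⟩ := hK.exists_abs_le
  exact tendsto_riemannSum (g := fun u => K u * u ^ r) (abs_mul_pow_le hC r)
    (hK.ae_continuous_mul (continuous_pow r)) hc hL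

/-- With `v = m2 / m0`, the determinant is `m0 * ∫ K(u) (u ^ 2 - v) ^ 2`. This integral vanishes
only if `K = 0` almost everywhere, because `u ^ 2 = v` at no more than one point of `(0, 1]`;
positive mass excludes that. -/
theorem moment_det_pos (hK : IsKernel K) :
    0 < (∫ u in (0 : ℝ)..1, K u * u ^ 0) * (∫ u in (0 : ℝ)..1, K u * u ^ 4) -
      (∫ u in (0 : ℝ)..1, K u * u ^ 2) ^ 2 := by
  set m0 := ∫ u in (0 : ℝ)..1, K u * u ^ 0 with h0
  set m2 := ∫ u in (0 : ℝ)..1, K u * u ^ 2 with h2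
  set m4 := ∫ u in (0 : ℝ)..1, K u * u ^ 4 with h4
  have hm0 : 0 < m0 := by
    rw [h0]; simpa using hK.mass_pos
  have i0 := hK.intervalIntegrable_mul_pow 0
  have i2 := hK.intervalIntegrable_mul_pow 2
  have i4 := hK.intervalIntegrable_mul_pow 4
  set v := m2 / m0 with hv
  have hexp : ∀ u, K u * (u ^ 2 - v) ^ 2 = K u * u ^ 4 - 2 * v * (K u * u ^ 2) +
      v ^ 2 * (K u * u ^ 0) := fun u => by ring
  have hint : IntervalIntegrable (fun u => K u * (u ^ 2 - v) ^ 2) volume 0 1 := by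
    simp only [hexp]
    exact (i4.sub (i2.const_mul _)).add (i0.const_mul _)
  have hval : ∫ u in (0 : ℝ)..1, K u * (u ^ 2 - v) ^ 2 = m4 - 2 * v * m2 + v ^ 2 * m0 := by
    simp only [hexp]
    rw [intervalIntegral.integral_add (i4.sub (i2.const_mul _)) (i0.const_mul _),
      intervalIntegral.integral_sub i4 (i2.const_mul _), intervalIntegral.integral_const_mul,
      intervalIntegral.integral_const_mul]
  have hnn : 0 ≤ᵐ[volume.restrict (Set.Ioc (0 : ℝ) 1)] fun u => K u * (u ^ 2 - v) ^ 2 := by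
    filter_upwards [ae_restrict_mem measurableSet_Ioc] with u hu
    exact mul_nonneg (hK.nonneg u ⟨hu.1.le, hu.2⟩) (sq_nonneg _)
  have hpos : 0 < ∫ u in (0 : ℝ)..1, K u * (u ^ 2 - v) ^ 2 := by
    rw [intervalIntegral.integral_of_le zero_le_one]
    refine lt_of_le_of_ne (integral_nonneg_of_ae hnn) fun heq => ?_
    have hz := (integral_eq_zero_iff_of_nonneg_ae hnn
      ((intervalIntegrable_iff_integrableOn_Ioc_of_le zero_le_one).1 hint)).1 heq.symm
    have hne : ∀ᵐ u ∂(volume.restrict (Set.Ioc (0 : ℝ) 1)), u ≠ Real.sqrt v :=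
      ae_restrict_of_ae (by simp [ae_iff])
    have hK0 : (fun u => K u * u ^ 0) =ᵐ[volume.restrict (Set.Ioc (0 : ℝ) 1)] 0 := by
      filter_upwards [hz, hne, ae_restrict_mem measurableSet_Ioc] with u h1 h2 h3
      rcases mul_eq_zero.1 h1 with h | h
      · simp [h]
      · exfalso
        apply h2
        have : u ^ 2 = v := by linarith [pow_eq_zero_iff (two_ne_zero) |>.1 h]
        rw [← this, Real.sqrt_sq h3.1.le]
    rw [h0, intervalIntegral.integral_of_le zero_le_one, integral_congr_ae hK0] at hm0
    simp at hm0
  rw [hval] at hpos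
  have h5 : m0 * (m4 - 2 * v * m2 + v ^ 2 * m0) = m0 * m4 - m2 ^ 2 := by
    rw [hv]; field_simp; ring
  rw [← h5]
  exact mul_pos hm0 hpos

end IsKernel

/-! ### The estimator as a weighted average of periodogram ordinates -/

/-- Normal equations of weighted least squares for a straight line. -/
theorem normalMatrix_eq {N : ℕ} (v W : Fin N → ℝ) :
    (Matrix.of fun i (c : Fin 2) => if c = 0 then (1 : ℝ) else v i).transpose * Matrix.diagonal W *
      (Matrix.of fun i (c : Fin 2) => if c = 0 then (1 : ℝ) else v i) =
      !![∑ i, W i, ∑ i, W i * v i; ∑ i, W i * v i, ∑ i, W i * v i ^ 2] := by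
  ext a b
  rw [Matrix.mul_apply]
  simp only [Matrix.mul_diagonal, Matrix.transpose_apply, Matrix.of_apply]
  fin_cases a <;> fin_cases b <;> simp
  · exact Finset.sum_congr rfl fun i _ => mul_comm _ _
  · exact Finset.sum_congr rfl fun i _ => by ring

/-- This is Cramer's rule for two unknowns. No invertibility is needed: for zero determinant both
sides are zero by convention. -/
theorem wls_eq_sum {N : ℕ} (v W Y : Fin N → ℝ) :
    ((Matrix.mulVec ((!![∑ i, W i, ∑ i, W i * v i; ∑ i, W i * v i, ∑ i, W i * v i ^ 2])⁻¹ *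
      (Matrix.of fun i (c : Fin 2) => if c = 0 then (1 : ℝ) else v i).transpose *
      Matrix.diagonal W) Y) 0) =
      ∑ i, ((∑ i, W i * v i ^ 2) - (∑ i, W i * v i) * v i) * W i /
        ((∑ i, W i) * (∑ i, W i * v i ^ 2) - (∑ i, W i * v i) ^ 2) * Y i := by
  rw [Matrix.inv_def, Matrix.adjugate_fin_two_of, Matrix.det_fin_two_of, Ring.inverse_eq_inv']
  simp only [Matrix.mulVec, dotProduct]
  refine Finset.sum_congr rfl fun i _ => ?_
  rw [Matrix.mul_diagonal, Matrix.mul_apply]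
  simp only [Fin.sum_univ_two, Matrix.transpose_apply, Matrix.of_apply, Matrix.smul_apply]
  simp
  left
  rw [div_eq_mul_inv, ← pow_two]
  ring

/-- The integers `s` for which `2πs/n` are the frequencies used at the boundary point. -/
noncomputable def freqIndex (θ δ : ℝ) (n : ℕ) (i : Fin (numFreq δ n)) : ℤ :=
  if θ = 0 then (i : ℤ) + 1 else (n : ℤ) / 2 - (numFreq δ n : ℤ) + 1 + (i : ℤ)

theorem freq_eq_fourierFreq (θ δ : ℝ) (n : ℕ) (i : Fin (numFreq δ n)) :
    freq θ δ n i = fourierFreq n (freqIndex θ δ n i) := rfl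

theorem freqIndex_injective (θ δ : ℝ) (n : ℕ) : Function.Injective (freqIndex θ δ n) := by
  intro i i' h
  unfold freqIndex at h
  split_ifs at h <;> exact Fin.ext (by omega)

/-- The condition `2M < n` keeps the indices strictly between `0` and `n`, where orthogonality to
constants is available. -/
theorem freqIndex_mem {θ δ : ℝ} {n : ℕ} (hn : 2 * numFreq δ n < n) (i : Fin (numFreq δ n)) :
    freqIndex θ δ n i ∈ Set.Ioo (0 : ℤ) n := by
  have := i.2
  unfold freqIndex
  split_ifs <;> constructor <;> omega

/-- The offset of the grid of distances to the boundary frequency. -/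
noncomputable def gridOffset (θ : ℝ) (n : ℕ) : ℝ :=
  if θ = 0 then 1 else (n : ℝ) / 2 - ((n : ℤ) / 2 : ℤ)

theorem gridOffset_mem (θ : ℝ) (n : ℕ) : gridOffset θ n ∈ Set.Icc (0 : ℝ) 1 := by
  unfold gridOffset
  split_ifs
  · simp
  · have h1 : 2 * ((n : ℤ) / 2) ≤ n := by omega
    have h2 : (n : ℤ) ≤ 2 * ((n : ℤ) / 2) + 1 := by omega
    have h1' : 2 * (((n : ℤ) / 2 : ℤ) : ℝ) ≤ n := by exact_mod_cast h1
    have h2' : (n : ℝ) ≤ 2 * (((n : ℤ) / 2 : ℤ) : ℝ) + 1 := by exact_mod_cast h2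
    constructor <;> linarith

/-- At `±π` distances decrease with the index, so reversal puts all cases on the grid `c, c + 1, …,
c + M - 1` in units of `2π/n`. The offset is `1` at the origin; at `±π` it is `0` or `1/2` according
to the parity of `n`. -/
theorem abs_sub_freq {θ : ℝ} (hθ : θ = 0 ∨ θ = Real.pi ∨ θ = -Real.pi) (δ : ℝ) {n : ℕ}
    (hn : 0 < n) : ∃ e : Equiv.Perm (Fin (numFreq δ n)), ∀ i,
      |(|θ| - freq θ δ n i)| = 2 * Real.pi * ((gridOffset θ n + (e i : ℕ)) / n) := by
  have hnR : (0 : ℝ) < n := by exact_mod_cast hn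
  by_cases h0 : θ = 0
  · refine ⟨Equiv.refl _, fun i => ?_⟩
    subst h0
    simp only [freq, gridOffset, if_true, abs_zero, zero_sub, abs_neg, Equiv.refl_apply]
    rw [abs_of_nonneg (by positivity)]
    push_cast; ring
  · refine ⟨Fin.revPerm, fun i => ?_⟩
    have hθ' : |θ| = Real.pi := by
      rcases hθ with h | h | h
      · exact absurd h h0
      · rw [h, abs_of_pos Real.pi_pos]
      · rw [h, abs_neg, abs_of_pos Real.pi_pos]
    have hi : ((Fin.revPerm i : Fin (numFreq δ n)) : ℕ) = (numFreq δ n : ℝ) - 1 - (i : ℕ) := by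
      rw [Fin.revPerm_apply, Fin.val_rev, Nat.cast_sub (by omega)]; push_cast; ring
    have e : |θ| - freq θ δ n i =
        2 * Real.pi * ((gridOffset θ n + ((Fin.revPerm i : Fin (numFreq δ n)) : ℕ)) / n) := by
      rw [hi, hθ', freq, gridOffset, if_neg h0, if_neg h0]
      push_cast
      field_simp
      ring
    rw [e, abs_of_nonneg]
    exact mul_nonneg (by positivity)
      (div_nonneg (add_nonneg (gridOffset_mem θ n).1 (by positivity)) hnR.le)

/-- The local quadratic estimator is a weighted average of periodogram ordinates, with weights of
the order of the reciprocal of the number of frequencies. -/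
theorem exists_weights {K : ℝ → ℝ} (hK : IsKernel K) {δ : ℕ → ℝ}
    (hM : Tendsto (fun n : ℕ => numFreq (δ n) n) atTop atTop) {θ : ℝ}
    (hθ : θ = 0 ∨ θ = Real.pi ∨ θ = -Real.pi) :
    ∃ C : ℝ, ∀ᶠ n : ℕ in atTop, IsUnit (gramXWX K θ (δ n) n).det ∧
      ∃ w : Fin (numFreq (δ n) n) → ℝ, ∑ i, w i = 1 ∧ (∀ i, |w i| ≤ C / numFreq (δ n) n) ∧
        ∀ (m : ℕ) (x : ℤ → Fin m → ℝ) (j k : Fin m),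
          wlsEstimator K θ (δ n) n x j k = ∑ i, w i * responseY θ (δ n) n x j k i := by
  obtain ⟨CK, hCK0, hCK⟩ := hK.exists_abs_le
  -- The kernel is scaled by `δ`, so the grid spacing is `1 / (δ n)` rather than `1 / M`; only the
  -- number of terms is rounded.
  let L : ℕ → ℝ := fun n => δ n * n
  have hMpos : ∀ᶠ n : ℕ in atTop, 0 < numFreq (δ n) n := hM.eventually_gt_atTop 0
  have hLM : ∀ᶠ n : ℕ in atTop, (numFreq (δ n) n : ℝ) ≤ L n := by
    filter_upwards [hMpos] with n hn
    exact Nat.floor_le (le_of_lt (Nat.pos_of_floor_pos hn))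
  have hL : Tendsto L atTop atTop :=
    tendsto_atTop_mono' _ hLM (tendsto_natCast_atTop_atTop.comp hM)
  let c : ℕ → ℝ := gridOffset θ
  have hc : ∀ n, c n ∈ Set.Icc (0 : ℝ) 1 := gridOffset_mem θ
  let T : ℕ → ℕ → ℝ := fun r n => (L n)⁻¹ * ∑ i ∈ Finset.range ⌊L n⌋₊,
      K ((c n + i) / L n) * ((c n + i) / L n) ^ r
  have hT : ∀ r, Tendsto (T r) atTop (𝓝 (∫ u in (0 : ℝ)..1, K u * u ^ r)) := fun r =>
    hK.tendsto_moment r hc hL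
  have hdet := ((hT 0).mul (hT 4)).sub ((hT 2).pow 2)
  have hpos := hK.moment_det_pos
  have hdet0 : ∀ᶠ n in atTop, 0 < T 0 n * T 4 n - T 2 n ^ 2 := hdet.eventually_const_lt hpos
  have hZ := (((hT 4).abs.add (hT 2).abs).mul_const CK).div hdet hpos.ne'
  set Z := ((|∫ u in (0 : ℝ)..1, K u * u ^ 4| + |∫ u in (0 : ℝ)..1, K u * u ^ 2|) * CK) /
    ((∫ u in (0 : ℝ)..1, K u * u ^ 0) * (∫ u in (0 : ℝ)..1, K u * u ^ 4) -
      (∫ u in (0 : ℝ)..1, K u * u ^ 2) ^ 2)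
  have hZ1 := hZ.eventually_lt_const (lt_add_one Z)
  -- `Z` is the limit of the bound for `L * |w i|`, so `Z + 1` is eventually a bound; `M ≤ L` then
  -- allows division by `M`.
  refine ⟨Z + 1, ?_⟩
  filter_upwards [hMpos, hLM, hL.eventually_gt_atTop 0, hdet0, hZ1, eventually_gt_atTop 0] with
    n hMn hLMn hLn hdn hZn hn
  have hnR : (0 : ℝ) < n := by exact_mod_cast hn
  have hMR : (0 : ℝ) < numFreq (δ n) n := by exact_mod_cast hMn
  have hδ : 0 < δ n := (pos_iff_pos_of_mul_pos hLn).2 hnR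
  set N := numFreq (δ n) n with hN
  obtain ⟨e, he⟩ : ∃ e : Equiv.Perm (Fin N), ∀ i : Fin N,
      |(|θ| - freq θ (δ n) n i)| = 2 * Real.pi * ((gridOffset θ n + (e i : ℕ)) / n) :=
    abs_sub_freq hθ (δ n) hn
  set h : ℝ := 2 * Real.pi * δ n with hh
  have hh0 : 0 < h := by positivity
  let u : Fin N → ℝ := fun i => (c n + (e i : ℕ)) / L n
  have hu : ∀ i, u i ∈ Set.Icc (0 : ℝ) 1 := fun i => riemann_point_mem (hc n) hLn (e i).2
  have hdist : ∀ i, |(|θ| - freq θ (δ n) n i)| = h * u i := by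
    intro i
    rw [he]
    simp only [u, L, c, h]
    field_simp
  let v : Fin N → ℝ := fun i => (|θ| - freq θ (δ n) n i) ^ 2
  have hv : ∀ i, v i = h ^ 2 * u i ^ 2 := fun i => by
    simp only [v]; rw [← sq_abs, hdist]; ring
  let W : Fin N → ℝ := fun i => scaledKernel K (δ n) |(|θ| - freq θ (δ n) n i)|
  have hW : ∀ i, W i = h⁻¹ * K (u i) := fun i => by
    simp only [W, scaledKernel]
    rw [hdist, mul_div_cancel_left₀ _ hh0.ne']
  have hsum : ∀ r, ∑ i, K (u i) * u i ^ r = L n * T r n := by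
    intro r
    simp only [T]
    rw [mul_inv_cancel_left₀ hLn.ne', Finset.sum_range]
    exact Equiv.sum_comp e fun i : Fin N => K ((c n + (i : ℕ)) / L n) * ((c n + (i : ℕ)) / L n) ^ r
  have g0 : ∑ i, W i = h⁻¹ * (L n * T 0 n) := by
    rw [← hsum, Finset.mul_sum]
    exact Finset.sum_congr rfl fun i _ => by rw [hW]; ring
  have g1 : ∑ i, W i * v i = h * (L n * T 2 n) := by
    rw [← hsum, Finset.mul_sum]
    exact Finset.sum_congr rfl fun i _ => by rw [hW, hv]; field_simp
  have g2 : ∑ i, W i * v i ^ 2 = h ^ 3 * (L n * T 4 n) := by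
    rw [← hsum, Finset.mul_sum]
    exact Finset.sum_congr rfl fun i _ => by rw [hW, hv]; field_simp
  have hG : gramXWX K θ (δ n) n =
      !![∑ i, W i, ∑ i, W i * v i; ∑ i, W i * v i, ∑ i, W i * v i ^ 2] := normalMatrix_eq v W
  -- The bandwidth enters only through powers of `h`, which cancel in the weights; what remains is a
  -- function of the rescaled moments.
  have hdetG : (∑ i, W i) * (∑ i, W i * v i ^ 2) - (∑ i, W i * v i) ^ 2 =
      h ^ 2 * L n ^ 2 * (T 0 n * T 4 n - T 2 n ^ 2) := by
    rw [g0, g1, g2]; field_simp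
  have hdetpos : 0 < (∑ i, W i) * (∑ i, W i * v i ^ 2) - (∑ i, W i * v i) ^ 2 := by
    rw [hdetG]; positivity
  refine ⟨?_, fun i => ((∑ i, W i * v i ^ 2) - (∑ i, W i * v i) * v i) * W i /
        ((∑ i, W i) * (∑ i, W i * v i ^ 2) - (∑ i, W i * v i) ^ 2), ?_, ?_, ?_⟩
  · rw [hG, Matrix.det_fin_two_of, isUnit_iff_ne_zero, ← pow_two]
    exact hdetpos.ne'
  -- The intercept of a least squares fit reproduces constants, so the weights sum to one.
  · rw [← Finset.sum_div, div_eq_one_iff_eq hdetpos.ne']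
    simp only [sub_mul, Finset.sum_sub_distrib, ← Finset.mul_sum, mul_assoc]
    rw [Finset.sum_congr rfl fun i _ => mul_comm (v i) (W i)]
    ring
  · intro i
    have e1 : ((∑ i, W i * v i ^ 2) - (∑ i, W i * v i) * v i) * W i /
        ((∑ i, W i) * (∑ i, W i * v i ^ 2) - (∑ i, W i * v i) ^ 2) =
        (T 4 n - T 2 n * u i ^ 2) * K (u i) / (T 0 n * T 4 n - T 2 n ^ 2) / L n := by
      rw [hdetG, g1, g2, hv, hW]
      field_simp
    simp only
    rw [e1, abs_div, abs_div, abs_mul, abs_of_pos hLn, abs_of_pos hdn]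
    refine (div_le_div_of_nonneg_left (by positivity) hMR hLMn).trans ?_
    refine div_le_div_of_nonneg_right (le_trans ?_ hZn.le) hMR.le
    refine div_le_div_of_nonneg_right ?_ hdn.le
    refine mul_le_mul ?_ (hCK _ (hu i)) (abs_nonneg _) (by positivity)
    refine (abs_sub _ _).trans (add_le_add le_rfl ?_)
    rw [abs_mul, abs_of_nonneg (sq_nonneg (u i))]
    exact mul_le_of_le_one_right (abs_nonneg _) (pow_le_one₀ (hu i).1 (hu i).2)
  · intro m x j k
    rw [wlsEstimator, hG]
    exact wls_eq_sum v W _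

/-! ### Expected periodogram and its limit -/

theorem sum_lag_eq {E : Type*} [AddCommMonoid E] (n : ℕ) (F : ℤ → ℤ → E) :
    ∑ h ∈ Finset.Ioo (-(n : ℤ)) n,
      ∑ t ∈ (Finset.Icc (1 : ℤ) n).filter (fun t => 1 ≤ t + h ∧ t + h ≤ n), F (t + h) t =
    ∑ t ∈ Finset.Icc (1 : ℤ) n, ∑ u ∈ Finset.Icc (1 : ℤ) n, F t u := by
  rw [Finset.sum_sigma', ← Finset.sum_product']
  refine Finset.sum_bij' (fun p _ => (p.2 + p.1, p.2)) (fun p _ => ⟨p.1 - p.2, p.2⟩) ?_ ?_ ?_ ?_ ?_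
  · rintro ⟨h, t⟩ hp
    simp only [Finset.mem_sigma, Finset.mem_filter, Finset.mem_Icc, Finset.mem_Ioo,
      Finset.mem_product] at hp ⊢
    omega
  · rintro ⟨t, u⟩ hp
    simp only [Finset.mem_sigma, Finset.mem_filter, Finset.mem_Icc, Finset.mem_Ioo,
      Finset.mem_product] at hp ⊢
    omega
  · rintro ⟨h, t⟩ _; simp
  · rintro ⟨t, u⟩ _; simp
  · rintro ⟨h, t⟩ _; rfl

theorem exp_neg_I_mul_re (w : ℝ) (h : ℤ) :
    (Complex.exp (-Complex.I * w * h)).re = Real.cos (w * h) := by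
  have : -Complex.I * w * h = ((-(w * h) : ℝ) : ℂ) * Complex.I := by push_cast; ring
  rw [this, Complex.exp_ofReal_mul_I_re, Real.cos_neg]

theorem periodogram_re {m : ℕ} (n : ℕ) (x : ℤ → Fin m → ℝ) (j k : Fin m) (w : ℝ) :
    (periodogram n x j k w).re = (2 * Real.pi * n)⁻¹ *
      cosForm n w (fun t => x t j - sampleMean n x j) (fun t => x t k - sampleMean n x k) := by
  have h1 : (1 / (2 * Real.pi) : ℂ) = (((2 * Real.pi)⁻¹ : ℝ) : ℂ) := by push_cast; rw [one_div]
  rw [periodogram, h1, Complex.re_ofReal_mul, Complex.re_sum, cosForm, mul_inv (2 * Real.pi),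
    mul_assoc _ (n : ℝ)⁻¹]
  refine congrArg _ ?_
  rw [← sum_lag_eq n fun t u => Real.cos (w * (t - u)) *
    (x t j - sampleMean n x j) * (x u k - sampleMean n x k), Finset.mul_sum]
  refine Finset.sum_congr rfl fun h _ => ?_
  rw [mul_comm, Complex.re_ofReal_mul, exp_neg_I_mul_re, sampleAutocov, div_eq_inv_mul, mul_assoc,
    Finset.sum_mul]
  refine congrArg _ (Finset.sum_congr rfl fun t _ => ?_)
  push_cast
  rw [add_sub_cancel_left]
  ring

theorem card_lag (n : ℕ) {h : ℤ} (hh : h ∈ Finset.Ioo (-(n : ℤ)) n) :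
    (((Finset.Icc (1 : ℤ) n).filter (fun t => 1 ≤ t + h ∧ t + h ≤ n)).card : ℝ) = n - |(h : ℝ)| := by
  rw [Finset.mem_Ioo] at hh
  have e : (Finset.Icc (1 : ℤ) n).filter (fun t => 1 ≤ t + h ∧ t + h ≤ n) =
      Finset.Icc (max 1 (1 - h)) (min n (n - h)) := by
    ext t
    simp only [Finset.mem_filter, Finset.mem_Icc, max_le_iff, le_min_iff]
    omega
  rw [e, Int.card_Icc]
  have : (((min (n : ℤ) (n - h) + 1 - max 1 (1 - h)).toNat : ℕ) : ℤ) = n - |h| := by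
    rcases abs_cases h with ⟨h1, h2⟩ | ⟨h1, h2⟩ <;> rw [h1] <;> omega
  exact_mod_cast this

/-- The triangular lag window. -/
noncomputable def triangle (n : ℕ) (h : ℤ) : ℝ :=
  if h ∈ Finset.Ioo (-(n : ℤ)) n then 1 - |(h : ℝ)| / n else 0

theorem triangle_mem {n : ℕ} (hn : 0 < n) (h : ℤ) : triangle n h ∈ Set.Icc (0 : ℝ) 1 := by
  have hnR : (0 : ℝ) < n := by exact_mod_cast hn
  unfold triangle
  split_ifs with hh
  · rw [Finset.mem_Ioo, ← abs_lt] at hh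
    have h1 : |(h : ℝ)| < n := by exact_mod_cast hh
    have h2 : |(h : ℝ)| / n ≤ 1 := (div_le_one hnR).2 h1.le
    have h3 : 0 ≤ |(h : ℝ)| / n := by positivity
    constructor <;> linarith
  · simp

theorem abs_triangle_sub_one_le {n : ℕ} (hn : 0 < n) (h : ℤ) :
    |triangle n h - 1| ≤ |(h : ℝ)| / n := by
  have hnR : (0 : ℝ) < n := by exact_mod_cast hn
  unfold triangle
  split_ifs with hh
  · rw [sub_sub_cancel_left, abs_neg, abs_of_nonneg (by positivity)]
  · rw [Finset.mem_Ioo, ← abs_lt, not_lt] at hh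
    have h1 : (n : ℝ) ≤ |(h : ℝ)| := by exact_mod_cast hh
    simpa using (one_le_div hnR).2 h1

/-- Exactly `n - |h|` pairs of sample times have lag `h`. Extending the sum to all of `ℤ` by a
vanishing window permits termwise comparison with the spectral series. -/
theorem sum_cos_toeplitz_eq {n : ℕ} (hn : 0 < n) (w : ℝ) (γ : ℤ → ℝ) :
    (n : ℝ)⁻¹ * ∑ t ∈ Finset.Icc (1 : ℤ) n, ∑ u ∈ Finset.Icc (1 : ℤ) n,
      Real.cos (w * (t - u)) * γ (t - u) = ∑' h : ℤ, triangle n h * Real.cos (w * h) * γ h := by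
  have hnR : (n : ℝ) ≠ 0 := by exact_mod_cast hn.ne'
  rw [← sum_lag_eq n fun t u => Real.cos (w * (t - u)) * γ (t - u), Finset.mul_sum,
    tsum_eq_sum (s := Finset.Ioo (-(n : ℤ)) n) fun h hh => by rw [triangle, if_neg hh]; ring]
  refine Finset.sum_congr rfl fun h hh => ?_
  have e : ∀ t : ℤ, Real.cos (w * (((t + h : ℤ) : ℝ) - t)) * γ (t + h - t) =
      Real.cos (w * h) * γ h := fun t => by
    push_cast; rw [add_sub_cancel_left, add_sub_cancel_left]
  simp only [e]
  rw [Finset.sum_const, nsmul_eq_mul, card_lag n hh, triangle, if_pos hh]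
  field_simp

/-- The error made by smoothing with the triangular lag window and perturbing the frequency. -/
theorem abs_tsum_triangle_sub_le {n : ℕ} (hn : 0 < n) {γ : ℤ → ℝ} (hγ : Summable γ) {w θ ρ : ℝ}
    (hw : |(|θ| - w)| ≤ ρ) :
    |(∑' h : ℤ, triangle n h * Real.cos (w * h) * γ h) - ∑' h : ℤ, Real.cos (θ * h) * γ h| ≤
      ∑' h : ℤ, min 2 ((1 / n + ρ) * |(h : ℝ)|) * |γ h| := by
  have hcosθ : ∀ h : ℤ, Real.cos (θ * h) = Real.cos (|θ| * h) := fun h => by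
    rcases abs_choice θ with h1 | h1 <;> rw [h1]
    rw [neg_mul, Real.cos_neg]
  have hρ : 0 ≤ ρ := (abs_nonneg _).trans hw
  -- The constant bound provides domination; the linear one, from the slope of the window and the
  -- Lipschitz property of cosine, provides convergence at each lag.
  have hb : ∀ h : ℤ, |triangle n h * Real.cos (w * h) - Real.cos (θ * h)| ≤
      min 2 ((1 / n + ρ) * |(h : ℝ)|) := by
    intro h
    have ht := triangle_mem hn h
    have h1 : |triangle n h * Real.cos (w * h)| ≤ 1 := by
      rw [abs_mul, abs_of_nonneg ht.1]
      exact mul_le_one₀ ht.2 (abs_nonneg _) (Real.abs_cos_le_one _)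
    refine le_min ?_ ?_
    · refine (abs_sub _ _).trans ?_
      linarith [Real.abs_cos_le_one (θ * h)]
    · have e : triangle n h * Real.cos (w * h) - Real.cos (θ * h) =
          (triangle n h - 1) * Real.cos (w * h) + (Real.cos (w * h) - Real.cos (|θ| * h)) := by
        rw [hcosθ]; ring
      rw [e, add_mul]
      refine (abs_add_le _ _).trans (add_le_add ?_ ?_)
      · rw [abs_mul]
        refine (mul_le_of_le_one_right (abs_nonneg _) (Real.abs_cos_le_one _)).trans ?_
        exact (abs_triangle_sub_one_le hn h).trans (le_of_eq (by ring))
      · refine (Real.abs_cos_sub_cos_le _ _).trans ?_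
        rw [← sub_mul, abs_mul, abs_sub_comm]
        exact mul_le_mul_of_nonneg_right hw (abs_nonneg _)
  have s0 : Summable fun h : ℤ => min 2 ((1 / n + ρ) * |(h : ℝ)|) * |γ h| :=
    Summable.of_nonneg_of_le (fun h => mul_nonneg (le_min zero_le_two (by positivity))
      (abs_nonneg _)) (fun h => mul_le_mul_of_nonneg_right (min_le_left _ _) (abs_nonneg _))
      (hγ.abs.mul_left 2)
  have s1 : Summable fun h : ℤ => triangle n h * Real.cos (w * h) * γ h :=
    summable_of_ne_finset_zero (s := Finset.Ioo (-(n : ℤ)) n) fun h hh => by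
      rw [triangle, if_neg hh]; ring
  have s2 : Summable fun h : ℤ => Real.cos (θ * h) * γ h :=
    Summable.of_norm_bounded hγ.abs fun h => by
      rw [Real.norm_eq_abs, abs_mul]
      exact mul_le_of_le_one_left (abs_nonneg _) (Real.abs_cos_le_one _)
  rw [← s1.tsum_sub s2]
  have s3 : ∀ h : ℤ, |triangle n h * Real.cos (w * h) * γ h - Real.cos (θ * h) * γ h| ≤
      min 2 ((1 / n + ρ) * |(h : ℝ)|) * |γ h| := fun h => by
    rw [← sub_mul, abs_mul]
    exact mul_le_mul_of_nonneg_right (hb h) (abs_nonneg _)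
  exact (Real.norm_eq_abs _).symm.le.trans
    (tsum_of_norm_bounded s0.hasSum fun h => (Real.norm_eq_abs _).le.trans (s3 h))

/-- Each term tends to zero and is at most `2 * |γ h|`, so dominated convergence applies without any
decay rate for `γ`. -/
theorem tendsto_tsum_min {γ : ℤ → ℝ} (hγ : Summable γ) {ρ : ℕ → ℝ} (hρ0 : ∀ n, 0 ≤ ρ n)
    (hρ : Tendsto ρ atTop (𝓝 0)) :
    Tendsto (fun n => ∑' h : ℤ, min 2 (ρ n * |(h : ℝ)|) * |γ h|) atTop (𝓝 0) := by
  have h := tendsto_tsum_of_dominated_convergence (𝓕 := atTop)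
    (f := fun n (h : ℤ) => min 2 (ρ n * |(h : ℝ)|) * |γ h|) (g := fun _ => (0 : ℝ))
    (hγ.abs.mul_left 2) (fun h => ?_) (.of_forall fun n h => ?_)
  · simpa using h
  · have := ((tendsto_const_nhds (x := (2 : ℝ))).min (hρ.mul_const |(h : ℝ)|)).mul_const |γ h|
    simpa using this
  · rw [Real.norm_eq_abs, abs_of_nonneg (mul_nonneg (le_min zero_le_two
      (mul_nonneg (hρ0 n) (abs_nonneg _))) (abs_nonneg _))]
    exact mul_le_mul_of_nonneg_right (min_le_left _ _) (abs_nonneg _)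

/-! ### Boundary spectra, and the mean of the weighted average -/

section Spectral

variable {Ω : Type*} [MeasurableSpace Ω] {P : Measure Ω} {m : ℕ} {X : ℤ → Ω → Fin m → ℝ}

/-- At the boundary frequencies the cross spectra are real. -/
theorem specDensity_boundary {θ : ℝ} (hθ : θ = 0 ∨ θ = Real.pi ∨ θ = -Real.pi) (j k : Fin m) :
    specDensity P X j k θ =
      (((2 * Real.pi)⁻¹ * ∑' h : ℤ, Real.cos (θ * h) * autocov P X j k h : ℝ) : ℂ) := by
  have hsin : ∀ h : ℤ, Real.sin (-(θ * h)) = 0 := by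
    intro h
    rcases hθ with rfl | rfl | rfl
    · simp
    · rw [Real.sin_neg, mul_comm, Real.sin_int_mul_pi, neg_zero]
    · rw [neg_mul, neg_neg, mul_comm, Real.sin_int_mul_pi]
  have hexp : ∀ h : ℤ, Complex.exp (-Complex.I * θ * h) = (Real.cos (θ * h) : ℂ) := by
    intro h
    apply Complex.ext
    · rw [exp_neg_I_mul_re, Complex.ofReal_re]
    · have : -Complex.I * θ * h = ((-(θ * h) : ℝ) : ℂ) * Complex.I := by push_cast; ring
      rw [this, Complex.exp_ofReal_mul_I_im, Complex.ofReal_im, hsin]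
  rw [specDensity]
  simp only [hexp]
  push_cast
  rw [one_div]

variable [IsProbabilityMeasure P]

/-- Concentration of weighted periodogram averages. -/
theorem AssumptionB.exists_integral_abs_le (hB : AssumptionB P X)
    (hL2 : ∀ (t : ℤ) (a : Fin m), MemLp (fun ω => X t ω a) 2 P)
    (hγ : ∀ j k, Summable (autocov P X j k)) (j k : Fin m) :
    ∃ C : ℝ, 0 ≤ C ∧ ∀ (N : ℕ) (n : ℕ) (s : Fin N → ℤ) (w : Fin N → ℝ) (b : ℝ),
      (∀ i, s i ∈ Set.Ioo (0 : ℤ) n) → Function.Injective s → (∀ i, |w i| ≤ b) →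
      ∫ ω, |(∑ p ∈ Finset.Icc (1 : ℤ) n ×ˢ Finset.Icc (1 : ℤ) n, cosWeight n s w p.1 p.2 *
          ((X p.1 ω j - ∫ ω', X 0 ω' j ∂P) * (X p.2 ω k - ∫ ω', X 0 ω' k ∂P))) -
        ∑ p ∈ Finset.Icc (1 : ℤ) n ×ˢ Finset.Icc (1 : ℤ) n, cosWeight n s w p.1 p.2 *
          autocov P X j k (p.1 - p.2)| ∂P ≤ Real.sqrt (C * (N * b ^ 2)) := by
  rcases hB.linear_or_cumulant with h | h
  · exact h.exists_integral_abs_le hB.stationary hL2 hγ j k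
  · exact h.exists_integral_abs_le hB.stationary hγ j k

/-- Because the weights sum to one, the limit can be moved inside the average and compared frequency
by frequency. The factor `N * b` bounds `∑ |w i|`; negative weights are allowed. -/
theorem abs_mean_sub_le {N n : ℕ} {s : Fin N → ℤ} {w : Fin N → ℝ} {b ρ θ : ℝ} {γ : ℤ → ℝ}
    (hn : 0 < n) (hγ : Summable γ) (hw : ∀ i, |w i| ≤ b) (hsum : ∑ i, w i = 1)
    (hs : ∀ i, |(|θ| - fourierFreq n (s i))| ≤ ρ) :
    |(∑ p ∈ Finset.Icc (1 : ℤ) n ×ˢ Finset.Icc (1 : ℤ) n, cosWeight n s w p.1 p.2 * γ (p.1 - p.2)) -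
      (2 * Real.pi)⁻¹ * ∑' h : ℤ, Real.cos (θ * h) * γ h| ≤
      N * b * ∑' h : ℤ, min 2 ((1 / n + ρ) * |(h : ℝ)|) * |γ h| := by
  set f := ∑' h : ℤ, Real.cos (θ * h) * γ h with hf
  have e1 : ∑ p ∈ Finset.Icc (1 : ℤ) n ×ˢ Finset.Icc (1 : ℤ) n,
      cosWeight n s w p.1 p.2 * γ (p.1 - p.2) = (2 * Real.pi)⁻¹ * ∑ i, w i *
        ∑' h : ℤ, triangle n h * Real.cos (fourierFreq n (s i) * h) * γ h := by
    rw [Finset.sum_product]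
    simp only [← sum_cos_toeplitz_eq hn, cosWeight, Finset.mul_sum, Finset.sum_mul]
    rw [Finset.sum_congr rfl fun t _ => Finset.sum_comm, Finset.sum_comm]
    refine Finset.sum_congr rfl fun i _ => Finset.sum_congr rfl fun t _ =>
      Finset.sum_congr rfl fun u _ => ?_
    rw [mul_inv]; ring
  have e2 : f = ∑ i, w i * f := by rw [← Finset.sum_mul, hsum, one_mul]
  rw [e1, e2, ← mul_sub, ← Finset.sum_sub_distrib, abs_mul, abs_of_nonneg (by positivity)]
  refine (mul_le_of_le_one_left (abs_nonneg _) two_pi_inv_le_one).trans ?_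
  refine (Finset.abs_sum_le_sum_abs _ _).trans ?_
  calc _ ≤ ∑ _i : Fin N, b * ∑' h : ℤ, min 2 ((1 / n + ρ) * |(h : ℝ)|) * |γ h| := by
        refine Finset.sum_le_sum fun i _ => ?_
        rw [← mul_sub, abs_mul]
        exact mul_le_mul (hw i) (abs_tsum_triangle_sub_le hn hγ (hs i)) (abs_nonneg _)
          ((abs_nonneg _).trans (hw i))
    _ = _ := by simp [mul_assoc]

end Spectral

end LocalQuad

/-! ### Consistency -/

theorem theorem4p2 {Ω : Type*} [MeasurableSpace Ω] (P : Measure Ω) [IsProbabilityMeasure P]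
    {m : ℕ} (X : ℤ → Ω → Fin m → ℝ)
    (hL2 : ∀ (t : ℤ) (a : Fin m), MemLp (fun ω => X t ω a) 2 P)
    (hA : LocalQuad.AssumptionA 4 P X) (hB : LocalQuad.AssumptionB P X)
    (K : ℝ → ℝ) (hK : LocalQuad.IsKernel K)
    (δ : ℕ → ℝ)
    (hM : Tendsto (fun n : ℕ => LocalQuad.numFreq (δ n) n) atTop atTop)
    (hMn : Tendsto (fun n : ℕ => (LocalQuad.numFreq (δ n) n : ℝ) / n) atTop (𝓝 0))
    (j k : Fin m) (θ : ℝ) (hθ : θ = 0 ∨ θ = Real.pi ∨ θ = -Real.pi) :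
    (∀ᶠ n : ℕ in atTop, IsUnit (LocalQuad.gramXWX K θ (δ n) n).det) ∧
    TendstoInMeasure P
      (fun (n : ℕ) (ω : Ω) =>
        ((LocalQuad.wlsEstimator K θ (δ n) n (fun t => X t ω) j k : ℝ) : ℂ))
      atTop (fun _ => LocalQuad.specDensity P X j k θ) := by
  obtain ⟨Cw, hCw⟩ := LocalQuad.exists_weights hK hM hθ
  obtain ⟨Cv, hCv0, hCv⟩ := hB.exists_integral_abs_le hL2 hA.summable j k
  refine ⟨hCw.mono fun n hn => hn.1, ?_⟩
  rw [tendstoInMeasure_iff_measureReal_norm]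
  intro η hη
  set f : ℝ := (2 * Real.pi)⁻¹ * ∑' h : ℤ, Real.cos (θ * h) * LocalQuad.autocov P X j k h
  rw [LocalQuad.specDensity_boundary hθ]
  let M : ℕ → ℝ := fun n => LocalQuad.numFreq (δ n) n
  have hMR : Tendsto M atTop atTop := tendsto_natCast_atTop_atTop.comp hM
  -- `1 / n` accounts for the triangular window and `2πM/n` for the distance of the frequencies from
  -- `|θ|`.
  let ρ : ℕ → ℝ := fun n => 1 / n + 2 * Real.pi * (M n / n)
  have hρ0 : ∀ n, 0 ≤ ρ n := fun n => by positivity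
  have hρ : Tendsto ρ atTop (𝓝 0) := by
    simpa [ρ, M] using (tendsto_one_div_atTop_nhds_zero_nat (𝕜 := ℝ)).add
      (hMn.const_mul (2 * Real.pi))
  -- With `N = M` and `b = Cw / M`, the deviation bound has `N * b ^ 2 = Cw ^ 2 / M` and the bias
  -- bound has `N * b = Cw`.
  let r : ℕ → ℝ := fun n => Real.sqrt (Cv * Cw ^ 2 * (M n)⁻¹) +
    Cw * ∑' h : ℤ, min 2 (ρ n * |(h : ℝ)|) * |LocalQuad.autocov P X j k h|
  have hr : Tendsto r atTop (𝓝 0) := by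
    have h1 := (hMR.inv_tendsto_atTop).const_mul (Cv * Cw ^ 2)
    have h2 := (Real.continuous_sqrt.tendsto _).comp h1
    have h3 := (LocalQuad.tendsto_tsum_min (hA.summable j k) hρ0 hρ).const_mul Cw
    simpa using h2.add h3
  have hsmall : ∀ᶠ n : ℕ in atTop, (LocalQuad.numFreq (δ n) n : ℝ) / n < 1 / 2 :=
    hMn.eventually_lt_const (by norm_num)
  have hr' : Tendsto (fun n => η⁻¹ * r n) atTop (𝓝 0) := by simpa using hr.const_mul η⁻¹
  refine squeeze_zero' (.of_forall fun n => measureReal_nonneg) ?_ hr'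
  filter_upwards [hCw, hsmall, hM.eventually_gt_atTop 0, eventually_gt_atTop 0] with
    n ⟨_, w, hw1, hwb, hest⟩ hn2 hM0 hn
  have hnR : (0 : ℝ) < n := by exact_mod_cast hn
  have hM0R : (0 : ℝ) < M n := Nat.cast_pos.2 hM0
  have h2M : 2 * LocalQuad.numFreq (δ n) n < n := by
    rw [div_lt_iff₀ hnR] at hn2
    have : (2 : ℝ) * LocalQuad.numFreq (δ n) n < n := by linarith
    exact_mod_cast this
  set s := LocalQuad.freqIndex θ (δ n) n
  have hs := LocalQuad.freqIndex_mem (θ := θ) h2M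
  have hinj := LocalQuad.freqIndex_injective θ (δ n) n
  let Q : Ω → ℝ := fun ω => ∑ p ∈ Finset.Icc (1 : ℤ) n ×ˢ Finset.Icc (1 : ℤ) n,
    LocalQuad.cosWeight n s w p.1 p.2 *
      ((X p.1 ω j - ∫ ω', X 0 ω' j ∂P) * (X p.2 ω k - ∫ ω', X 0 ω' k ∂P))
  let q : ℝ := ∑ p ∈ Finset.Icc (1 : ℤ) n ×ˢ Finset.Icc (1 : ℤ) n,
    LocalQuad.cosWeight n s w p.1 p.2 * LocalQuad.autocov P X j k (p.1 - p.2)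
  -- Centring at the sample mean is undone and the true mean is inserted; both are exact at these
  -- frequencies.
  have hQ : ∀ ω, LocalQuad.wlsEstimator K θ (δ n) n (fun t => X t ω) j k = Q ω := by
    intro ω
    simp only [Q]
    rw [hest, Finset.sum_product, LocalQuad.sum_cosWeight_mul n s w
      (fun t => X t ω j - ∫ ω', X 0 ω' j ∂P) (fun t => X t ω k - ∫ ω', X 0 ω' k ∂P), Finset.mul_sum]
    refine Finset.sum_congr rfl fun i _ => ?_
    rw [LocalQuad.responseY, LocalQuad.periodogram_re, LocalQuad.freq_eq_fourierFreq,
      LocalQuad.cosForm_sub_const (hs i) (fun t => X t ω j) (fun t => X t ω k),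
      LocalQuad.cosForm_sub_const (hs i) (fun t => X t ω j) (fun t => X t ω k)]
    ring
  have hdist : ∀ i, |(|θ| - LocalQuad.fourierFreq n (s i))| ≤ 2 * Real.pi * (M n / n) := by
    obtain ⟨e, he⟩ := LocalQuad.abs_sub_freq hθ (δ n) hn
    intro i
    rw [← LocalQuad.freq_eq_fourierFreq, he]
    refine mul_le_mul_of_nonneg_left (div_le_div_of_nonneg_right ?_ hnR.le) (by positivity)
    -- The offset is at most `1` and the grid index at most `M - 1`, so every distance is at most
    -- `M` steps.
    have h1 : (((e i : ℕ) + 1 : ℕ) : ℝ) ≤ M n :=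
      Nat.cast_le.2 (Nat.succ_le_of_lt (e i).2)
    push_cast at h1
    linarith [(LocalQuad.gridOffset_mem θ n).2]
  have hbias : |q - f| ≤ Cw * ∑' h : ℤ, min 2 (ρ n * |(h : ℝ)|) * |LocalQuad.autocov P X j k h| := by
    have := LocalQuad.abs_mean_sub_le hn (hA.summable j k) hwb hw1 hdist
    rwa [mul_div_cancel₀ _ hM0R.ne'] at this
  have hdev : ∫ ω, |Q ω - q| ∂P ≤ Real.sqrt (Cv * Cw ^ 2 * (M n)⁻¹) := by
    refine (hCv _ n s w _ hs hinj hwb).trans (Real.sqrt_le_sqrt (le_of_eq ?_))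
    have : (LocalQuad.numFreq (δ n) n : ℝ) = M n := rfl
    rw [this]
    field_simp
  have hU2 : ∀ t a, MemLp (fun ω => X t ω a - ∫ ω', X 0 ω' a ∂P) 2 P := fun t a =>
    (hL2 t a).sub (memLp_const _)
  have hiQ : Integrable Q P :=
    integrable_finsetSum _ fun p _ => ((hU2 p.1 j).integrable_mul (hU2 p.2 k)).const_mul _
  have hi1 : Integrable (fun ω => |Q ω - q|) P := (hiQ.sub (integrable_const _)).abs
  have hi2 : Integrable (fun ω => |Q ω - f|) P := (hiQ.sub (integrable_const _)).abs
  have htotal : ∫ ω, |Q ω - f| ∂P ≤ r n := by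
    calc _ ≤ ∫ ω, (|Q ω - q| + |q - f|) ∂P :=
          integral_mono hi2 (hi1.add (integrable_const _)) fun ω => abs_sub_le _ _ _
      _ = (∫ ω, |Q ω - q| ∂P) + |q - f| := by
          rw [integral_add hi1 (integrable_const _)]; simp
      _ ≤ _ := add_le_add hdev hbias
  -- Markov's inequality is applied to `|Q - f|`, whose mean is at most the deviation plus the bias.
  have hmarkov := mul_meas_ge_le_integral_of_nonneg (.of_forall fun ω => abs_nonneg (Q ω - f)) hi2 η
  have hset : {ω | η ≤ ‖((LocalQuad.wlsEstimator K θ (δ n) n (fun t => X t ω) j k : ℝ) : ℂ) -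
      (f : ℂ)‖} = {ω | η ≤ |Q ω - f|} := by
    ext ω
    rw [Set.mem_ofPred_eq, Set.mem_ofPred_eq, hQ, ← Complex.ofReal_sub, Complex.norm_real,
      Real.norm_eq_abs]
  rw [hset, ← div_eq_inv_mul, le_div_iff₀' hη]
  exact hmarkov.trans htotal
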